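/- **Notation.** Let $d\ge 1$ and $\mathscr X=(0,1)^d$. For $m\in\mathbb N$, let $\mathscr H^m_{\mathsf{mix}}$ be the order-$m$ Sobolev space with dominating mixed smoothness on $\mathscr X$: the set of $g\in L^2(\mathscr X)$ such that, for every multi-index $\alpha=(\alpha_1,\dots,\alpha_d)$ with $0\le\alpha_j\le m$ for all $j$, the weak partial derivative $\partial^{\alpha_1}_{x_1}\cdots\partial^{\alpha_d}_{x_d}g$ exists and lies in $L^2(\mathscr X)$. For each $j=1,\dots,d$ let $-\infty\le a_j\le 0$ and $1\le b_j\le\infty$, let $p_j,q_j$ be positive functions on $(a_j,b_j)$ with $p_j/q_j$ strictly increasing, and put $$k_j(x,y)=p_j(x\wedge y)\,q_j(x\vee y)\quad (x,y\in(a_j,b_j)),\qquad k(\mathbf x,\mathbf y)=\prod_{j=1}^d k_j(x_j,y_j)\quad\Bigl(\mathbf x,\mathbf y\in\mathscr I:=\prod_{j=1}^d(a_j,b_j)\Bigr).$$ These are positive semidefinite kernels; $\mathscr H_{k_j}$ and $\mathscr H_k$ denote their reproducing kernel Hilbert spaces, and for $g:(0,1)\to\mathbb R$ put $\|g\|_{\mathscr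 H_{k_j}(0,1)}=\inf\{\|h\|_{\mathscr H_{k_j}}: h\in\mathscr H_{k_j},\ h|_{(0,1)}=g\}$ (with $\inf\emptyset=\infty$). **Sturm–Liouville assumption.** For each $j$: 1. There are a continuously differentiable $u_j$ and a continuous $v_j$ on $(a_j,b_j)$ such that $p_j$ and $q_j$ are continuously differentiable and satisfy $\mathcal L_j[p_j]=\mathcal L_j[q_j]=0$ on $(a_j,b_j)$, where $\mathcal L_j[g]=-(u_jg')'+v_jg$. 2. With the same $u_j,v_j$, $\langle g,h\rangle_{\mathscr H_{k_j}}=\int_{a_j}^{b_j}g\,\mathcal L_j[h]\,dx$ (hence, exchanging $g$ and $h$, also $\langle g,h\rangle_{\mathscr H_{k_j}}=\int_{a_j}^{b_j}\mathcal L_j[g]\,h\,dx$) for all $g,h\in\mathscr H_{k_j}$ for which the distribution $\mathcal L_j[h]$ is a locally integrable function and $g\,\mathcal L_j[h]$ is integrable on $(a_j,b_j)$. 3. There are constants $C,\tilde C>0$ such that $C\int_0^1|D^1g|^2\,dx\le\|g\|^2_{\mathscr H_{k_j}(0,1)}$ for all $g:(0,1)\to\mathbb R$ and $\|g\|^2_{\mathscr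 H_{k_j}(0,1)}\le\tilde C\int_0^1\bigl(|g|^2+|D^1g|^2\bigr)dx$ for all continuous $g:(0,1)\to\mathbb R$, where $D^1g$ is the weak derivative and $\int_0^1|D^1g|^2\,dx=\infty$ if $D^1g$ does not exist. Moreover, for every $w\in L^2(a_j,b_j)$ the integral $\int_{a_j}^{b_j}k_j(x,s)w(s)\,ds$ converges absolutely for all $x\in(0,1)$, and as a function of $x$ it has a second weak derivative in $L^2(0,1)$. Let $\mathscr H^2_k$ be the set of $g\in\mathscr H_k$ for which there is $w\in L^2(\mathscr I)$ with $g(\mathbf x)=\int_{\mathscr I}k(\mathbf x,\mathbf s)w(\mathbf s)\,d\mathbf s$ (absolutely convergent) for all $\mathbf x\in\mathscr I$, and let $\mathscr H^2_k(\mathscr X)=\{h|_{\mathscr X}:h\in\mathscr H^2_k\}$. **Proposition.** Let $k$ satisfy the Sturm–Liouville assumption. Then $\mathscr H^2_k(\mathscr X)=\mathscr H^2_{\mathsf{mix}}$ as sets of functions, where functions that agree almost everywhere are identified. Precisely: a function $g:\mathscr X\to\mathbb R$ belongs to $\mathscr H^2_k(\mathscr X)$ if and only if it is continuous and belongs to $\mathscr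 H^2_{\mathsf{mix}}$; and $g$ belongs to $\mathscr H^2_{\mathsf{mix}}$ if and only if it agrees almost everywhere with some element of $\mathscr H^2_k(\mathscr X)$. -/

import Mathlib

open MeasureTheory
open scoped ENNReal ContDiff

/- Subsets of `ℝ` and of `ℝ^d` carry Lebesgue measure. -/
attribute [local instance] MeasureTheory.Measure.Subtype.measureSpace

/-! ### Test functions, weak derivatives, dominating mixed smoothness -/

/-- Smooth functions whose support is a compact subset of `S`. -/
def IsTestFunction {E : Type*} [NormedAddCommGroup E] [NormedSpace ℝ E] (S : Set E)
    (φ : E → ℝ) : Prop :=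
  ContDiff ℝ ∞ φ ∧ HasCompactSupport φ ∧ tsupport φ ⊆ S

/-- `f` is the weak derivative of order `m` of `g` on the set `S ⊆ ℝ`. -/
def IsWeakDeriv (S : Set ℝ) (m : ℕ) (g f : S → ℝ) : Prop :=
  LocallyIntegrable g ∧ LocallyIntegrable f ∧
    ∀ φ : ℝ → ℝ, IsTestFunction S φ →
      ∫ x : S, g x * iteratedDeriv m φ x = (-1) ^ m * ∫ x : S, f x * φ x

/-- The unit interval `(0,1)`. -/
abbrev unitIoo : Set ℝ := Set.Ioo 0 1

/-- The open unit cube `(0,1)^d`. -/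
def openCube (d : ℕ) : Set (Fin d → ℝ) := {x | ∀ j, x j ∈ unitIoo}

/-- The partial derivative `∂φ/∂x_j`. -/
noncomputable def partialDeriv {d : ℕ} (j : Fin d) (φ : (Fin d → ℝ) → ℝ) : (Fin d → ℝ) → ℝ :=
  fun x => fderiv ℝ φ x (Pi.single j 1)

/-- `∂^α φ`, the partial derivative of order `α j` in each variable `x_j`. -/
noncomputable def mixedPartial {d : ℕ} (α : Fin d → ℕ) (φ : (Fin d → ℝ) → ℝ) :
    (Fin d → ℝ) → ℝ :=
  (List.finRange d).foldr (fun j ψ => (partialDeriv j)^[α j] ψ) φ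

/-- `f` is the weak partial derivative `∂^α g` on `(0,1)^d`. -/
def IsWeakPartial {d : ℕ} (α : Fin d → ℕ) (g f : openCube d → ℝ) : Prop :=
  LocallyIntegrable g ∧ LocallyIntegrable f ∧
    ∀ φ : (Fin d → ℝ) → ℝ, IsTestFunction (openCube d) φ →
      ∫ x : openCube d, g x * mixedPartial α φ x
        = (-1) ^ (∑ j, α j) * ∫ x : openCube d, f x * φ x

/-- The order-`m` Sobolev space with dominating mixed smoothness on `(0,1)^d`: the functions in
`L²` all of whose weak partial derivatives of order at most `m` in each variable are in `L²`. -/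
def mixedSobolev (d m : ℕ) : Set (openCube d → ℝ) :=
  {g | MemLp g 2 ∧ ∀ α : Fin d → ℕ, (∀ j, α j ≤ m) → ∃ f, MemLp f 2 ∧ IsWeakPartial α g f}

/-! ### Real kernels and their reproducing kernel Hilbert spaces -/

/-- A real kernel as an operator-valued matrix, the form in which `RKHS.OfKernel` takes it. -/
def kernelMatrix {X : Type*} (k : X → X → ℝ) : Matrix X X (ℝ →L[ℝ] ℝ) :=
  Matrix.of fun x y => k x y • ContinuousLinearMap.id ℝ ℝ

/-- Scaled measures of intersections form a positive semidefinite kernel. -/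
theorem kernelMatrix_posSemidef {X α : Type*} [MeasurableSpace α] (μ : Measure α)
    (A : X → Set α) (hA : ∀ x, MeasurableSet (A x)) (hμ : ∀ x, μ (A x) ≠ ⊤) (c : X → ℝ)
    (k : X → X → ℝ) (hk : ∀ x y, k x y = c x * c y * μ.real (A x ∩ A y)) :
    (kernelMatrix k).PosSemidef := by
  have key := (RKHS.posSemidef_tfae (𝕜 := ℝ) (K := kernelMatrix k)).out 0 2
  rw [key]
  refine ⟨?_, fun w => ?_⟩
  · ext x y
    simp [kernelMatrix, star, hk x y, hk y x, Set.inter_comm (A x), mul_comm (c x),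
      ContinuousLinearMap.adjoint_id]
  · let e : X → Lp ℝ 2 μ := fun x => c x • indicatorConstLp 2 (hA x) (hμ x) (1 : ℝ)
    have he : ∀ x y, inner ℝ (e x) (e y) = k x y := by
      intro x y
      simp only [e, real_inner_smul_left, real_inner_smul_right]
      rw [L2.real_inner_indicatorConstLp_one_indicatorConstLp_one (hA x) (hA y) (hμ x) (hμ y), hk]
      ring
    have h0 : 0 ≤ inner ℝ (w.sum fun x r => r • e x) (w.sum fun x r => r • e x) :=
      real_inner_self_nonneg
    refine h0.trans_eq ?_
    simp only [Finsupp.sum, sum_inner, inner_sum, real_inner_smul_left, real_inner_smul_right, he,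
      map_sum, kernelMatrix, Matrix.of_apply]
    refine Finset.sum_congr rfl fun x _ => Finset.sum_congr rfl fun y _ => ?_
    simp
    ring

/-! ### Tensor Markov kernels -/

/-- The open interval of reals between two extended reals. -/
def erealIoo (a b : EReal) : Set ℝ := {x | a < (x : EReal) ∧ (x : EReal) < b}

/-- A tensor Markov kernel on `∏ (a_j, b_j)`, where `-∞ ≤ a_j ≤ 0` and `1 ≤ b_j ≤ ∞`, given by
positive functions `p_j`, `q_j` on `(a_j, b_j)` with `p_j / q_j` strictly increasing. -/
structure TensorMarkovKernel (d : ℕ) where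
  a : Fin d → EReal
  b : Fin d → EReal
  p : Fin d → ℝ → ℝ
  q : Fin d → ℝ → ℝ
  a_le : ∀ j, a j ≤ 0
  le_b : ∀ j, 1 ≤ b j
  p_pos : ∀ j, ∀ x ∈ erealIoo (a j) (b j), 0 < p j x
  q_pos : ∀ j, ∀ x ∈ erealIoo (a j) (b j), 0 < q j x
  strictMono : ∀ j, StrictMonoOn (fun x => p j x / q j x) (erealIoo (a j) (b j))

namespace TensorMarkovKernel

variable {d : ℕ} (T : TensorMarkovKernel d)

/-- The interval `(a_j, b_j)`. -/
def interval (j : Fin d) : Set ℝ := erealIoo (T.a j) (T.b j)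

/-- The box `∏ (a_j, b_j)`. -/
def box : Set (Fin d → ℝ) := {x | ∀ j, x j ∈ T.interval j}

/-- `k_j(x, y) = p_j(x ∧ y) q_j(x ∨ y)`. -/
def kernel₁ (j : Fin d) (x y : ℝ) : ℝ := T.p j (min x y) * T.q j (max x y)

/-- `k(x, y) = ∏ k_j(x_j, y_j)`. -/
def kernel (x y : Fin d → ℝ) : ℝ := ∏ j, T.kernel₁ j (x j) (y j)

theorem unitIoo_subset (j : Fin d) : unitIoo ⊆ T.interval j := fun x hx =>
  ⟨(T.a_le j).trans_lt (by exact_mod_cast hx.1), lt_of_lt_of_le (by exact_mod_cast hx.2) (T.le_b j)⟩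

theorem openCube_subset : openCube d ⊆ T.box := fun _ hx j => T.unitIoo_subset j (hx j)

theorem kernel₁_eq (j : Fin d) {x y : ℝ} (hx : x ∈ T.interval j) (hy : y ∈ T.interval j) :
    T.kernel₁ j x y
      = T.q j x * T.q j y * min (T.p j x / T.q j x) (T.p j y / T.q j y) := by
  have hqx := (T.q_pos j x hx).ne'
  have hqy := (T.q_pos j y hy).ne'
  rcases le_total x y with h | h
  · have := (T.strictMono j).monotoneOn hx hy h
    simp only [kernel₁, min_eq_left h, max_eq_right h]
    rw [min_eq_left this]; field_simp
  · have := (T.strictMono j).monotoneOn hy hx h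
    simp only [kernel₁, min_eq_right h, max_eq_left h]
    rw [min_eq_right this]; field_simp

theorem ratio_pos (j : Fin d) {x : ℝ} (hx : x ∈ T.interval j) : 0 < T.p j x / T.q j x :=
  div_pos (T.p_pos j x hx) (T.q_pos j x hx)

instance factPosSemidef₁ (j : Fin d) :
    Fact (kernelMatrix fun x y : T.interval j => T.kernel₁ j x y).PosSemidef := ⟨by
  refine kernelMatrix_posSemidef volume (fun x : T.interval j => Set.Ioc 0 (T.p j x / T.q j x))
    (fun _ => measurableSet_Ioc) (fun _ => by simp) (fun x => T.q j x)
    (fun x y : T.interval j => T.kernel₁ j x y) fun x y => ?_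
  rw [T.kernel₁_eq j x.2 y.2, Set.Ioc_inter_Ioc, Real.volume_real_Ioc_of_le]
  · simp
  · simpa using ⟨(T.ratio_pos j x.2).le, (T.ratio_pos j y.2).le⟩⟩

instance factPosSemidef :
    Fact (kernelMatrix fun x y : T.box => T.kernel x y).PosSemidef := ⟨by
  refine kernelMatrix_posSemidef volume
    (fun x => Set.univ.pi fun j => Set.Ioc 0 (T.p j (x.1 j) / T.q j (x.1 j)))
    (fun _ => MeasurableSet.univ_pi fun _ => measurableSet_Ioc)
    (fun x => by simp [Real.volume_pi_Ioc, ENNReal.prod_ne_top])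
    (fun x => ∏ j, T.q j (x.1 j)) _ fun x y => ?_
  rw [← Set.pi_inter_distrib, Measure.real, volume_pi_pi, ENNReal.toReal_prod,
    ← Finset.prod_mul_distrib, ← Finset.prod_mul_distrib, kernel]
  refine Finset.prod_congr rfl fun j _ => ?_
  have hx := T.ratio_pos j (x.2 j)
  have hy := T.ratio_pos j (y.2 j)
  rw [T.kernel₁_eq j (x.2 j) (y.2 j), Set.Ioc_inter_Ioc, Real.volume_Ioc,
    ENNReal.toReal_ofReal] <;> simp [hx.le, hy.le]⟩

/-- The reproducing kernel Hilbert space of `k_j` on `(a_j, b_j)`. -/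
abbrev Space₁ (j : Fin d) : Type :=
  RKHS.OfKernel (kernelMatrix fun x y : T.interval j => T.kernel₁ j x y)

/-- The reproducing kernel Hilbert space of `k` on `∏ (a_j, b_j)`. -/
abbrev Space : Type := RKHS.OfKernel (kernelMatrix fun x y : T.box => T.kernel x y)

/-! ### The Sturm–Liouville assumption -/

/-- `L[φ] = -(u φ')' + v φ`. -/
noncomputable def slOp (u v φ : ℝ → ℝ) (x : ℝ) : ℝ :=
  -deriv (fun y => u y * deriv φ y) x + v x * φ x

/-- `L[h] = f` in the sense of distributions on `S`; the operator `L` is formally symmetric. -/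
def IsWeakSL (S : Set ℝ) (u v : ℝ → ℝ) (h f : S → ℝ) : Prop :=
  LocallyIntegrable h ∧ LocallyIntegrable f ∧
    ∀ φ : ℝ → ℝ, IsTestFunction S φ → ∫ x : S, h x * slOp u v φ x = ∫ x : S, f x * φ x

/-- `p_j` and `q_j` are `C¹` solutions of `-(u g')' + v g = 0` on `(a_j, b_j)`, with `u` of class
`C¹` and `v` continuous. -/
def SolvesODE (j : Fin d) (u v : ℝ → ℝ) : Prop :=
  ContDiffOn ℝ 1 u (T.interval j) ∧ ContinuousOn v (T.interval j) ∧
    ∀ g ∈ ({T.p j, T.q j} : Set (ℝ → ℝ)), ContDiffOn ℝ 1 g (T.interval j) ∧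
      ∀ x ∈ T.interval j, DifferentiableAt ℝ (fun y => u y * deriv g y) x ∧ slOp u v g x = 0

/-- `⟨g, h⟩ = ∫ g L[h] = ∫ L[g] h` in the Hilbert space of `k_j`. The first equation is required
of all `g`, `h` for which `L[h]` is a function and `g L[h]` is integrable; the second is the first
with `g` and `h` exchanged. -/
def InnerEqSL (j : Fin d) (u v : ℝ → ℝ) : Prop :=
  ∀ (g h : T.Space₁ j) (f : T.interval j → ℝ), IsWeakSL (T.interval j) u v h f →
    Integrable (fun x => g x * f x) → inner ℝ g h = ∫ x, g x * f x

/-- The squared norm of `g` in the restriction to `(0,1)` of the Hilbert space of `k_j`; it is `∞`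
if `g` is not in the restriction. -/
noncomputable def restrNormSq (j : Fin d) (g : unitIoo → ℝ) : ℝ≥0∞ :=
  ⨅ (h : T.Space₁ j) (_ : ∀ x : unitIoo, h (Set.inclusion (T.unitIoo_subset j) x) = g x),
    ‖h‖ₑ ^ 2

/-- `∫ |D¹g|²` over `(0,1)` for the weak derivative `D¹g`; it is `∞` if there is none. -/
noncomputable def derivNormSq (g : unitIoo → ℝ) : ℝ≥0∞ :=
  ⨅ (f : unitIoo → ℝ) (_ : IsWeakDeriv unitIoo 1 g f), ∫⁻ x, ‖f x‖ₑ ^ 2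

/-- The restriction to `(0,1)` of the Hilbert space of `k_j` is the first-order Sobolev space, with
equivalent norms. -/
def RestrNormEquiv (j : Fin d) : Prop :=
  ∃ c C : ℝ, 0 < c ∧ 0 < C ∧
    (∀ g : unitIoo → ℝ, ENNReal.ofReal c * derivNormSq g ≤ T.restrNormSq j g) ∧
    ∀ g : unitIoo → ℝ, Continuous g →
      T.restrNormSq j g ≤ ENNReal.ofReal C * ((∫⁻ x, ‖g x‖ₑ ^ 2) + derivNormSq g)

/-- For `w` in `L²(a_j, b_j)`, the transform `∫ k_j(·, s) w(s) ds` is defined on `(0,1)` and has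
its second weak derivative in `L²(0,1)`. -/
def TransformRegular (j : Fin d) : Prop :=
  ∀ w : T.interval j → ℝ, MemLp w 2 →
    (∀ x ∈ unitIoo, Integrable fun s : T.interval j => T.kernel₁ j x s * w s) ∧
    ∃ f : unitIoo → ℝ, MemLp f 2 ∧
      IsWeakDeriv unitIoo 2 (fun x => ∫ s : T.interval j, T.kernel₁ j x s * w s) f

/-- The Sturm–Liouville assumption on a tensor Markov kernel. -/
def SturmLiouville : Prop :=
  ∀ j, (∃ u v : ℝ → ℝ, T.SolvesODE j u v ∧ T.InnerEqSL j u v) ∧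
    T.RestrNormEquiv j ∧ T.TransformRegular j

/-! ### The space of kernel integral transforms -/

/-- The elements of the Hilbert space of `k` of the form `∫ k(·, s) w(s) ds` with `w ∈ L²`. -/
def spaceTwo : Set T.Space :=
  {g | ∃ w : T.box → ℝ, MemLp w 2 ∧ ∀ x : T.box,
    Integrable (fun s : T.box => T.kernel x s * w s) ∧ g x = ∫ s : T.box, T.kernel x s * w s}

/-- The restrictions to `(0,1)^d` of the functions in `spaceTwo`. -/
def restrSpaceTwo : Set (openCube d → ℝ) :=
  {g | ∃ h ∈ T.spaceTwo, ∀ x : openCube d, h (Set.inclusion T.openCube_subset x) = g x}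

end TensorMarkovKernel

/-! In one variable, `f (x) = ∫ k (x, s) w (s) ds` satisfies `f' (x) = ∫ ∂ₓk (x, s) w (s) ds`, and
since `∂ₓk` jumps across the diagonal, where `p' q - p q'` is a multiple of `1 / u`, `f''` is
`∫ ∂ₓ²k (x, s) w (s) ds` minus a bounded multiple of `w`. For `x` in the unit interval and `s`
outside it the kernel is a product `p (x) q (s)` or `p (s) q (x)`, so the outer part of `w` only
matters through integrals against `q` or `p`. These operations act variable by variable, which gives
the mixed derivatives of the transform on the cube.

Conversely, for a test function `ψ` put `Ψ (s) = ∫ k (x, s) ψ (x) dx`. The Sturm–Liouville operator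
inverts the kernel, so integrating by parts writes `∫ f ψ` as integrals of `f`, `f'`, `f''` against
multiples of `Ψ`, plus boundary terms that are multiples of `Ψ (0)` and `Ψ (1)`. The interval
reaches beyond both `0` and `1`, and on the outer pieces `Ψ` is a known multiple of `Ψ (0)` or
`Ψ (1)`; hence mass placed there accounts for the boundary terms, and `∫ f ψ = ∫ w Ψ` for some
square-integrable `w`. Doing this in every variable exhibits a given mixed Sobolev function as a
transform. -/

/-! ### Functions on subsets -/

theorem extend_val_of_mem {E : Type*} {S : Set E} (g : S → ℝ) {x : E} (hx : x ∈ S) :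
    Function.extend Subtype.val g 0 x = g ⟨x, hx⟩ :=
  Subtype.val_injective.extend_apply g 0 (⟨x, hx⟩ : S)

section Subtype

variable {E : Type*} [MeasureSpace E] {S : Set E}

theorem integral_subtype_eq (hS : MeasurableSet S) {f : S → ℝ} {F : E → ℝ}
    (h : ∀ x : S, f x = F x) : ∫ x, f x = ∫ x in S, F x := by
  rw [← integral_subtype hS, integral_congr_ae (ae_of_all _ h)]

theorem map_val_volume (hS : MeasurableSet S) :
    (volume : Measure S).map Subtype.val = volume.restrict S :=
  map_comap_subtype_coe hS _

theorem memLp_subtype_iff (hS : MeasurableSet S) {f : S → ℝ} {F : E → ℝ}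
    (h : ∀ x : S, f x = F x) {p : ℝ≥0∞} : MemLp f p ↔ MemLp F p (volume.restrict S) := by
  rw [← map_val_volume hS, (MeasurableEmbedding.subtype_coe hS).memLp_map_measure_iff]
  exact iff_of_eq (congrArg (fun f => MemLp f p) (funext h))

theorem integrable_subtype_iff (hS : MeasurableSet S) {f : S → ℝ} {F : E → ℝ}
    (h : ∀ x : S, f x = F x) : Integrable f ↔ IntegrableOn F S := by
  rw [← memLp_one_iff_integrable, memLp_subtype_iff hS h, memLp_one_iff_integrable, IntegrableOn]

theorem ae_subtype_iff (hS : MeasurableSet S) {P : E → Prop} :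
    (∀ᵐ x : S, P x) ↔ ∀ᵐ x ∂volume.restrict S, P x := by
  rw [← map_val_volume hS, (MeasurableEmbedding.subtype_coe hS).ae_map_iff]

variable [TopologicalSpace E]

theorem locallyIntegrableOn_of_subtype [OpensMeasurableSpace E] (hS : IsOpen S) {f : S → ℝ}
    {F : E → ℝ} (h : ∀ x : S, f x = F x) (hf : LocallyIntegrable f) :
    LocallyIntegrableOn F S := by
  intro x hx
  obtain ⟨U, hU, hfU⟩ := hf ⟨x, hx⟩
  refine ⟨Subtype.val '' U, ?_, ?_⟩
  · rw [hS.nhdsWithin_eq hx]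
    exact hS.isOpenMap_subtype_val.image_mem_nhds hU
  · have hF : IntegrableOn F (Subtype.val '' U) ((volume : Measure S).map Subtype.val) := by
      rw [(MeasurableEmbedding.subtype_coe hS.measurableSet).integrableOn_map_iff,
        Set.preimage_image_eq _ Subtype.val_injective]
      exact (funext h : f = F ∘ Subtype.val) ▸ hfU
    rwa [map_val_volume hS.measurableSet, IntegrableOn, Measure.restrict_restrict_of_subset
      (Subtype.coe_image_subset S U)] at hF

theorem isLocallyFiniteMeasure_subtype [IsLocallyFiniteMeasure (volume : Measure E)]
    (hS : MeasurableSet S) : IsLocallyFiniteMeasure (volume : Measure S) := by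
  refine ⟨fun x => ?_⟩
  obtain ⟨U, hU, hfU⟩ := (volume : Measure E).finiteAt_nhds x
  refine ⟨Subtype.val ⁻¹' U, continuous_subtype_val.continuousAt hU, ?_⟩
  rw [show (volume : Measure S) = Measure.comap Subtype.val volume from rfl,
    (MeasurableEmbedding.subtype_coe hS).comap_apply]
  exact (measure_mono (Set.image_preimage_subset _ _)).trans_lt hfU

end Subtype

/-! ### Bounded measurable functions -/

/-- Bounded measurable functions. They are the functions whose products along the coordinates
multiply integrable functions on a product space into integrable ones. -/
def IsBddMeas {X : Type*} [MeasurableSpace X] (f : X → ℝ) : Prop :=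
  Measurable f ∧ ∃ C, ∀ x, ‖f x‖ ≤ C

namespace IsBddMeas

variable {X Y : Type*} [MeasurableSpace X] [MeasurableSpace Y] {f g : X → ℝ}

theorem const (c : ℝ) : IsBddMeas fun _ : X => c := ⟨measurable_const, ‖c‖, fun _ => le_rfl⟩

theorem comp {f : Y → ℝ} (hf : IsBddMeas f) {e : X → Y} (he : Measurable e) :
    IsBddMeas fun x => f (e x) :=
  ⟨hf.1.comp he, hf.2.imp fun _ h x => h (e x)⟩

theorem mul (hf : IsBddMeas f) (hg : IsBddMeas g) : IsBddMeas fun x => f x * g x := by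
  obtain ⟨hf, C, hC⟩ := hf
  obtain ⟨hg, D, hD⟩ := hg
  refine ⟨hf.mul hg, C * D, fun x => ?_⟩
  rw [norm_mul]
  exact mul_le_mul (hC x) (hD x) (norm_nonneg _) ((norm_nonneg _).trans (hC x))

theorem add (hf : IsBddMeas f) (hg : IsBddMeas g) : IsBddMeas fun x => f x + g x := by
  obtain ⟨hf, C, hC⟩ := hf
  obtain ⟨hg, D, hD⟩ := hg
  exact ⟨hf.add hg, C + D, fun x => (norm_add_le _ _).trans (add_le_add (hC x) (hD x))⟩

theorem ite (hf : IsBddMeas f) (hg : IsBddMeas g) {p : X → Prop} [DecidablePred p]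
    (hp : MeasurableSet {x | p x}) : IsBddMeas fun x => if p x then f x else g x := by
  obtain ⟨hf, C, hC⟩ := hf
  obtain ⟨hg, D, hD⟩ := hg
  refine ⟨Measurable.ite hp hf hg, max C D, fun x => ?_⟩
  dsimp only
  split_ifs
  exacts [(hC x).trans (le_max_left _ _), (hD x).trans (le_max_right _ _)]

theorem indicator (hf : IsBddMeas f) {A : Set X} (hA : MeasurableSet A) :
    IsBddMeas (A.indicator f) :=
  ⟨hf.1.indicator hA, hf.2.imp fun _ hC x => (norm_indicator_le_norm_self _ _).trans (hC x)⟩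

theorem finset_prod {ι : Type*} [Fintype ι] {F : ι → X → ℝ} (hF : ∀ i, IsBddMeas (F i)) :
    IsBddMeas fun x => ∏ i, F i x := by
  choose hm C hC using hF
  refine ⟨Finset.measurable_prod _ fun i _ => hm i, ∏ i, C i, fun x => ?_⟩
  rw [norm_prod]
  exact Finset.prod_le_prod (fun _ _ => norm_nonneg _) fun i _ => hC i x

theorem pi_prod {ι : Type*} [Fintype ι] {F : ι → X → ℝ} (hF : ∀ i, IsBddMeas (F i)) :
    IsBddMeas fun x : ι → X => ∏ i, F i (x i) :=
  finset_prod fun i => (hF i).comp (measurable_pi_apply i)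

theorem memLp (hf : IsBddMeas f) {μ : Measure X} [IsFiniteMeasure μ] {p : ℝ≥0∞} :
    MemLp f p μ := by
  obtain ⟨hf, C, hC⟩ := hf
  exact MemLp.of_bound hf.aestronglyMeasurable C (ae_of_all _ hC)

theorem integrable (hf : IsBddMeas f) {μ : Measure X} [IsFiniteMeasure μ] : Integrable f μ :=
  memLp_one_iff_integrable.1 hf.memLp

theorem integrable_mul (hf : IsBddMeas f) {μ : Measure X} (hg : Integrable g μ) :
    Integrable (fun x => g x * f x) μ := by
  obtain ⟨hf, C, hC⟩ := hf
  exact hg.mul_bdd hf.aestronglyMeasurable (ae_of_all _ hC)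

end IsBddMeas

/-! ### Test functions -/

namespace IsTestFunction

variable {E : Type*} [NormedAddCommGroup E] [NormedSpace ℝ E] {S : Set E} {φ ψ : E → ℝ}

theorem eq_zero (h : IsTestFunction S φ) {x : E} (hx : x ∉ S) : φ x = 0 :=
  image_eq_zero_of_notMem_tsupport fun h' => hx (h.2.2 h')

theorem continuous (h : IsTestFunction S φ) : Continuous φ := h.1.continuous

theorem isBddMeas [MeasurableSpace E] [BorelSpace E] (h : IsTestFunction S φ) : IsBddMeas φ :=
  ⟨h.continuous.measurable, h.2.1.exists_bound_of_continuous h.continuous⟩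

theorem sub (h : IsTestFunction S φ) (h' : IsTestFunction S ψ) :
    IsTestFunction S (fun x => φ x - ψ x) :=
  ⟨h.1.sub h'.1, h.2.1.sub h'.2.1, (tsupport_sub φ ψ).trans (Set.union_subset h.2.2 h'.2.2)⟩

theorem const_mul (h : IsTestFunction S φ) (c : ℝ) : IsTestFunction S (fun x => c * φ x) :=
  ⟨contDiff_const.mul h.1, h.2.1.mul_left, tsupport_mul_subset_right.trans h.2.2⟩

theorem contDiff_mul (h : IsTestFunction S φ) (hS : IsOpen S) {F : E → ℝ} {n : ℕ}
    (hF : ContDiffOn ℝ n F S) : ContDiff ℝ n fun x => F x * φ x := by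
  refine contDiff_iff_contDiffAt.2 fun x => ?_
  by_cases hx : x ∈ S
  · exact (hF.contDiffAt (hS.mem_nhds hx)).mul (h.1.of_le (by exact_mod_cast le_top)).contDiffAt
  · have hzero := notMem_tsupport_iff_eventuallyEq.1 fun hx' => hx (h.2.2 hx')
    refine (contDiff_const (c := (0 : ℝ))).contDiffAt.congr_of_eventuallyEq ?_
    filter_upwards [hzero] with y hy
    simp [hy]

theorem integrableOn_mul [MeasurableSpace E] [BorelSpace E] {μ : Measure E}
    (h : IsTestFunction S φ) {f : E → ℝ} (hf : LocallyIntegrableOn f S μ) :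
    IntegrableOn (fun x => f x * φ x) S μ := by
  have hsupp : IntegrableOn (fun x => f x * φ x) (tsupport φ) μ :=
    h.isBddMeas.integrable_mul (hf.integrableOn_compact_subset h.2.2 h.2.1)
  refine ((integrableOn_iff_integrable_of_support_subset ?_).1 hsupp).integrableOn
  exact (Function.support_mul_subset_right _ _).trans (subset_tsupport φ)

variable {I : Set ℝ} {η : ℝ → ℝ}

theorem deriv (h : IsTestFunction I η) : IsTestFunction I (deriv η) :=
  ⟨(contDiff_infty_iff_deriv.1 h.1).2, h.2.1.deriv,
    (closure_minimal support_deriv_subset isClosed_closure).trans h.2.2⟩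

theorem hasDerivAt (h : IsTestFunction I η) (x : ℝ) : HasDerivAt η (_root_.deriv η x) x :=
  (h.1.differentiable (by norm_num)).differentiableAt.hasDerivAt

theorem integrable (h : IsTestFunction I η) : Integrable η :=
  h.continuous.integrable_of_hasCompactSupport h.2.1

theorem setIntegral_eq (h : IsTestFunction I η) : ∫ x in I, η x = ∫ x, η x :=
  setIntegral_eq_integral_of_forall_compl_eq_zero fun _ hx => h.eq_zero hx

theorem setIntegral_mul_deriv (h : IsTestFunction I η) (hI : IsOpen I) {F F' : ℝ → ℝ}
    (hF : ∀ x ∈ I, HasDerivAt F (F' x) x) (hF' : ContinuousOn F' I) :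
    ∫ x in I, F x * _root_.deriv η x = -∫ x in I, F' x * η x := by
  have hFc : ContinuousOn F I := fun x hx => (hF x hx).continuousAt.continuousWithinAt
  have hsmooth : ContDiff ℝ 1 fun x => F x * η x := by
    refine h.contDiff_mul hI ((contDiffOn_succ_iff_deriv_of_isOpen (n := 0) hI).2
      ⟨fun x hx => (hF x hx).differentiableAt.differentiableWithinAt, by simp, ?_⟩)
    exact contDiffOn_zero.2 (hF'.congr fun x hx => (hF x hx).deriv)
  have hsupp : HasCompactSupport fun x => F x * η x := h.2.1.mul_left
  have hprod : ∀ x, x ∉ I → _root_.deriv (fun x => F x * η x) x = 0 := fun x hx =>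
    image_eq_zero_of_notMem_tsupport fun hx' => hx
      (h.2.2 (tsupport_mul_subset_right (tsupport_deriv_subset hx')))
  have htotal : ∫ x in I, _root_.deriv (fun x => F x * η x) x = 0 := by
    rw [setIntegral_eq_integral_of_forall_compl_eq_zero hprod]
    exact integral_eq_zero_of_hasDerivAt_of_integrable
      (fun x => (hsmooth.differentiable (by norm_num) x).hasDerivAt)
      ((hsmooth.continuous_deriv le_rfl).integrable_of_hasCompactSupport hsupp.deriv)
      (hsmooth.continuous.integrable_of_hasCompactSupport hsupp)
  have hleibniz : Set.EqOn (_root_.deriv fun x => F x * η x)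
      (fun x => F' x * η x + F x * _root_.deriv η x) I :=
    fun x hx => ((hF x hx).mul (h.hasDerivAt x)).deriv
  rw [setIntegral_congr_fun hI.measurableSet hleibniz,
    integral_add (h.integrableOn_mul (hF'.locallyIntegrableOn hI.measurableSet))
      (h.deriv.integrableOn_mul (hFc.locallyIntegrableOn hI.measurableSet))] at htotal
  linarith

end IsTestFunction

theorem exists_Icc_superset_of_isCompact_of_subset_unitIoo {K : Set ℝ} (hK : IsCompact K)
    (h : K ⊆ unitIoo) : ∃ a b : ℝ, 0 < a ∧ b < 1 ∧ K ⊆ Set.Icc a b := by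
  rcases K.eq_empty_or_nonempty with rfl | hne
  · exact ⟨1, 0, zero_lt_one, zero_lt_one, Set.empty_subset _⟩
  · obtain ⟨a, ha, hleast⟩ := hK.exists_isLeast hne
    obtain ⟨b, hb, hgreatest⟩ := hK.exists_isGreatest hne
    exact ⟨a, b, (h ha).1, (h hb).2, fun x hx => ⟨hleast hx, hgreatest hx⟩⟩

theorem exists_isTestFunction_unitIoo_integral_eq_one :
    ∃ ψ : ℝ → ℝ, IsTestFunction unitIoo ψ ∧ ∫ x, ψ x = 1 := by
  let f : ContDiffBump (1 / 2 : ℝ) := ⟨1 / 8, 1 / 4, by norm_num, by norm_num⟩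
  refine ⟨f.normed volume, ⟨f.contDiff_normed, f.hasCompactSupport_normed, ?_⟩, f.integral_normed⟩
  rw [f.tsupport_normed_eq, Real.closedBall_eq_Icc]
  exact Set.Icc_subset_Ioo (by norm_num [f]) (by norm_num [f])

theorem IsTestFunction.exists_deriv_eq {ψ : ℝ → ℝ} (h : IsTestFunction unitIoo ψ)
    (h0 : ∫ x, ψ x = 0) : ∃ φ, IsTestFunction unitIoo φ ∧ _root_.deriv φ = ψ := by
  obtain ⟨a, b, ha, hb, hK⟩ := exists_Icc_superset_of_isCompact_of_subset_unitIoo h.2.1 h.2.2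
  have hout : ∀ x, x ∉ Set.Icc a b → ψ x = 0 := fun x hx =>
    image_eq_zero_of_notMem_tsupport fun h' => hx (hK h')
  have hder : ∀ x, HasDerivAt (fun x => ∫ t in (0 : ℝ)..x, ψ t) (ψ x) x := fun x =>
    intervalIntegral.integral_hasDerivAt_right (h.continuous.intervalIntegrable _ _)
      (h.continuous.stronglyMeasurableAtFilter _ _) h.continuous.continuousAt
  have hderiv : _root_.deriv (fun x => ∫ t in (0 : ℝ)..x, ψ t) = ψ :=
    funext fun x => (hder x).deriv
  have hsupp : Function.support (fun x => ∫ t in (0 : ℝ)..x, ψ t) ⊆ Set.Icc a b := by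
    refine fun x hx => by_contra fun hx' => hx ?_
    rcases not_and_or.1 hx' with hxa | hxb
    · refine (intervalIntegral.integral_congr (g := fun _ => 0) fun t ht => ?_).trans (by simp)
      exact hout t fun ht' => (ht.2.trans_lt (max_lt ha (not_le.1 hxa))).not_ge ht'.1
    · refine Eq.trans (intervalIntegral.integral_eq_integral_of_support_subset fun t ht => ?_) h0
      have ht' : t ∈ Set.Icc a b := by_contra fun ht' => ht (hout t ht')
      exact ⟨ha.trans_le ht'.1, ht'.2.trans (not_le.1 hxb).le⟩
  exact ⟨_, ⟨contDiff_infty_iff_deriv.2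
      ⟨fun x => (hder x).differentiableAt, by rw [hderiv]; exact h.1⟩,
    HasCompactSupport.of_support_subset_isCompact isCompact_Icc hsupp,
    (closure_minimal hsupp isClosed_Icc).trans (Set.Icc_subset_Ioo ha hb)⟩, hderiv⟩

/-! ### Weak derivatives on the unit interval -/

/-- Lebesgue measure on the unit interval, as a measure on `ℝ`. -/
noncomputable abbrev unitVolume : Measure ℝ := volume.restrict unitIoo

theorem integral_unitVolume_eq (f : ℝ → ℝ) : ∫ x, f x ∂unitVolume = ∫ x in (0 : ℝ)..1, f x := by
  rw [intervalIntegral.integral_of_le zero_le_one, integral_Ioc_eq_integral_Ioo]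

theorem intervalIntegrable_zero_one_iff {f : ℝ → ℝ} :
    IntervalIntegrable f volume 0 1 ↔ Integrable f unitVolume :=
  intervalIntegrable_iff_integrableOn_Ioo_of_le zero_le_one

theorem ae_eq_zero_of_integral_mul_test {θ : ℝ → ℝ} (hθ : LocallyIntegrableOn θ unitIoo)
    (h : ∀ φ, IsTestFunction unitIoo φ → ∫ x, θ x * φ x ∂unitVolume = 0) :
    θ =ᵐ[unitVolume] 0 := by
  refine (ae_restrict_iff' measurableSet_Ioo).2 ?_
  refine isOpen_Ioo.ae_eq_zero_of_integral_contDiff_smul_eq_zero hθ fun φ h₁ h₂ h₃ => ?_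
  have hφ : IsTestFunction unitIoo φ := ⟨h₁, h₂, h₃⟩
  rw [← setIntegral_eq_integral_of_forall_compl_eq_zero fun x hx => by
    rw [hφ.eq_zero hx, zero_smul], ← h φ hφ]
  simp only [smul_eq_mul, mul_comm]

/-- The du Bois-Reymond lemma. -/
theorem exists_ae_eq_const_of_integral_mul_deriv {h : ℝ → ℝ} (hh : LocallyIntegrableOn h unitIoo)
    (hw : ∀ φ, IsTestFunction unitIoo φ → ∫ x, h x * deriv φ x ∂unitVolume = 0) :
    ∃ C : ℝ, ∀ᵐ x ∂unitVolume, h x = C := by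
  obtain ⟨ψ₀, hψ₀, hψ₀_one⟩ := exists_isTestFunction_unitIoo_integral_eq_one
  set C := ∫ x, h x * ψ₀ x ∂unitVolume with hC
  have hconst : LocallyIntegrableOn (fun _ => C) unitIoo :=
    (locallyIntegrable_const C).locallyIntegrableOn _
  refine ⟨C, ?_⟩
  suffices hzero : (fun x => h x - C) =ᵐ[unitVolume] 0 by
    filter_upwards [hzero] with x hx using sub_eq_zero.1 hx
  refine ae_eq_zero_of_integral_mul_test (hh.sub hconst) fun ψ hψ => ?_
  obtain ⟨φ, hφ, hφψ⟩ := (hψ.sub (hψ₀.const_mul (∫ x, ψ x))).exists_deriv_eq (by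
    rw [integral_sub hψ.integrable (hψ₀.integrable.const_mul _), integral_const_mul, hψ₀_one,
      mul_one, sub_self])
  have horth := hw φ hφ
  have hsplit : ∀ x, h x * (ψ x - (∫ x, ψ x) * ψ₀ x)
      = h x * ψ x - (∫ x, ψ x) * (h x * ψ₀ x) := fun x => by ring
  simp_rw [hφψ, hsplit] at horth
  rw [integral_sub (hψ.integrableOn_mul hh) ((hψ₀.integrableOn_mul hh).const_mul _),
    integral_const_mul, ← hC] at horth
  simp_rw [sub_mul]
  rw [integral_sub (hψ.integrableOn_mul hh) (hψ.integrableOn_mul hconst), integral_const_mul,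
    hψ.setIntegral_eq]
  linarith

theorem integral_indefinite_mul_deriv {f X : ℝ → ℝ} (hf : Integrable f unitVolume)
    (hX : AbsolutelyContinuousOnInterval X 0 1) :
    ∫ x, (∫ t in (0 : ℝ)..x, f t) * deriv X x ∂unitVolume
      = (∫ t in (0 : ℝ)..1, f t) * X 1 - ∫ x, f x * X x ∂unitVolume := by
  have hf' := intervalIntegrable_zero_one_iff.2 hf
  have hac := hf'.absolutelyContinuousOnInterval_intervalIntegral (c := 0) (by simp)
  have hderiv : ∫ x in (0 : ℝ)..1, deriv (fun x => ∫ t in (0 : ℝ)..x, f t) x * X x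
      = ∫ x in (0 : ℝ)..1, f x * X x := by
    refine intervalIntegral.integral_congr_ae ?_
    filter_upwards [hf'.ae_hasDerivAt_integral] with x hx hx'
    rw [(hx (Set.uIoc_subset_uIcc hx') 0 (by simp)).deriv]
  rw [integral_unitVolume_eq, integral_unitVolume_eq, hac.integral_mul_deriv_eq_deriv_mul hX,
    hderiv, intervalIntegral.integral_same, zero_mul, sub_zero]

theorem continuousOn_indefinite_integral {f : ℝ → ℝ} (hf : Integrable f unitVolume) :
    ContinuousOn (fun x => ∫ t in (0 : ℝ)..x, f t) (Set.Icc 0 1) := by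
  have hac := (intervalIntegrable_zero_one_iff.2
    hf).absolutelyContinuousOnInterval_intervalIntegral (c := 0) (by simp)
  simpa only [Set.uIcc_of_le zero_le_one] using hac.continuousOn

theorem ae_eq_const_add_integral {h h₁ : ℝ → ℝ} (hh : LocallyIntegrableOn h unitIoo)
    (hh₁ : Integrable h₁ unitVolume)
    (hw : ∀ φ, IsTestFunction unitIoo φ →
      ∫ x, h x * deriv φ x ∂unitVolume = -∫ x, h₁ x * φ x ∂unitVolume) :
    ∃ C : ℝ, ∀ᵐ x ∂unitVolume, h x = C + ∫ t in (0 : ℝ)..x, h₁ t := by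
  have hH : LocallyIntegrableOn (fun x => ∫ t in (0 : ℝ)..x, h₁ t) unitIoo :=
    ((continuousOn_indefinite_integral hh₁).mono Set.Ioo_subset_Icc_self).locallyIntegrableOn
      measurableSet_Ioo
  have hsub : LocallyIntegrableOn (fun x => h x - ∫ t in (0 : ℝ)..x, h₁ t) unitIoo := hh.sub hH
  obtain ⟨C, hC⟩ := exists_ae_eq_const_of_integral_mul_deriv hsub fun φ hφ => by
    simp_rw [sub_mul]
    rw [integral_sub (hφ.deriv.integrableOn_mul hh) (hφ.deriv.integrableOn_mul hH), hw φ hφ,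
      integral_indefinite_mul_deriv hh₁
        ((hφ.1.of_le (by norm_cast)).contDiffOn.absolutelyContinuousOnInterval),
      hφ.eq_zero (x := 1) (by simp)]
    ring
  exact ⟨C, by filter_upwards [hC] with x hx; linarith⟩

theorem absolutelyContinuousOnInterval_of_hasDerivAt {X X' : ℝ → ℝ} {a b : ℝ}
    (hX : ∀ x ∈ Set.uIcc a b, HasDerivAt X (X' x) x) (hX' : ContinuousOn X' (Set.uIcc a b)) :
    AbsolutelyContinuousOnInterval X a b := by
  obtain ⟨C, hC⟩ := isCompact_uIcc.exists_bound_of_continuousOn hX'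
  refine ((convex_uIcc a b).lipschitzOnWith_of_nnnorm_hasDerivWithin_le (C := C.toNNReal)
    (fun x hx => (hX x hx).hasDerivWithinAt) fun x hx => ?_).absolutelyContinuousOnInterval
  rw [← norm_toNNReal]
  exact Real.toNNReal_le_toNNReal (hC x hx)

/-- `h₁` is the weak derivative of `h` on `(0,1)`, both being integrable. In contrast to
`IsWeakDeriv` the functions live on `ℝ`, where their values outside `(0,1)` play no role. -/
structure HasIntegrableWeakDeriv (h h₁ : ℝ → ℝ) : Prop where
  integrable : Integrable h unitVolume
  integrable_deriv : Integrable h₁ unitVolume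
  integral_mul_deriv : ∀ φ, IsTestFunction unitIoo φ →
    ∫ x, h x * deriv φ x ∂unitVolume = -∫ x, h₁ x * φ x ∂unitVolume

namespace HasIntegrableWeakDeriv

variable {h h₁ : ℝ → ℝ}

theorem exists_boundary_values (hw : HasIntegrableWeakDeriv h h₁) :
    ∃ h_zero h_one : ℝ, ∀ X X' : ℝ → ℝ, (∀ x ∈ Set.Icc (0 : ℝ) 1, HasDerivAt X (X' x) x) →
      ContinuousOn X' (Set.Icc 0 1) →
      (∫ x, h x * X' x ∂unitVolume) + ∫ x, h₁ x * X x ∂unitVolume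
        = h_one * X 1 - h_zero * X 0 := by
  obtain ⟨C, hC⟩ := ae_eq_const_add_integral
    (show IntegrableOn h unitIoo volume from hw.integrable).locallyIntegrableOn
    hw.integrable_deriv
    hw.integral_mul_deriv
  refine ⟨C, C + ∫ t in (0 : ℝ)..1, h₁ t, fun X X' hX hX' => ?_⟩
  rw [← Set.uIcc_of_le zero_le_one] at hX hX'
  have hX'int : IntervalIntegrable X' volume 0 1 := hX'.intervalIntegrable
  have hHX' : Integrable (fun x => (∫ t in (0 : ℝ)..x, h₁ t) * X' x) unitVolume := by
    refine intervalIntegrable_zero_one_iff.1 (hX'int.continuousOn_mul ?_)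
    rw [Set.uIcc_of_le zero_le_one]
    exact continuousOn_indefinite_integral hw.integrable_deriv
  have hderiv : ∀ x ∈ unitIoo, (∫ t in (0 : ℝ)..x, h₁ t) * X' x
      = (∫ t in (0 : ℝ)..x, h₁ t) * deriv X x := fun x hx => by
    rw [(hX x (Set.Icc_subset_uIcc (Set.Ioo_subset_Icc_self hx))).deriv]
  have hsplit : ∫ x, h x * X' x ∂unitVolume
      = C * (X 1 - X 0) + ∫ x, (∫ t in (0 : ℝ)..x, h₁ t) * X' x ∂unitVolume := by
    have hX'int' := intervalIntegrable_zero_one_iff.1 hX'int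
    rw [← intervalIntegral.integral_eq_sub_of_hasDerivAt hX hX'int, ← integral_unitVolume_eq,
      ← integral_const_mul, ← integral_add (hX'int'.const_mul C) hHX']
    refine integral_congr_ae ?_
    filter_upwards [hC] with x hx
    rw [hx, add_mul]
  rw [hsplit, setIntegral_congr_fun measurableSet_Ioo hderiv,
    integral_indefinite_mul_deriv hw.integrable_deriv
      (absolutelyContinuousOnInterval_of_hasDerivAt hX hX')]
  ring

/-- Integration by parts. The boundary values of `h` are read off by testing against the affine
functions `x - 1` and `x`. -/
theorem integral_mul_deriv_add (hw : HasIntegrableWeakDeriv h h₁) {X X' : ℝ → ℝ}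
    (hX : ∀ x ∈ Set.Icc (0 : ℝ) 1, HasDerivAt X (X' x) x) (hX' : ContinuousOn X' (Set.Icc 0 1)) :
    (∫ x, h x * X' x ∂unitVolume) + ∫ x, h₁ x * X x ∂unitVolume
      = ((∫ x, h x ∂unitVolume) + ∫ x, h₁ x * x ∂unitVolume) * X 1
        - ((∫ x, h x ∂unitVolume) + ∫ x, h₁ x * (x - 1) ∂unitVolume) * X 0 := by
  obtain ⟨h_zero, h_one, hparts⟩ := hw.exists_boundary_values
  have hid := hparts (fun x => x) (fun _ => 1) (fun x _ => hasDerivAt_id x) continuousOn_const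
  have hshift := hparts (fun x => x - 1) (fun _ => 1) (fun x _ => (hasDerivAt_id x).sub_const 1)
    continuousOn_const
  simp only [mul_one, mul_zero, sub_zero, sub_self, zero_sub, mul_neg, neg_neg] at hid hshift
  rw [hparts X X' hX hX', hid, hshift]

end HasIntegrableWeakDeriv

/-! ### Product measures -/

/-- Lebesgue measure on the unit cube, as a measure on `ℝ^d`. -/
noncomputable abbrev cubeVolume (d : ℕ) : Measure (Fin d → ℝ) := Measure.pi fun _ => unitVolume

theorem openCube_eq_pi (d : ℕ) : openCube d = Set.univ.pi fun _ => unitIoo := by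
  ext x; simp [openCube]

theorem isOpen_openCube (d : ℕ) : IsOpen (openCube d) := by
  rw [openCube_eq_pi]; exact isOpen_set_pi Set.finite_univ fun _ _ => isOpen_Ioo

theorem measurableSet_openCube (d : ℕ) : MeasurableSet (openCube d) :=
  (isOpen_openCube d).measurableSet

theorem volume_restrict_openCube (d : ℕ) : volume.restrict (openCube d) = cubeVolume d := by
  rw [openCube_eq_pi, volume_pi, Measure.restrict_pi_pi]

section InsertNth

variable {X : Type*} [MeasurableSpace X] {n : ℕ} {m : Fin (n + 1) → Measure X}
  [∀ i, SigmaFinite (m i)] (i : Fin (n + 1))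

theorem integrable_pi_iff_insertNth {f : (Fin (n + 1) → X) → ℝ} :
    Integrable f (Measure.pi m) ↔ Integrable (fun z : X × (Fin n → X) => f (i.insertNth z.1 z.2))
      ((m i).prod (Measure.pi fun j => m (i.succAbove j))) :=
  ((measurePreserving_piFinSuccAbove m i).symm.integrable_comp_emb
    (MeasurableEquiv.measurableEmbedding _)).symm

theorem integral_pi_insertNth (f : (Fin (n + 1) → X) → ℝ) :
    ∫ x, f x ∂Measure.pi m = ∫ z : X × (Fin n → X), f (i.insertNth z.1 z.2)
      ∂(m i).prod (Measure.pi fun j => m (i.succAbove j)) :=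
  ((measurePreserving_piFinSuccAbove m i).symm.integral_comp
    (MeasurableEquiv.measurableEmbedding _) f).symm

end InsertNth

section ProductFunctions

variable {X : Type*} [MeasurableSpace X] {d : ℕ}

theorem integrable_mul_prod {ι : Type*} [Fintype ι] {m : ι → Measure X} {Θ : (ι → X) → ℝ}
    (hΘ : Integrable Θ (Measure.pi m)) {η : ι → X → ℝ} (hη : ∀ j, IsBddMeas (η j)) :
    Integrable (fun x => Θ x * ∏ j, η j (x j)) (Measure.pi m) :=
  (IsBddMeas.pi_prod hη).integrable_mul hΘ

theorem exists_integral_mul_prod_update_eq {m : Fin d → Measure X} [∀ i, SigmaFinite (m i)]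
    {Θ : (Fin d → X) → ℝ} (hΘ : Integrable Θ (Measure.pi m)) {η : Fin d → X → ℝ}
    (hη : ∀ j, IsBddMeas (η j)) (i : Fin d) :
    ∃ θ : X → ℝ, Integrable θ (m i) ∧ ∀ φ, IsBddMeas φ →
      ∫ x, Θ x * ∏ j, Function.update η i φ j (x j) ∂Measure.pi m = ∫ t, θ t * φ t ∂m i := by
  obtain ⟨n, rfl⟩ := Nat.exists_eq_add_one_of_ne_zero (Nat.ne_zero_of_lt i.2)
  have hint := (integrable_pi_iff_insertNth i).1 hΘ
  have hrest := (IsBddMeas.pi_prod fun j => hη (i.succAbove j)).comp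
    (measurable_snd (α := X) (β := Fin n → X))
  have hθ := hrest.integrable_mul hint
  refine ⟨_, hθ.integral_prod_left, fun φ hφ => ?_⟩
  rw [integral_pi_insertNth i]
  have hfactor : ∀ z : X × (Fin n → X), Θ (i.insertNth z.1 z.2) *
      ∏ j, Function.update η i φ j (i.insertNth (α := fun _ => X) z.1 z.2 j)
      = Θ (i.insertNth z.1 z.2) * (∏ j, η (i.succAbove j) (z.2 j)) * φ z.1 := fun z => by
    rw [Fin.prod_univ_succAbove _ i]
    simp only [Function.update_self, Fin.insertNth_apply_same, ne_eq, Fin.succAbove_ne,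
      not_false_eq_true, Function.update_of_ne, Fin.insertNth_apply_succAbove]
    ring
  simp_rw [hfactor]
  rw [integral_prod _ ((hφ.comp measurable_fst).integrable_mul hθ)]
  simp_rw [integral_mul_const]

theorem integral_mul_prod_eq_zero_of_separating {m : Fin d → Measure X} [∀ i, SigmaFinite (m i)]
    {P : Fin d → (X → ℝ) → Prop} (hP : ∀ i φ, P i φ → IsBddMeas φ) (S : Finset (Fin d))
    (hsep : ∀ i ∈ S, ∀ θ : X → ℝ, Integrable θ (m i) →
      (∀ φ, P i φ → ∫ t, θ t * φ t ∂m i = 0) → θ =ᵐ[m i] 0)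
    {Θ : (Fin d → X) → ℝ} (hΘ : Integrable Θ (Measure.pi m))
    (h : ∀ η : Fin d → X → ℝ, (∀ j, P j (η j)) → ∫ x, Θ x * ∏ j, η j (x j) ∂Measure.pi m = 0)
    {η : Fin d → X → ℝ} (hη : ∀ j, IsBddMeas (η j)) (hηS : ∀ j ∉ S, P j (η j)) :
    ∫ x, Θ x * ∏ j, η j (x j) ∂Measure.pi m = 0 := by
  induction S using Finset.induction_on generalizing η with
  | empty => exact h η fun j => hηS j (Finset.notMem_empty j)
  | insert i S hi ih =>
    obtain ⟨θ, hθ, hΘθ⟩ := exists_integral_mul_prod_update_eq hΘ hη i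
    have hθ_zero : θ =ᵐ[m i] 0 := hsep i (Finset.mem_insert_self i S) θ hθ fun φ hφ => by
      rw [← hΘθ φ (hP i φ hφ)]
      refine ih (fun i hi => hsep i (Finset.mem_insert_of_mem hi)) (fun j => ?_) fun j hj => ?_
      · rcases eq_or_ne j i with rfl | hji
        · simpa using hP j φ hφ
        · simpa [hji] using hη j
      · rcases eq_or_ne j i with rfl | hji
        · simpa using hφ
        · simpa [hji] using hηS j (by simp [hji, hj])
    rw [← Function.update_eq_self i η, hΘθ _ (hη i)]
    refine integral_eq_zero_of_ae ?_
    filter_upwards [hθ_zero] with t ht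
    simp [ht]

theorem ae_eq_zero_of_integral_mul_prod_eq_zero {μ : Measure (Fin d → X)}
    {Θ : (Fin d → X) → ℝ} (hΘ : Integrable Θ μ)
    (h : ∀ η : Fin d → X → ℝ, (∀ j, IsBddMeas (η j)) →
      ∫ x, Θ x * ∏ j, η j (x j) ∂μ = 0) : Θ =ᵐ[μ] 0 := by
  have hrect : ∀ A : Fin d → Set X, (∀ j, MeasurableSet (A j)) →
      ∫ x in Set.univ.pi A, Θ x ∂μ = 0 := fun A hA => by
    rw [← integral_indicator (MeasurableSet.univ_pi hA),
      ← h (fun j => (A j).indicator 1) fun j => (IsBddMeas.const 1).indicator (hA j)]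
    refine integral_congr_ae (ae_of_all _ fun x => ?_)
    classical
    simp [Set.indicator_apply, Finset.prod_ite_zero]
  refine hΘ.ae_eq_zero_of_forall_setIntegral_eq_zero fun s hs _ => ?_
  refine MeasurableSpace.induction_on_inter (C := fun s _ => ∫ x in s, Θ x ∂μ = 0)
    generateFrom_pi.symm isPiSystem_pi (by simp) ?_ ?_ ?_ s hs
  · rintro _ ⟨A, hA, rfl⟩
    exact hrect A fun j => hA j (Set.mem_univ j)
  · intro t ht hzero
    have hsplit := integral_add_compl ht hΘ
    have huniv := hrect (fun _ => Set.univ) fun _ => MeasurableSet.univ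
    rw [Set.pi_univ, setIntegral_univ] at huniv
    rwa [hzero, huniv, zero_add] at hsplit
  · intro f hdisj hf hzero
    rw [integral_iUnion hf hdisj hΘ.integrableOn]
    simp [hzero]

end ProductFunctions

theorem ae_eq_zero_of_integral_mul_prod_test {d : ℕ} {Θ : (Fin d → ℝ) → ℝ}
    (hΘ : Integrable Θ (cubeVolume d))
    (h : ∀ η : Fin d → ℝ → ℝ, (∀ j, IsTestFunction unitIoo (η j)) →
      ∫ x, Θ x * ∏ j, η j (x j) ∂cubeVolume d = 0) : Θ =ᵐ[cubeVolume d] 0 :=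
  ae_eq_zero_of_integral_mul_prod_eq_zero hΘ fun _ hη =>
    integral_mul_prod_eq_zero_of_separating (P := fun _ => IsTestFunction unitIoo)
      (fun _ _ hφ => hφ.isBddMeas) Finset.univ
      (fun _ _ _ hθ hzero => ae_eq_zero_of_integral_mul_test
        (show IntegrableOn _ unitIoo volume from hθ).locallyIntegrableOn hzero) hΘ h hη
      fun j hj => absurd (Finset.mem_univ j) hj

/-! ### Transfer of square-integrable functions along a pair of maps -/

section Transfer

variable {Ω X Y : Type*} [MeasurableSpace Ω] [MeasurableSpace X] [MeasurableSpace Y]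
  {M : Measure Ω} {μ : Measure X} {ν : Measure Y} {π : Ω → X} {ρ : Ω → Y}

theorem exists_memLp_integral_mul_comp (hρ : MeasurePreserving ρ M ν) {G : Ω → ℝ}
    (hG : MemLp G 2 M) :
    ∃ F : Y → ℝ, MemLp F 2 ν ∧ ∀ ψ : Y → ℝ, MemLp ψ 2 ν →
      ∫ y, F y * ψ y ∂ν = ∫ z, G z * ψ (ρ z) ∂M := by
  let pullback := (Lp.compMeasurePreservingₗᵢ (E := ℝ) (p := 2) ℝ ρ hρ).toContinuousLinearMap
  let F := ContinuousLinearMap.adjoint pullback (hG.toLp G)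
  refine ⟨F, Lp.memLp F, fun ψ hψ => ?_⟩
  have hadj : inner ℝ F (hψ.toLp ψ) = inner ℝ (hG.toLp G) (pullback (hψ.toLp ψ)) :=
    ContinuousLinearMap.adjoint_inner_left pullback _ _
  rw [L2.inner_def, L2.inner_def] at hadj
  calc ∫ y, F y * ψ y ∂ν = ∫ y, inner ℝ (F y) (hψ.toLp ψ y) ∂ν := by
        refine integral_congr_ae ?_
        filter_upwards [hψ.coeFn_toLp] with y hy
        simp [hy, mul_comm]
    _ = ∫ z, inner ℝ (hG.toLp G z) (pullback (hψ.toLp ψ) z) ∂M := hadj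
    _ = ∫ z, G z * ψ (ρ z) ∂M := by
        refine integral_congr_ae ?_
        filter_upwards [hG.coeFn_toLp, Lp.coeFn_compMeasurePreserving (hψ.toLp ψ) hρ,
          hρ.quasiMeasurePreserving.ae_eq_comp hψ.coeFn_toLp] with z h₁ h₂ h₃
        rw [h₁, show pullback (hψ.toLp ψ) z = ψ (ρ z) from h₂.trans h₃]
        simp [mul_comm]

theorem exists_memLp_integral_mul_comp_of_smul {a b : ℝ≥0∞}
    (hπ : MeasurePreserving π M (a • μ)) (hρ : MeasurePreserving ρ M (b • ν))
    (ha : a ≠ ⊤) (hb : b ≠ ⊤) {m : Ω → ℝ} (hm : IsBddMeas m) {f : X → ℝ} (hf : MemLp f 2 μ) :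
    ∃ F : Y → ℝ, MemLp F 2 ν ∧ ∀ ψ : Y → ℝ, MemLp ψ 2 ν →
      ∫ y, F y * ψ y ∂ν = ∫ z, m z * f (π z) * ψ (ρ z) ∂M := by
  obtain ⟨C, hC⟩ := hm.2
  have hG : MemLp (fun z => m z * f (π z)) 2 M :=
    ((hf.smul_measure ha).comp_measurePreserving hπ).mul (p := ⊤)
      (memLp_top_of_bound hm.1.aestronglyMeasurable C (ae_of_all _ hC))
  obtain ⟨F, hF, hFψ⟩ := exists_memLp_integral_mul_comp hρ hG
  rcases eq_or_ne b 0 with rfl | hb'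
  · refine ⟨0, MemLp.zero, fun ψ _ => ?_⟩
    rw [← hFψ ψ (by simp)]
    simp
  have hF' : MemLp F 2 ν := by
    refine hF.of_measure_le_smul (c := b⁻¹) (by simp [hb']) ?_
    rw [smul_smul, ENNReal.inv_mul_cancel hb' hb, one_smul]
  refine ⟨fun y => b.toReal * F y, hF'.const_mul _, fun ψ hψ => ?_⟩
  rw [← hFψ ψ (hψ.smul_measure hb), integral_smul_measure, smul_eq_mul]
  simp only [mul_assoc, integral_const_mul]

end Transfer

section TransferPi

variable {ι : Type*} [Fintype ι]

theorem pi_smul_measure {X : ι → Type*} [∀ i, MeasurableSpace (X i)] (c : ι → ℝ≥0∞)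
    (ν : ∀ i, Measure (X i)) [∀ i, SigmaFinite (ν i)] [∀ i, SigmaFinite (c i • ν i)] :
    Measure.pi (fun i => c i • ν i) = (∏ i, c i) • Measure.pi ν := by
  refine Measure.pi_eq fun s _ => ?_
  simp [Finset.prod_mul_distrib]

theorem measurePreserving_pi_smul {X Y : ι → Type*} [∀ i, MeasurableSpace (X i)]
    [∀ i, MeasurableSpace (Y i)] {m : ∀ i, Measure (X i)} {ν : ∀ i, Measure (Y i)}
    [∀ i, IsFiniteMeasure (ν i)] {c : ι → ℝ≥0∞} (hc : ∀ i, c i ≠ ⊤)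
    {f : ∀ i, X i → Y i} (hf : ∀ i, MeasurePreserving (f i) (m i) (c i • ν i)) :
    MeasurePreserving (fun x i => f i (x i)) (Measure.pi m) ((∏ i, c i) • Measure.pi ν) := by
  have : ∀ i, IsFiniteMeasure (c i • ν i) := fun i => (ν i).smul_finite (hc i)
  rw [← pi_smul_measure]
  exact measurePreserving_pi _ _ hf

variable {X Y Θ : Type*} [MeasurableSpace X] [MeasurableSpace Y] [MeasurableSpace Θ]
  {μ : ι → Measure X} {ν : ι → Measure Y} {θ : ι → Measure Θ} [∀ i, IsFiniteMeasure (μ i)]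
  [∀ i, IsFiniteMeasure (ν i)] [∀ i, IsFiniteMeasure (θ i)]

theorem integral_pi_prod_measure (f : (ι → X) → (ι → Θ) → ℝ) :
    ∫ z, f (fun i => (z i).1) (fun i => (z i).2) ∂Measure.pi (fun i => (μ i).prod (θ i))
      = ∫ y, f y.1 y.2 ∂(Measure.pi μ).prod (Measure.pi θ) :=
  (measurePreserving_arrowProdEquivProdArrow X Θ ι μ θ).integral_comp
    (MeasurableEquiv.measurableEmbedding _) fun y => f y.1 y.2

theorem IsBddMeas.prod_prodMk {K : ι → X × Θ → ℝ} (hK : ∀ i, IsBddMeas (K i)) :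
    IsBddMeas fun z : (ι → X) × (ι → Θ) => ∏ i, K i (z.1 i, z.2 i) :=
  IsBddMeas.finset_prod fun i =>
    (hK i).comp (e := fun z : (ι → X) × (ι → Θ) => (z.1 i, z.2 i)) (by fun_prop)

theorem exists_memLp_integral_mul_pi {c : ι → ℝ≥0∞} (hc : ∀ i, c i ≠ ⊤) {r : ι → X × Θ → Y}
    (hr : ∀ i, MeasurePreserving (r i) ((μ i).prod (θ i)) (c i • ν i)) {m : ι → X × Θ → ℝ}
    (hm : ∀ i, IsBddMeas (m i)) {f : (ι → X) → ℝ} (hf : MemLp f 2 (Measure.pi μ)) :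
    ∃ F : (ι → Y) → ℝ, MemLp F 2 (Measure.pi ν) ∧ ∀ φ : (ι → Y) → ℝ, IsBddMeas φ →
      ∫ y, F y * φ y ∂Measure.pi ν
        = ∫ x, f x * ∫ t, (∏ i, m i (x i, t i)) * φ (fun i => r i (x i, t i)) ∂Measure.pi θ
            ∂Measure.pi μ := by
  have hπ : MeasurePreserving (fun (z : ι → X × Θ) i => (z i).1)
      (Measure.pi fun i => (μ i).prod (θ i)) ((∏ i, θ i Set.univ) • Measure.pi μ) :=
    measurePreserving_pi_smul (f := fun _ => Prod.fst) (fun _ => measure_ne_top _ _)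
      fun i => ⟨measurable_fst, Measure.map_fst_prod⟩
  obtain ⟨F, hF, hFφ⟩ := exists_memLp_integral_mul_comp_of_smul hπ
    (measurePreserving_pi_smul hc hr) (ENNReal.prod_ne_top fun _ _ => measure_ne_top _ _)
    (ENNReal.prod_ne_top fun i _ => hc i)
    (IsBddMeas.finset_prod fun i => (hm i).comp (measurable_pi_apply i)) hf
  refine ⟨F, hF, fun φ hφ => ?_⟩
  have hint : Integrable (fun z : (ι → X) × (ι → Θ) =>
      (∏ i, m i (z.1 i, z.2 i)) * f z.1 * φ fun i => r i (z.1 i, z.2 i))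
      ((Measure.pi μ).prod (Measure.pi θ)) := by
    have hr' : Measurable fun (z : (ι → X) × (ι → Θ)) i => r i (z.1 i, z.2 i) :=
      measurable_pi_lambda _ fun i => (hr i).measurable.comp (by fun_prop)
    convert ((IsBddMeas.prod_prodMk hm).mul (hφ.comp hr')).integrable_mul
      ((hf.integrable (by norm_num)).comp_fst (Measure.pi θ)) using 2 with z
    ring
  rw [hFφ φ hφ.memLp, integral_pi_prod_measure fun x t =>
    (∏ i, m i (x i, t i)) * f x * φ fun i => r i (x i, t i), integral_prod _ hint]
  refine integral_congr_ae (ae_of_all _ fun x => ?_)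
  simp only [← integral_const_mul]
  refine integral_congr_ae (ae_of_all _ fun t => ?_)
  ring

end TransferPi

/-! ### Kernel operators with a multiplication part -/

section JumpOp

variable {X : Type*} [MeasurableSpace X] (μ ν : Measure X) (U : Set X) (K : X × X → ℝ) (J : X → ℝ)

/-- The operator `φ ↦ ∫ K(·, t) φ(t) dν(t) + 1_U J φ`. Its second part, the multiplication by a
jump `J`, is what differentiating a kernel with a kink on the diagonal produces. -/
noncomputable def jumpOp (φ : X → ℝ) (s : X) : ℝ :=
  ∫ t, K (s, t) * φ t ∂ν + U.indicator (fun s => J s * φ s) s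

open Classical in
/-- The points at which `φ` is evaluated when `jumpOp ν U K J φ s` is written as the single
integral of `jumpWeight ν U K J (s, ·) * φ (jumpPoint U (s, ·))` over `X × Bool`: the Boolean
selects one of the two parts of the operator, and the part without an integral is averaged
over `U`. -/
noncomputable def jumpPoint (z : X × X × Bool) : X :=
  (U ×ˢ U ×ˢ {false}).piecewise Prod.fst (fun z => z.2.1) z

open Classical in
/-- The weights that belong to the points `jumpPoint U`. -/
noncomputable def jumpWeight (z : X × X × Bool) : ℝ :=
  if z.2.2 then K (z.1, z.2.1) else (U ×ˢ U).indicator (fun y => J y.1 / ν.real U) (z.1, z.2.1)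

variable {μ ν U K J}

theorem isBddMeas_jumpWeight (hU : MeasurableSet U) (hK : IsBddMeas K) (hJ : IsBddMeas J) :
    IsBddMeas (jumpWeight ν U K J) := by
  refine (hK.comp (e := fun z : X × X × Bool => (z.1, z.2.1)) (by fun_prop)).ite
    (((((hJ.comp measurable_fst).mul (.const (ν.real U)⁻¹)).indicator (hU.prod hU))).comp
      (e := fun z : X × X × Bool => (z.1, z.2.1)) (by fun_prop)) ?_
  exact measurable_snd.snd (measurableSet_singleton true)

theorem measurable_jumpPoint (hU : MeasurableSet U) : Measurable (jumpPoint U) := by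
  classical
  exact measurable_fst.piecewise (hU.prod (hU.prod (measurableSet_singleton _))) measurable_snd.fst

theorem measurePreserving_jumpPoint [IsFiniteMeasure μ] [IsFiniteMeasure ν]
    (hU : MeasurableSet U) (hμν : μ.restrict U = ν.restrict U) :
    MeasurePreserving (jumpPoint U) (μ.prod (ν.prod .count))
      ((μ Set.univ * Measure.count (Set.univ : Set Bool)) • ν) := by
  classical
  have hS : MeasurableSet (U ×ˢ U ×ˢ ({false} : Set Bool)) :=
    hU.prod (hU.prod (measurableSet_singleton _))
  have hp := measurable_jumpPoint hU
  refine ⟨hp, ?_⟩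
  set M := μ.prod (ν.prod (.count : Measure Bool))
  set S := U ×ˢ U ×ˢ ({false} : Set Bool)
  have hsnd (N : Measure (X × X × Bool)) :
      N.map (fun z => z.2.1) = (N.map Prod.snd).map Prod.fst :=
    (Measure.map_map measurable_fst measurable_snd).symm
  have hsymm : (M.restrict S).map Prod.fst = (M.restrict S).map fun z => z.2.1 := by
    have hMS : M.restrict S
        = (ν.restrict U).prod ((ν.restrict U).prod (Measure.count.restrict {false})) := by
      rw [← Measure.prod_restrict, ← Measure.prod_restrict, hμν]
    rw [hMS, Measure.map_fst_prod, hsnd, Measure.map_snd_prod, Measure.map_smul,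
      Measure.map_fst_prod, smul_smul, ← Set.univ_prod_univ, Measure.prod_prod]
  calc M.map (jumpPoint U)
      = (M.restrict S).map (jumpPoint U) + (M.restrict Sᶜ).map (jumpPoint U) := by
        rw [← Measure.map_add _ _ hp, Measure.restrict_add_restrict_compl hS]
    _ = (M.restrict S).map (fun z => z.2.1) + (M.restrict Sᶜ).map fun z => z.2.1 := by
        rw [← hsymm]
        congr 1 <;> refine Measure.map_congr ?_
        · filter_upwards [ae_restrict_mem hS] with z hz using Set.piecewise_eq_of_mem _ _ _ hz
        · filter_upwards [ae_restrict_mem hS.compl] with z hz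
            using Set.piecewise_eq_of_notMem _ _ _ hz
    _ = M.map fun z => z.2.1 := by
        rw [← Measure.map_add _ _ measurable_snd.fst, Measure.restrict_add_restrict_compl hS]
    _ = (μ Set.univ * Measure.count (Set.univ : Set Bool)) • ν := by
        rw [hsnd, Measure.map_snd_prod, Measure.map_smul, Measure.map_fst_prod, smul_smul]

theorem integral_prod_count_bool [SigmaFinite ν] {f : X × Bool → ℝ}
    (hf : Integrable f (ν.prod .count)) :
    ∫ z, f z ∂ν.prod .count = ∫ t, f (t, true) ∂ν + ∫ t, f (t, false) ∂ν := by
  rw [integral_prod_symm _ hf, integral_fintype .of_finite]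
  simp

theorem integral_jumpWeight_mul [IsFiniteMeasure ν] (hU : MeasurableSet U) (hνU : ν U ≠ 0)
    (hK : IsBddMeas K) (hJ : IsBddMeas J) {φ : X → ℝ} (hφ : IsBddMeas φ) (s : X) :
    ∫ z, jumpWeight ν U K J (s, z) * φ (jumpPoint U (s, z)) ∂ν.prod .count
      = jumpOp ν U K J φ s := by
  classical
  rw [integral_prod_count_bool (((isBddMeas_jumpWeight hU hK hJ).mul
    (hφ.comp (measurable_jumpPoint hU))).comp measurable_prodMk_left).integrable, jumpOp]
  congr 1
  · simp [jumpWeight, jumpPoint, Set.piecewise]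
  · by_cases hs : s ∈ U
    · have : ∀ t, jumpWeight ν U K J (s, t, false) * φ (jumpPoint U (s, t, false))
          = U.indicator (fun _ => J s / ν.real U * φ s) t := fun t => by
        by_cases ht : t ∈ U <;> simp [jumpWeight, jumpPoint, Set.piecewise, hs, ht]
      have hνU' : ν.real U ≠ 0 := (measureReal_ne_zero_iff (measure_ne_top _ _)).2 hνU
      simp only [this, integral_indicator_const _ hU, Set.indicator_of_mem hs, smul_eq_mul]
      field_simp
    · simp [jumpWeight, hs]

section Pi

variable {ι : Type*} [Fintype ι] {μ ν : ι → Measure X} [∀ i, IsFiniteMeasure (μ i)]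
  [∀ i, IsFiniteMeasure (ν i)] {K : ι → X × X → ℝ} {J : ι → X → ℝ}

theorem exists_memLp_integral_mul_jump (hU : MeasurableSet U)
    (hμν : ∀ i, (μ i).restrict U = (ν i).restrict U) (hK : ∀ i, IsBddMeas (K i))
    (hJ : ∀ i, IsBddMeas (J i)) {f : (ι → X) → ℝ} (hf : MemLp f 2 (Measure.pi μ)) :
    ∃ F : (ι → X) → ℝ, MemLp F 2 (Measure.pi ν) ∧ ∀ φ : (ι → X) → ℝ, IsBddMeas φ →
      ∫ y, F y * φ y ∂Measure.pi ν
        = ∫ x, f x * ∫ z, (∏ i, jumpWeight (ν i) U (K i) (J i) (x i, z i))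
            * φ (fun i => jumpPoint U (x i, z i)) ∂Measure.pi (fun i => (ν i).prod .count)
            ∂Measure.pi μ :=
  exists_memLp_integral_mul_pi
    (fun _ => ENNReal.mul_ne_top (measure_ne_top _ _) (measure_ne_top _ _))
    (fun i => measurePreserving_jumpPoint hU (hμν i))
    (fun i => isBddMeas_jumpWeight hU (hK i) (hJ i)) hf

theorem exists_memLp_integral_mul_prod_jumpOp (hU : MeasurableSet U)
    (hμν : ∀ i, (μ i).restrict U = (ν i).restrict U) (hνU : ∀ i, ν i U ≠ 0)
    (hK : ∀ i, IsBddMeas (K i)) (hJ : ∀ i, IsBddMeas (J i)) {f : (ι → X) → ℝ}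
    (hf : MemLp f 2 (Measure.pi μ)) :
    ∃ F : (ι → X) → ℝ, MemLp F 2 (Measure.pi ν) ∧ ∀ φ : ι → X → ℝ, (∀ i, IsBddMeas (φ i)) →
      ∫ y, F y * ∏ i, φ i (y i) ∂Measure.pi ν
        = ∫ x, f x * ∏ i, jumpOp (ν i) U (K i) (J i) (φ i) (x i) ∂Measure.pi μ := by
  obtain ⟨F, hF, hFφ⟩ := exists_memLp_integral_mul_jump hU hμν hK hJ hf
  refine ⟨F, hF, fun φ hφ => ?_⟩
  rw [hFφ _ (IsBddMeas.pi_prod hφ)]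
  refine integral_congr_ae (ae_of_all _ fun x => ?_)
  simp only [← Finset.prod_mul_distrib]
  rw [integral_fintype_prod_eq_prod fun i z =>
    jumpWeight (ν i) U (K i) (J i) (x i, z) * φ i (jumpPoint U (x i, z))]
  simp only [integral_jumpWeight_mul hU (hνU _) (hK _) (hJ _) (hφ _)]

end Pi

end JumpOp

/-! ### Mixed partial derivatives -/

section MixedPartial

variable {d n : ℕ}

theorem IsTestFunction.comp_of_leftInverse {E F : Type*} [NormedAddCommGroup E] [NormedSpace ℝ E]
    [NormedAddCommGroup F] [NormedSpace ℝ F] {S : Set F} {S' : Set E} {φ : F → ℝ}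
    (h : IsTestFunction S φ) {f : E → F} {g : F → E} (hf : ContDiff ℝ ∞ f) (hg : Continuous g)
    (hgf : Function.LeftInverse g f) (hS : Set.MapsTo g S S') :
    IsTestFunction S' fun x => φ (f x) := by
  have hK : IsCompact (g '' tsupport φ) := h.2.1.image hg
  have hsub : tsupport (fun x => φ (f x)) ⊆ g '' tsupport φ :=
    closure_minimal (fun x hx => ⟨f x, subset_closure hx, hgf x⟩) hK.isClosed
  exact ⟨h.1.comp hf, hK.of_isClosed_subset isClosed_closure hsub,
    hsub.trans (Set.image_subset_iff.2 fun x hx => hS (h.2.2 hx))⟩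

theorem contDiff_cons_right (y : ℝ) :
    ContDiff ℝ ∞ fun z : Fin n → ℝ => (Fin.cons y z : Fin (n + 1) → ℝ) :=
  contDiff_pi.2 <| Fin.cases (by simpa using contDiff_const)
    fun j => by simpa using contDiff_apply ℝ ℝ j

theorem IsTestFunction.cons_right {φ : (Fin (n + 1) → ℝ) → ℝ}
    (h : IsTestFunction (openCube (n + 1)) φ) (y : ℝ) :
    IsTestFunction (openCube n) fun z => φ (Fin.cons y z) :=
  h.comp_of_leftInverse (g := Fin.tail) (contDiff_cons_right y) (by unfold Fin.tail; fun_prop)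
    (fun z => Fin.tail_cons (α := fun _ => ℝ) y z) fun _ hx j => hx j.succ

theorem contDiff_cons_left (z : Fin n → ℝ) :
    ContDiff ℝ ∞ fun y => (Fin.cons y z : Fin (n + 1) → ℝ) :=
  contDiff_pi.2 <| Fin.cases (by simpa using contDiff_fun_id)
    fun j => by simpa using contDiff_const

theorem IsTestFunction.cons_left {φ : (Fin (n + 1) → ℝ) → ℝ}
    (h : IsTestFunction (openCube (n + 1)) φ) (z : Fin n → ℝ) :
    IsTestFunction unitIoo fun y => φ (Fin.cons y z) :=
  h.comp_of_leftInverse (g := fun x => x 0) (contDiff_cons_left z) (by fun_prop) (fun _ => rfl)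
    fun _ hx => hx 0

/-- Partial derivatives of order `α j` in the variables listed in `l`, so that `mixedPartial α` is
the case in which `l` lists all variables. -/
noncomputable def listPartial (α : Fin d → ℕ) (φ : (Fin d → ℝ) → ℝ) (l : List (Fin d)) :
    (Fin d → ℝ) → ℝ :=
  l.foldr (fun j ψ => (partialDeriv j)^[α j] ψ) φ

section Smooth

variable {φ : (Fin d → ℝ) → ℝ}

theorem contDiff_iterate_partialDeriv (h : ContDiff ℝ ∞ φ) (j : Fin d) (m : ℕ) :
    ContDiff ℝ ∞ ((partialDeriv j)^[m] φ) := by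
  induction m with
  | zero => exact h
  | succ m ih =>
    rw [Function.iterate_succ_apply']
    exact (ih.fderiv_right (by norm_cast)).clm_apply contDiff_const

theorem contDiff_listPartial (h : ContDiff ℝ ∞ φ) (α : Fin d → ℕ) (l : List (Fin d)) :
    ContDiff ℝ ∞ (listPartial α φ l) := by
  induction l with
  | nil => exact h
  | cons j l ih => exact contDiff_iterate_partialDeriv ih j (α j)

theorem tsupport_iterate_partialDeriv_subset (φ : (Fin d → ℝ) → ℝ) (j : Fin d) (m : ℕ) :
    tsupport ((partialDeriv j)^[m] φ) ⊆ tsupport φ := by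
  induction m with
  | zero => rfl
  | succ m ih =>
    rw [Function.iterate_succ_apply']
    exact (tsupport_fderiv_apply_subset ℝ _).trans ih

theorem IsTestFunction.listPartial {S : Set (Fin d → ℝ)} (h : IsTestFunction S φ)
    (α : Fin d → ℕ) (l : List (Fin d)) : IsTestFunction S (listPartial α φ l) := by
  have hsub : tsupport (_root_.listPartial α φ l) ⊆ tsupport φ := by
    induction l with
    | nil => rfl
    | cons j l ih => exact (tsupport_iterate_partialDeriv_subset _ j _).trans ih
  exact ⟨contDiff_listPartial h.1 α l, h.2.1.of_isClosed_subset isClosed_closure hsub,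
    hsub.trans h.2.2⟩

theorem IsTestFunction.mixedPartial {S : Set (Fin d → ℝ)} (h : IsTestFunction S φ)
    (α : Fin d → ℕ) : IsTestFunction S (mixedPartial α φ) :=
  h.listPartial α _

theorem iteratedDeriv_update (h : ContDiff ℝ ∞ φ) (x : Fin d → ℝ) (i : Fin d) (m : ℕ) :
    iteratedDeriv m (fun y => φ (Function.update x i y))
      = fun y => (partialDeriv i)^[m] φ (Function.update x i y) := by
  induction m with
  | zero => simp
  | succ m ih =>
    rw [iteratedDeriv_succ, ih]
    funext y
    rw [Function.iterate_succ_apply']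
    exact (((contDiff_iterate_partialDeriv h i m).differentiable (by norm_num)
      _).hasFDerivAt.comp_hasDerivAt y (hasDerivAt_update x i y)).deriv

end Smooth

variable {φ : (Fin (n + 1) → ℝ) → ℝ}

theorem iterate_partialDeriv_zero_cons (h : ContDiff ℝ ∞ φ) (m : ℕ) (y : ℝ) (z : Fin n → ℝ) :
    (partialDeriv 0)^[m] φ (Fin.cons y z) = iteratedDeriv m (fun t => φ (Fin.cons t z)) y := by
  have := congrFun (iteratedDeriv_update h (Fin.cons y z) 0 m) y
  simpa only [Fin.update_cons_zero] using this.symm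

theorem iterate_partialDeriv_succ_cons (h : ContDiff ℝ ∞ φ) (j : Fin n) (m : ℕ) (y : ℝ) :
    (fun z => (partialDeriv j.succ)^[m] φ (Fin.cons y z))
      = (partialDeriv j)^[m] fun z => φ (Fin.cons y z) := by
  funext z
  have h₁ := congrFun (iteratedDeriv_update h (Fin.cons y z) j.succ m) (z j)
  have h₂ := congrFun (iteratedDeriv_update (h.comp (contDiff_cons_right y)) z j m) (z j)
  simp only [← Fin.cons_update, Function.comp, Function.update_eq_self] at h₁ h₂
  exact h₁.symm.trans h₂

theorem listPartial_map_succ_cons (h : ContDiff ℝ ∞ φ) (α : Fin (n + 1) → ℕ) (l : List (Fin n))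
    (y : ℝ) :
    (fun z => listPartial α φ (l.map Fin.succ) (Fin.cons y z))
      = listPartial (fun j => α j.succ) (fun z => φ (Fin.cons y z)) l := by
  induction l with
  | nil => rfl
  | cons j l ih =>
    refine (iterate_partialDeriv_succ_cons (contDiff_listPartial h α (l.map Fin.succ)) j _ y).trans
      ?_
    rw [ih]
    rfl

theorem listPartial_map_succ_finRange_cons (h : ContDiff ℝ ∞ φ) (α : Fin (n + 1) → ℕ) (y : ℝ)
    (z : Fin n → ℝ) :
    listPartial α φ ((List.finRange n).map Fin.succ) (Fin.cons y z)
      = mixedPartial (fun j => α j.succ) (fun z => φ (Fin.cons y z)) z :=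
  congrFun (listPartial_map_succ_cons h α _ y) z

theorem mixedPartial_cons (h : ContDiff ℝ ∞ φ) (α : Fin (n + 1) → ℕ) (y : ℝ) (z : Fin n → ℝ) :
    mixedPartial α φ (Fin.cons y z)
      = iteratedDeriv (α 0) (fun t => mixedPartial (fun j => α j.succ)
          (fun z => φ (Fin.cons t z)) z) y := by
  have hsplit : mixedPartial α φ
      = (partialDeriv 0)^[α 0] (listPartial α φ ((List.finRange n).map Fin.succ)) := by
    rw [mixedPartial, List.finRange_succ]
    rfl
  rw [hsplit, iterate_partialDeriv_zero_cons (contDiff_listPartial h α _)]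
  simp only [listPartial_map_succ_finRange_cons h]

theorem IsTestFunction.mixedPartial_cons_left (h : IsTestFunction (openCube (n + 1)) φ)
    (α : Fin n → ℕ) (z : Fin n → ℝ) :
    IsTestFunction unitIoo fun t => _root_.mixedPartial α (fun z => φ (Fin.cons t z)) z := by
  have := (h.listPartial (Fin.cons 0 α) ((List.finRange n).map Fin.succ)).cons_left z
  simpa only [listPartial_map_succ_finRange_cons h.1, Fin.cons_succ] using this

theorem mixedPartial_const_mul : ∀ {d : ℕ} {φ : (Fin d → ℝ) → ℝ} (_ : ContDiff ℝ ∞ φ)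
    (α : Fin d → ℕ) (c : ℝ), mixedPartial α (fun x => c * φ x) = fun x => c * mixedPartial α φ x
  | 0, _, _, _, _ => by simp [mixedPartial]
  | n + 1, φ, h, α, c => by
    funext x
    refine Fin.consCases (fun y z => ?_) x
    rw [mixedPartial_cons h, mixedPartial_cons (contDiff_const.mul h),
      ← iteratedDeriv_const_mul_field]
    congr 1
    funext t
    exact congrFun (mixedPartial_const_mul (h.comp (contDiff_cons_right t)) _ c) z

theorem contDiff_prod_apply {η : Fin d → ℝ → ℝ} (hη : ∀ j, ContDiff ℝ ∞ (η j)) :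
    ContDiff ℝ ∞ fun x : Fin d → ℝ => ∏ j, η j (x j) :=
  contDiff_prod fun j _ => (hη j).comp (contDiff_apply ℝ ℝ j)

theorem isTestFunction_prod {η : Fin d → ℝ → ℝ} (hη : ∀ j, IsTestFunction unitIoo (η j)) :
    IsTestFunction (openCube d) (fun x => ∏ j, η j (x j)) := by
  have hK : IsCompact (Set.univ.pi fun j => tsupport (η j)) :=
    isCompact_univ_pi fun j => (hη j).2.1
  have hsub : tsupport (fun x : Fin d → ℝ => ∏ j, η j (x j))
      ⊆ Set.univ.pi fun j => tsupport (η j) :=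
    closure_minimal (fun x hx j _ => subset_closure fun h₀ =>
      hx (Finset.prod_eq_zero (Finset.mem_univ j) h₀)) hK.isClosed
  exact ⟨contDiff_prod_apply fun j => (hη j).1, hK.of_isClosed_subset isClosed_closure hsub,
    fun x hx j => (hη j).2.2 (hsub hx j trivial)⟩

theorem mixedPartial_prod : ∀ {d : ℕ} {η : Fin d → ℝ → ℝ} (_ : ∀ j, ContDiff ℝ ∞ (η j))
    (α : Fin d → ℕ), mixedPartial α (fun x => ∏ j, η j (x j))
      = fun x => ∏ j, iteratedDeriv (α j) (η j) (x j)
  | 0, _, _, _ => by simp [mixedPartial]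
  | n + 1, η, h, α => by
    funext x
    refine Fin.consCases (fun y z => ?_) x
    have htail := mixedPartial_prod (fun j => h j.succ) fun j => α j.succ
    rw [mixedPartial_cons (contDiff_prod_apply h)]
    simp only [Fin.prod_univ_succ, Fin.cons_zero, Fin.cons_succ,
      mixedPartial_const_mul (contDiff_prod_apply fun j => h j.succ), htail]
    simp only [mul_comm (η 0 _), iteratedDeriv_const_mul_field]
    exact mul_comm _ _

section Integral

variable {Θ : Type*} [MeasurableSpace Θ]

theorem integral_mul_integral_mul_comm {X Y : Type*} [MeasurableSpace X] [MeasurableSpace Y]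
    {μ : Measure X} [SFinite μ] {ν : Measure Y} [SFinite ν] {f : X → ℝ} (hf : Integrable f μ)
    {g : Y → ℝ} (hg : Integrable g ν) {F : X × Y → ℝ} (hF : IsBddMeas F) :
    ∫ x, f x * ∫ y, g y * F (x, y) ∂ν ∂μ = ∫ y, g y * ∫ x, f x * F (x, y) ∂μ ∂ν := by
  have hswap := integral_integral_swap (f := fun x y => f x * g y * F (x, y))
    (hF.integrable_mul (hf.mul_prod hg))
  simp only [← integral_const_mul, ← mul_assoc]
  simp only [mul_comm (g _) (f _), hswap]

theorem integral_pi_prod_mul_eq_integral_cons {m : Fin (n + 1) → Measure Θ}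
    [∀ j, SigmaFinite (m j)] {e : Fin (n + 1) → Θ → ℝ} (he : ∀ j, Integrable (e j) (m j))
    {f : (Fin (n + 1) → Θ) → ℝ} (hf : IsBddMeas f) :
    ∫ t, (∏ j, e j (t j)) * f t ∂Measure.pi m
      = ∫ y, e 0 y * ∫ z, (∏ j, e j.succ (z j)) * f (Fin.cons y z)
          ∂Measure.pi (fun j => m j.succ) ∂m 0 := by
  have hint := (integrable_pi_iff_insertNth 0).1 (hf.integrable_mul (Integrable.fintype_prod he))
  rw [integral_pi_insertNth 0, integral_prod _ hint]
  simp only [Fin.insertNth_zero', Fin.succAbove_zero, Fin.prod_univ_succ, Fin.cons_zero,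
    Fin.cons_succ, mul_assoc, integral_const_mul]

theorem integral_prod_mul_mixedPartial : ∀ {d : ℕ} {m : Fin d → Measure ℝ}
    [∀ j, SigmaFinite (m j)] {θ : Fin d → Measure Θ} [∀ j, SigmaFinite (θ j)] {c : Fin d → ℝ → ℝ}
    {e r : Fin d → Θ → ℝ} {α : Fin d → ℕ} (_ : ∀ j, Integrable (c j) (m j))
    (_ : ∀ j, Integrable (e j) (θ j)) (_ : ∀ j, Measurable (r j))
    (_ : ∀ j ψ, IsTestFunction unitIoo ψ →
      ∫ x, c j x * iteratedDeriv (α j) ψ x ∂m j = ∫ t, e j t * ψ (r j t) ∂θ j)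
    {φ : (Fin d → ℝ) → ℝ} (_ : IsTestFunction (openCube d) φ),
    ∫ x, (∏ j, c j (x j)) * mixedPartial α φ x ∂Measure.pi m
      = ∫ t, (∏ j, e j (t j)) * φ (fun j => r j (t j)) ∂Measure.pi θ
  | 0, _, _, _, _, _, _, _, _, _, _, _, _, φ, _ => by
    rw [Measure.pi_of_empty _ isEmptyElim, Measure.pi_of_empty _ isEmptyElim, integral_dirac,
      integral_dirac]
    simp only [Finset.univ_eq_empty, Finset.prod_empty]
    exact congrArg (fun x => 1 * φ x) (Subsingleton.elim _ _)
  | n + 1, m, _, θ, _, c, e, r, α, hc, he, hr, h, φ, hφ => by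
    have hcons : Measurable fun z : (Fin n → ℝ) × ℝ => (Fin.cons z.2 z.1 : Fin (n + 1) → ℝ) :=
      measurable_pi_lambda _ (Fin.cases (by simpa using measurable_snd) fun j => by
        simpa using measurable_fst.eval)
    have hcons' : Measurable fun z : (Fin n → ℝ) × Θ =>
        (Fin.cons (r 0 z.2) z.1 : Fin (n + 1) → ℝ) :=
      hcons.comp (measurable_fst.prodMk ((hr 0).comp measurable_snd))
    have htail : IsBddMeas fun z : (Fin n → ℝ) × Θ =>
        mixedPartial (fun j => α j.succ) (fun y => φ (Fin.cons (r 0 z.2) y)) z.1 := by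
      simp only [← listPartial_map_succ_finRange_cons hφ.1 α]
      exact (hφ.listPartial α _).isBddMeas.comp hcons'
    have hc' := Integrable.fintype_prod fun j : Fin n => hc j.succ
    have hrm : Measurable fun (t : Fin (n + 1) → Θ) j => r j (t j) :=
      measurable_pi_lambda _ fun j => (hr j).comp (measurable_pi_apply j)
    rw [integral_pi_prod_mul_eq_integral_cons hc (hφ.mixedPartial α).isBddMeas,
      integral_pi_prod_mul_eq_integral_cons he (hφ.isBddMeas.comp hrm),
      ← integral_mul_integral_mul_comm hc' (hc 0) ((hφ.mixedPartial α).isBddMeas.comp hcons)]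
    simp only [mixedPartial_cons hφ.1, h 0 _ (hφ.mixedPartial_cons_left _ _)]
    rw [integral_mul_integral_mul_comm hc' (he 0) htail]
    refine integral_congr_ae (ae_of_all _ fun t => ?_)
    dsimp only
    rw [integral_prod_mul_mixedPartial (fun j => hc j.succ) (fun j => he j.succ)
      (fun j => hr j.succ) (fun j => h j.succ) (hφ.cons_right (r 0 t))]
    congr! 5 with z
    exact funext (Fin.cases rfl fun _ => rfl)

end Integral

end MixedPartial

/-! ### Kernels of the form `p (min x y) * q (max x y)` -/

/-- The point of `[0,1]` closest to `s`. -/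
noncomputable def unitClamp (s : ℝ) : ℝ := Set.projIcc 0 1 zero_le_one s

section UnitClamp

theorem unitClamp_mem (s : ℝ) : unitClamp s ∈ Set.Icc (0 : ℝ) 1 := (Set.projIcc 0 1 _ s).2

theorem unitClamp_of_mem {s : ℝ} (hs : s ∈ Set.Icc (0 : ℝ) 1) : unitClamp s = s := by
  rw [unitClamp, Set.projIcc_of_mem _ hs]

theorem unitClamp_of_nonpos {s : ℝ} (hs : s ≤ 0) : unitClamp s = 0 := by
  rw [unitClamp, Set.projIcc_of_le_left _ hs]

theorem unitClamp_of_one_le {s : ℝ} (hs : 1 ≤ s) : unitClamp s = 1 := by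
  rw [unitClamp, Set.projIcc_of_right_le _ hs]

theorem continuous_unitClamp : Continuous unitClamp :=
  continuous_subtype_val.comp continuous_projIcc

theorem le_of_pos_of_le_unitClamp {s x : ℝ} (hx : 0 < x) (h : x ≤ unitClamp s) : x ≤ s :=
  ((le_max_iff.1 h).resolve_left hx.not_ge).trans (min_le_right _ _)

theorem lt_of_le_one_of_unitClamp_lt {s x : ℝ} (hx : x ≤ 1) (h : unitClamp s < x) : s < x :=
  (min_lt_iff.1 (max_lt_iff.1 h).2).resolve_left hx.not_gt

theorem continuous_comp_unitClamp {f : ℝ → ℝ} (hf : ContinuousOn f (Set.Icc 0 1)) :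
    Continuous fun s => f (unitClamp s) :=
  hf.comp_continuous continuous_unitClamp unitClamp_mem

theorem isBddMeas_comp_unitClamp {f : ℝ → ℝ} (hf : ContinuousOn f (Set.Icc 0 1)) :
    IsBddMeas fun s => f (unitClamp s) := by
  obtain ⟨C, hC⟩ := isCompact_Icc.exists_bound_of_continuousOn hf
  exact ⟨(continuous_comp_unitClamp hf).measurable, C, fun s => hC _ (unitClamp_mem s)⟩

theorem IsTestFunction.comp_unitClamp {φ : ℝ → ℝ} (h : IsTestFunction unitIoo φ) (s : ℝ) :
    φ (unitClamp s) = φ s := by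
  by_cases hs : s ∈ unitIoo
  · rw [unitClamp_of_mem (Set.Ioo_subset_Icc_self hs)]
  · rw [h.eq_zero hs, h.eq_zero fun hs' =>
      hs ⟨lt_of_not_ge fun hs₀ => ?_, lt_of_not_ge fun hs₁ => ?_⟩]
    · exact hs'.1.ne' (unitClamp_of_nonpos hs₀)
    · exact hs'.2.ne (unitClamp_of_one_le hs₁)

theorem integral_ite_le_eq_add {f g : ℝ → ℝ} (hf : ContinuousOn f (Set.Icc 0 1))
    (hg : ContinuousOn g (Set.Icc 0 1)) (s : ℝ) :
    ∫ x, (if x ≤ s then f x else g x) ∂unitVolume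
      = (∫ x in 0..unitClamp s, f x) + ∫ x in unitClamp s..1, g x := by
  obtain ⟨hs₀, hs₁⟩ := unitClamp_mem s
  have hleft : ∀ x ∈ Set.uIoc 0 (unitClamp s), f x = if x ≤ s then f x else g x := fun x hx => by
    rw [Set.uIoc_of_le hs₀] at hx
    rw [if_pos (le_of_pos_of_le_unitClamp hx.1 hx.2)]
  have hright : ∀ x ∈ Set.uIoc (unitClamp s) 1, g x = if x ≤ s then f x else g x := fun x hx => by
    rw [Set.uIoc_of_le hs₁] at hx
    rw [if_neg (lt_of_le_one_of_unitClamp_lt hx.2 hx.1).not_ge]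
  have hfint : IntervalIntegrable f volume 0 (unitClamp s) := (hf.mono (by
    rw [Set.uIcc_of_le hs₀]; exact Set.Icc_subset_Icc_right hs₁)).intervalIntegrable
  have hgint : IntervalIntegrable g volume (unitClamp s) 1 := (hg.mono (by
    rw [Set.uIcc_of_le hs₁]; exact Set.Icc_subset_Icc_left hs₀)).intervalIntegrable
  rw [integral_unitVolume_eq, ← intervalIntegral.integral_add_adjacent_intervals
    (hfint.congr hleft) (hgint.congr hright),
    ← intervalIntegral.integral_congr_ae (ae_of_all _ hleft),
    ← intervalIntegral.integral_congr_ae (ae_of_all _ hright)]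

theorem IsTestFunction.intervalIntegral_mul_deriv {φ : ℝ → ℝ} (h : IsTestFunction unitIoo φ)
    {f f' : ℝ → ℝ} {a b : ℝ} (hf : ∀ x ∈ Set.Icc (0 : ℝ) 1, HasDerivAt f (f' x) x)
    (hf' : ContinuousOn f' (Set.Icc 0 1)) (ha : a ∈ Set.Icc (0 : ℝ) 1)
    (hb : b ∈ Set.Icc (0 : ℝ) 1) :
    ∫ x in a..b, f x * _root_.deriv φ x = f b * φ b - f a * φ a - ∫ x in a..b, f' x * φ x := by
  have hsub : Set.uIcc a b ⊆ Set.Icc 0 1 := Set.uIcc_subset_Icc ha hb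
  exact intervalIntegral.integral_mul_deriv_eq_deriv_mul (fun x hx => hf x (hsub hx))
    (fun x _ => h.hasDerivAt x) (hf'.mono hsub).intervalIntegrable
    (h.deriv.continuous.intervalIntegrable _ _)

theorem integral_ite_le_mul_deriv {f f' g g' : ℝ → ℝ}
    (hf : ∀ x ∈ Set.Icc (0 : ℝ) 1, HasDerivAt f (f' x) x) (hf' : ContinuousOn f' (Set.Icc 0 1))
    (hg : ∀ x ∈ Set.Icc (0 : ℝ) 1, HasDerivAt g (g' x) x) (hg' : ContinuousOn g' (Set.Icc 0 1))
    {φ : ℝ → ℝ} (hφ : IsTestFunction unitIoo φ) (s : ℝ) :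
    ∫ x, (if x ≤ s then f x else g x) * deriv φ x ∂unitVolume
      = (f (unitClamp s) - g (unitClamp s)) * φ s
        - ∫ x, (if x ≤ s then f' x else g' x) * φ x ∂unitVolume := by
  have hcont : ∀ {F F' : ℝ → ℝ}, (∀ x ∈ Set.Icc (0 : ℝ) 1, HasDerivAt F (F' x) x) →
      ContinuousOn F (Set.Icc 0 1) := fun hF => HasDerivAt.continuousOn hF
  simp only [ite_mul]
  rw [integral_ite_le_eq_add ((hcont hf).fun_mul hφ.deriv.continuous.continuousOn)
      ((hcont hg).fun_mul hφ.deriv.continuous.continuousOn),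
    integral_ite_le_eq_add (hf'.fun_mul hφ.continuous.continuousOn)
      (hg'.fun_mul hφ.continuous.continuousOn),
    hφ.intervalIntegral_mul_deriv hf hf' (by simp) (unitClamp_mem s),
    hφ.intervalIntegral_mul_deriv hg hg' (unitClamp_mem s) (by simp), hφ.comp_unitClamp,
    hφ.eq_zero (x := 0) (by simp), hφ.eq_zero (x := 1) (by simp)]
  ring

end UnitClamp

section KernelDeriv

/-- The kernel `(x, y) ↦ p(x ∧ y) q(x ∨ y)` of a single coordinate. -/
def markovKernel (p q : ℝ → ℝ) (x y : ℝ) : ℝ := p (min x y) * q (max x y)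

/-- The function `(s, x) ↦ ∂ₓⁿ k(x, s)` for `k = markovKernel p q`, off the diagonal. Both
variables are clamped to `[0,1]`, but their order is that of `s` and `x`. -/
noncomputable def kernelDeriv (p q : ℝ → ℝ) (n : ℕ) (z : ℝ × ℝ) : ℝ :=
  if z.2 ≤ z.1 then deriv^[n] p (unitClamp z.2) * q (unitClamp z.1)
  else p (unitClamp z.1) * deriv^[n] q (unitClamp z.2)

/-- The multiple of the Dirac measure at `s` in the second derivative of `markovKernel p q · s`;
the derivatives of order `n ≤ 1` are functions. -/
noncomputable def kernelJump (p q : ℝ → ℝ) (n : ℕ) (s : ℝ) : ℝ :=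
  if n = 2 then
    p (unitClamp s) * deriv q (unitClamp s) - deriv p (unitClamp s) * q (unitClamp s)
  else 0

variable {I : Set ℝ} {p q : ℝ → ℝ} {n : ℕ}

theorem kernelDeriv_zero {x : ℝ} (hx : x ∈ Set.Icc (0 : ℝ) 1) (s : ℝ) :
    kernelDeriv p q 0 (s, x) = markovKernel p q x (unitClamp s) := by
  simp only [kernelDeriv, markovKernel, Function.iterate_zero, id, unitClamp_of_mem hx]
  split_ifs with h
  · have hle : x ≤ unitClamp s := by
      rw [← unitClamp_of_mem hx]
      exact Set.monotone_projIcc zero_le_one h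
    rw [min_eq_left hle, max_eq_right hle]
  · have hle : unitClamp s ≤ x := by
      rw [← unitClamp_of_mem hx]
      exact Set.monotone_projIcc zero_le_one (le_of_not_ge h)
    rw [min_eq_right hle, max_eq_left hle]

theorem contDiffOn_iterate_deriv (hI : IsOpen I) {m : ℕ} (hp : ContDiffOn ℝ (n + m) p I) :
    ContDiffOn ℝ m (deriv^[n] p) I := by
  induction n generalizing m with
  | zero => simpa using hp
  | succ n ih =>
    rw [Function.iterate_succ_apply']
    exact (ih (m := m + 1) (by convert hp using 1; push_cast; ring)).deriv_of_isOpen hI (by simp)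

theorem continuousOn_iterate_deriv_Icc (hI : IsOpen I) (h01 : Set.Icc 0 1 ⊆ I)
    (hp : ContDiffOn ℝ n p I) : ContinuousOn (deriv^[n] p) (Set.Icc 0 1) :=
  (contDiffOn_iterate_deriv hI (m := 0) (by simpa using hp)).continuousOn.mono h01

theorem hasDerivAt_of_contDiffOn_one (hI : IsOpen I) (hp : ContDiffOn ℝ 1 p I) {x : ℝ}
    (hx : x ∈ I) : HasDerivAt p (deriv p x) x :=
  ((hp.differentiableOn one_ne_zero).differentiableAt (hI.mem_nhds hx)).hasDerivAt

theorem isBddMeas_kernelDeriv (hI : IsOpen I) (h01 : Set.Icc 0 1 ⊆ I) (hp : ContDiffOn ℝ n p I)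
    (hq : ContDiffOn ℝ n q I) : IsBddMeas (kernelDeriv p q n) := by
  have hbdd : ∀ {f : ℝ → ℝ} {m : ℕ}, ContDiffOn ℝ m f I →
      IsBddMeas fun s => deriv^[m] f (unitClamp s) := fun hf =>
    isBddMeas_comp_unitClamp (continuousOn_iterate_deriv_Icc hI h01 hf)
  have hzero : ∀ {f : ℝ → ℝ}, ContDiffOn ℝ n f I → IsBddMeas fun s => f (unitClamp s) :=
    fun hf => hbdd (m := 0) (hf.of_le (by simp))
  exact (((hbdd hp).comp measurable_snd).mul ((hzero hq).comp measurable_fst)).ite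
    (((hzero hp).comp measurable_fst).mul ((hbdd hq).comp measurable_snd))
    (measurableSet_le measurable_snd measurable_fst)

theorem isBddMeas_kernelJump (hI : IsOpen I) (h01 : Set.Icc 0 1 ⊆ I) (hp : ContDiffOn ℝ 1 p I)
    (hq : ContDiffOn ℝ 1 q I) (n : ℕ) : IsBddMeas (kernelJump p q n) := by
  unfold kernelJump
  split_ifs
  · have hp' := continuousOn_iterate_deriv_Icc hI h01 (n := 1) hp
    have hq' := continuousOn_iterate_deriv_Icc hI h01 (n := 1) hq
    exact isBddMeas_comp_unitClamp
      (((hp.continuousOn.mono h01).mul hq').sub (hp'.mul (hq.continuousOn.mono h01)))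
  · exact .const 0

theorem integral_kernelDeriv_mul (n : ℕ) (s : ℝ) (φ : ℝ → ℝ) :
    ∫ x, kernelDeriv p q n (s, x) * φ x ∂unitVolume
      = ∫ x, (if x ≤ s then deriv^[n] p x * q (unitClamp s)
          else p (unitClamp s) * deriv^[n] q x) * φ x ∂unitVolume :=
  setIntegral_congr_fun measurableSet_Ioo fun x hx => by
    simp only [kernelDeriv, unitClamp_of_mem (Set.Ioo_subset_Icc_self hx)]

theorem integral_kernelDeriv_mul_deriv (hI : IsOpen I) (h01 : Set.Icc 0 1 ⊆ I)
    (hp : ContDiffOn ℝ (n + 1) p I) (hq : ContDiffOn ℝ (n + 1) q I) {φ : ℝ → ℝ}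
    (hφ : IsTestFunction unitIoo φ) (s : ℝ) :
    ∫ x, kernelDeriv p q n (s, x) * deriv φ x ∂unitVolume
      = (deriv^[n] p (unitClamp s) * q (unitClamp s)
          - p (unitClamp s) * deriv^[n] q (unitClamp s)) * φ s
        - ∫ x, kernelDeriv p q (n + 1) (s, x) * φ x ∂unitVolume := by
  have hderiv : ∀ {f : ℝ → ℝ}, ContDiffOn ℝ (n + 1) f I →
      ∀ x ∈ Set.Icc (0 : ℝ) 1, HasDerivAt (deriv^[n] f) (deriv^[n + 1] f x) x := fun hf x hx => by
    rw [Function.iterate_succ_apply']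
    exact hasDerivAt_of_contDiffOn_one hI (contDiffOn_iterate_deriv hI (m := 1) hf) (h01 hx)
  rw [integral_kernelDeriv_mul, integral_kernelDeriv_mul]
  exact integral_ite_le_mul_deriv (fun x hx => (hderiv hp x hx).mul_const _)
    ((continuousOn_iterate_deriv_Icc hI h01 (by exact_mod_cast hp)).mul_const _)
    (fun x hx => (hderiv hq x hx).const_mul _)
    ((continuousOn_iterate_deriv_Icc hI h01 (by exact_mod_cast hq)).const_mul _) hφ s

theorem integral_kernelDeriv_mul_iteratedDeriv (hI : IsOpen I) (h01 : Set.Icc 0 1 ⊆ I)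
    (hp : ContDiffOn ℝ 2 p I) (hq : ContDiffOn ℝ 2 q I) (hn : n ≤ 2) {φ : ℝ → ℝ}
    (hφ : IsTestFunction unitIoo φ) (s : ℝ) :
    ∫ x, kernelDeriv p q 0 (s, x) * iteratedDeriv n φ x ∂unitVolume
      = (-1) ^ n * jumpOp unitVolume unitIoo (kernelDeriv p q n) (kernelJump p q n) φ s := by
  have hind : unitIoo.indicator (fun s => kernelJump p q n s * φ s) s = kernelJump p q n s * φ s :=
    Set.indicator_apply_eq_self.2 fun hs => by rw [hφ.eq_zero hs, mul_zero]
  have hp₁ : ContDiffOn ℝ ((0 : ℕ) + 1) p I := hp.of_le (by norm_num)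
  have hq₁ : ContDiffOn ℝ ((0 : ℕ) + 1) q I := hq.of_le (by norm_num)
  have hp₂ : ContDiffOn ℝ ((1 : ℕ) + 1) p I := by norm_num [one_add_one_eq_two, hp]
  have hq₂ : ContDiffOn ℝ ((1 : ℕ) + 1) q I := by norm_num [one_add_one_eq_two, hq]
  rw [jumpOp, hind]
  interval_cases n
  · simp [kernelJump]
  · rw [iteratedDeriv_one, integral_kernelDeriv_mul_deriv hI h01 hp₁ hq₁ hφ]
    simp [kernelJump]
  · rw [iteratedDeriv_succ, iteratedDeriv_one,
      integral_kernelDeriv_mul_deriv hI h01 hp₁ hq₁ hφ.deriv,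
      integral_kernelDeriv_mul_deriv hI h01 hp₂ hq₂ hφ]
    simp only [Function.iterate_zero, Function.iterate_one, id, kernelJump, if_true]
    ring

end KernelDeriv

/-! ### Sturm–Liouville equations -/

/-- `r` is a `C¹` solution of `-(u r')' + v r = 0` on the open set `I`. -/
structure IsSLSolution (I : Set ℝ) (u v r : ℝ → ℝ) : Prop where
  isOpen : IsOpen I
  u_contDiffOn : ContDiffOn ℝ 1 u I
  v_continuousOn : ContinuousOn v I
  contDiffOn : ContDiffOn ℝ 1 r I
  hasDerivAt_mul_deriv : ∀ x ∈ I, HasDerivAt (fun y => u y * deriv r y) (v x * r x) x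

namespace IsSLSolution

variable {I : Set ℝ} {u v r s : ℝ → ℝ}

theorem hasDerivAt_u (h : IsSLSolution I u v r) {x : ℝ} (hx : x ∈ I) :
    HasDerivAt u (deriv u x) x :=
  hasDerivAt_of_contDiffOn_one h.isOpen h.u_contDiffOn hx

theorem hasDerivAt (h : IsSLSolution I u v r) {x : ℝ} (hx : x ∈ I) :
    HasDerivAt r (deriv r x) x :=
  hasDerivAt_of_contDiffOn_one h.isOpen h.contDiffOn hx

theorem continuousOn_deriv_u (h : IsSLSolution I u v r) : ContinuousOn (deriv u) I :=
  h.u_contDiffOn.continuousOn_deriv_of_isOpen h.isOpen le_rfl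

theorem continuousOn_deriv (h : IsSLSolution I u v r) : ContinuousOn (deriv r) I :=
  h.contDiffOn.continuousOn_deriv_of_isOpen h.isOpen le_rfl

theorem slOp_eq (h : IsSLSolution I u v r) {φ : ℝ → ℝ} (hφ : IsTestFunction I φ) {x : ℝ}
    (hx : x ∈ I) : TensorMarkovKernel.slOp u v φ x
      = -(deriv u x * deriv φ x + u x * deriv (deriv φ) x) + v x * φ x := by
  rw [TensorMarkovKernel.slOp, ((h.hasDerivAt_u hx).fun_mul (hφ.deriv.hasDerivAt x)).deriv]

theorem integral_mul_slOp (h : IsSLSolution I u v r) {φ : ℝ → ℝ} (hφ : IsTestFunction I φ) :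
    ∫ x in I, r x * TensorMarkovKernel.slOp u v φ x = 0 := by
  have hint : ∀ {f η : ℝ → ℝ}, ContinuousOn f I → IsTestFunction I η →
      IntegrableOn (fun x => f x * η x) I := fun hf hη =>
    hη.integrableOn_mul (hf.locallyIntegrableOn h.isOpen.measurableSet)
  have hr := h.contDiffOn.continuousOn
  have hu := h.u_contDiffOn.continuousOn
  have hvr : ContinuousOn (fun x => v x * r x) I := h.v_continuousOn.mul hr
  have hur : ContinuousOn (fun x => r x * u x) I := hr.mul hu
  have hur₁ : ContinuousOn (fun x => u x * deriv r x) I := hu.mul h.continuousOn_deriv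
  have hur' : ContinuousOn (fun x => deriv r x * u x + r x * deriv u x) I :=
    (h.continuousOn_deriv.mul hu).add (hr.mul h.continuousOn_deriv_u)
  have hparts₁ := hφ.setIntegral_mul_deriv h.isOpen h.hasDerivAt_mul_deriv hvr
  have hparts₂ := hφ.deriv.setIntegral_mul_deriv h.isOpen
    (fun x hx => (h.hasDerivAt hx).fun_mul (h.hasDerivAt_u hx)) hur'
  have hsum₁ : IntegrableOn (fun x => v x * r x * φ x + u x * deriv r x * deriv φ x) I :=
    (hint hvr hφ).add (hint hur₁ hφ.deriv)
  have hsum₂ : IntegrableOn (fun x => (deriv r x * u x + r x * deriv u x) * deriv φ x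
      + r x * u x * deriv (deriv φ) x) I :=
    (hint hur' hφ.deriv).add (hint hur hφ.deriv.deriv)
  have hexpand : Set.EqOn (fun x => r x * TensorMarkovKernel.slOp u v φ x)
      (fun x => v x * r x * φ x + u x * deriv r x * deriv φ x
        - ((deriv r x * u x + r x * deriv u x) * deriv φ x + r x * u x * deriv (deriv φ) x)) I :=
    fun x hx => by
      simp only [h.slOp_eq hφ hx]
      ring
  rw [setIntegral_congr_fun h.isOpen.measurableSet hexpand, integral_sub hsum₁ hsum₂,
    integral_add (hint hvr hφ) (hint hur₁ hφ.deriv),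
    integral_add (hint hur' hφ.deriv) (hint hur hφ.deriv.deriv), hparts₁, hparts₂]
  ring

theorem exists_wronskian_eq (h : IsSLSolution I u v r) (h' : IsSLSolution I u v s)
    (hI : IsPreconnected I) :
    ∃ c, ∀ x ∈ I, u x * (deriv r x * s x - r x * deriv s x) = c := by
  have hderiv : ∀ x ∈ I,
      HasDerivAt (fun x => u x * deriv r x * s x - r x * (u x * deriv s x)) 0 x := fun x hx =>
    (((h.hasDerivAt_mul_deriv x hx).mul (h'.hasDerivAt hx)).sub
      ((h.hasDerivAt hx).mul (h'.hasDerivAt_mul_deriv x hx))).congr_deriv (by ring)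
  obtain ⟨c, hc⟩ := h.isOpen.exists_is_const_of_deriv_eq_zero hI
    (fun x hx => (hderiv x hx).differentiableAt.differentiableWithinAt)
    fun x hx => (hderiv x hx).deriv
  exact ⟨c, fun x hx => by rw [← hc x hx]; ring⟩

theorem hasDerivAt_deriv (h : IsSLSolution I u v r) {x : ℝ} (hx : x ∈ I)
    (hu : ∀ x ∈ I, u x ≠ 0) :
    HasDerivAt (deriv r) ((v x * r x - deriv u x * deriv r x) / u x) x := by
  have hdiv := (h.hasDerivAt_mul_deriv x hx).div (h.hasDerivAt_u hx) (hu x hx)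
  have heq : deriv r =ᶠ[nhds x] fun y => u y * deriv r y / u y := by
    filter_upwards [h.isOpen.mem_nhds hx] with y hy
    rw [mul_div_cancel_left₀ _ (hu y hy)]
  refine (hdiv.congr_of_eventuallyEq heq).congr_deriv ?_
  have hux := hu x hx
  field_simp

theorem contDiffOn_two (h : IsSLSolution I u v r) (hu : ∀ x ∈ I, u x ≠ 0) :
    ContDiffOn ℝ 2 r I := by
  have hr' : ContDiffOn ℝ 1 (deriv r) I := by
    refine (contDiffOn_succ_iff_deriv_of_isOpen (n := 0) h.isOpen).2
      ⟨fun x hx => (h.hasDerivAt_deriv hx hu).differentiableAt.differentiableWithinAt, by simp,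
        contDiffOn_zero.2 (ContinuousOn.congr ?_ fun x hx => (h.hasDerivAt_deriv hx hu).deriv)⟩
    exact ((h.v_continuousOn.mul h.contDiffOn.continuousOn).sub
      (h.continuousOn_deriv_u.mul h.continuousOn_deriv)).div h.u_contDiffOn.continuousOn hu
  exact (contDiffOn_succ_iff_deriv_of_isOpen (n := 1) h.isOpen).2
    ⟨h.contDiffOn.differentiableOn one_ne_zero, by simp, hr'⟩

end IsSLSolution

/-- Positive solutions `p`, `q` of the equation `-(u r')' + v r = 0` on an open set containing
`[0,1]`, with Wronskian `c ≠ 0`. -/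
structure IsSLPair (I : Set ℝ) (p q u v : ℝ → ℝ) (c : ℝ) : Prop where
  left : IsSLSolution I u v p
  right : IsSLSolution I u v q
  Icc_subset : Set.Icc 0 1 ⊆ I
  left_pos : ∀ x ∈ I, 0 < p x
  right_pos : ∀ x ∈ I, 0 < q x
  ne_zero : c ≠ 0
  wronskian : ∀ x ∈ I, u x * (deriv p x * q x - p x * deriv q x) = c

/-- The transform `∫₀¹ k(x, y) ψ(y) dy` for `k = markovKernel p q`, as a function of `x ∈ [0,1]`. -/
noncomputable def markovTransform (p q ψ : ℝ → ℝ) (x : ℝ) : ℝ :=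
  q x * (∫ t in (0 : ℝ)..x, p t * ψ t) + p x * ∫ t in x..1, q t * ψ t

theorem integral_markovKernel_mul {p q ψ : ℝ → ℝ} (hp : ContinuousOn p (Set.Icc 0 1))
    (hq : ContinuousOn q (Set.Icc 0 1)) (hψ : Continuous ψ) (s : ℝ) :
    ∫ y, markovKernel p q y (unitClamp s) * ψ y ∂unitVolume
      = markovTransform p q ψ (unitClamp s) := by
  have hker : ∀ y ∈ unitIoo, markovKernel p q y (unitClamp s) * ψ y
      = if y ≤ s then q (unitClamp s) * (p y * ψ y) else p (unitClamp s) * (q y * ψ y) :=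
    fun y hy => by
      rw [← kernelDeriv_zero (Set.Ioo_subset_Icc_self hy), kernelDeriv]
      simp only [Function.iterate_zero, id, unitClamp_of_mem (Set.Ioo_subset_Icc_self hy), ite_mul]
      exact ite_congr rfl (fun _ => by ring) fun _ => by ring
  rw [setIntegral_congr_fun measurableSet_Ioo hker,
    integral_ite_le_eq_add ((hp.fun_mul hψ.continuousOn).const_mul _)
      ((hq.fun_mul hψ.continuousOn).const_mul _), markovTransform,
    intervalIntegral.integral_const_mul, intervalIntegral.integral_const_mul]

namespace IsSLPair

variable {I : Set ℝ} {p q u v ψ : ℝ → ℝ} {c : ℝ}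

theorem u_ne_zero (h : IsSLPair I p q u v c) : ∀ x ∈ I, u x ≠ 0 := fun x hx h0 =>
  h.ne_zero (by rw [← h.wronskian x hx, h0, zero_mul])

theorem hasDerivAt_integral_mul {r : ℝ → ℝ} (hr : IsSLSolution I u v r)
    (h01 : Set.Icc 0 1 ⊆ I) (hψ : IsTestFunction unitIoo ψ) (x : ℝ) :
    HasDerivAt (fun x => ∫ t in (0 : ℝ)..x, r t * ψ t) (r x * ψ x) x
      ∧ HasDerivAt (fun x => ∫ t in x..1, r t * ψ t) (-(r x * ψ x)) x := by
  have hcont : Continuous fun t => r t * ψ t := (hψ.contDiff_mul isOpen_Ioo (n := 1)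
    (hr.contDiffOn.mono (Set.Ioo_subset_Icc_self.trans h01))).continuous
  exact ⟨intervalIntegral.integral_hasDerivAt_right (hcont.intervalIntegrable _ _)
      (hcont.stronglyMeasurableAtFilter _ _) hcont.continuousAt,
    intervalIntegral.integral_hasDerivAt_left (hcont.intervalIntegrable _ _)
      (hcont.stronglyMeasurableAtFilter _ _) hcont.continuousAt⟩

theorem hasDerivAt_markovTransform (h : IsSLPair I p q u v c) (hψ : IsTestFunction unitIoo ψ)
    {x : ℝ} (hx : x ∈ I) :
    HasDerivAt (markovTransform p q ψ)
      (deriv q x * (∫ t in (0 : ℝ)..x, p t * ψ t) + deriv p x * ∫ t in x..1, q t * ψ t) x :=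
  (((h.right.hasDerivAt hx).mul (hasDerivAt_integral_mul h.left h.Icc_subset hψ x).1).add
    ((h.left.hasDerivAt hx).mul
      (hasDerivAt_integral_mul h.right h.Icc_subset hψ x).2)).congr_deriv (by ring)

theorem hasDerivAt_mul_deriv_markovTransform (h : IsSLPair I p q u v c)
    (hψ : IsTestFunction unitIoo ψ) {x : ℝ} (hx : x ∈ I) :
    HasDerivAt (fun x => u x * deriv (markovTransform p q ψ) x)
      (v x * markovTransform p q ψ x - c * ψ x) x := by
  have heq : (fun x => u x * deriv (markovTransform p q ψ) x) =ᶠ[nhds x] fun x =>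
      u x * deriv q x * (∫ t in (0 : ℝ)..x, p t * ψ t)
        + u x * deriv p x * ∫ t in x..1, q t * ψ t := by
    filter_upwards [h.left.isOpen.mem_nhds hx] with y hy
    rw [(h.hasDerivAt_markovTransform hψ hy).deriv]
    ring
  refine HasDerivAt.congr_of_eventuallyEq ?_ heq
  refine (((h.right.hasDerivAt_mul_deriv x hx).mul
    (hasDerivAt_integral_mul h.left h.Icc_subset hψ x).1).add
      ((h.left.hasDerivAt_mul_deriv x hx).mul
        (hasDerivAt_integral_mul h.right h.Icc_subset hψ x).2)).congr_deriv ?_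
  rw [markovTransform, ← h.wronskian x hx]
  ring

theorem deriv_markovTransform_zero (h : IsSLPair I p q u v c) (hψ : IsTestFunction unitIoo ψ) :
    deriv (markovTransform p q ψ) 0 = deriv p 0 / p 0 * markovTransform p q ψ 0 := by
  have h0 : (0 : ℝ) ∈ I := h.Icc_subset (by simp)
  have hp0 := (h.left_pos 0 h0).ne'
  rw [(h.hasDerivAt_markovTransform hψ h0).deriv, markovTransform, intervalIntegral.integral_same]
  field_simp
  ring

theorem deriv_markovTransform_one (h : IsSLPair I p q u v c) (hψ : IsTestFunction unitIoo ψ) :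
    deriv (markovTransform p q ψ) 1 = deriv q 1 / q 1 * markovTransform p q ψ 1 := by
  have h1 : (1 : ℝ) ∈ I := h.Icc_subset (by simp)
  have hq1 := (h.right_pos 1 h1).ne'
  rw [(h.hasDerivAt_markovTransform hψ h1).deriv, markovTransform, intervalIntegral.integral_same]
  field_simp
  ring

end IsSLPair

section InverseFormula

/-- The multiplier of `Ψ = markovTransform p q ψ` in the function `ηₙ`, where
`∫ h ψ = ∫ h η₀ + ∫ h' η₁ + ∫ h'' η₂`. -/
noncomputable def interiorCoeff (u v : ℝ → ℝ) (c : ℝ) (n : Fin 3) (x : ℝ) : ℝ :=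
  c⁻¹ * ![v x, -deriv u x, -u x] n

/-- The multiplier of `Ψ 0` in the function `ηₙ` of `interiorCoeff`. -/
noncomputable def zeroCoeff (p u : ℝ → ℝ) (c : ℝ) (n : Fin 3) (x : ℝ) : ℝ :=
  c⁻¹ * u 0 * ![deriv p 0 / p 0, deriv p 0 / p 0 * (x - 1) - 1, 1 - x] n

/-- The multiplier of `Ψ 1` in the function `ηₙ` of `interiorCoeff`. -/
noncomputable def oneCoeff (q u : ℝ → ℝ) (c : ℝ) (n : Fin 3) (x : ℝ) : ℝ :=
  c⁻¹ * u 1 * ![-(deriv q 1 / q 1), 1 - deriv q 1 / q 1 * x, x] n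

variable {I : Set ℝ} {p q u v : ℝ → ℝ} {c : ℝ}

theorem continuous_zeroCoeff (n : Fin 3) : Continuous (zeroCoeff p u c n) := by
  refine continuous_const.mul ?_
  fin_cases n
  exacts [continuous_const, (continuous_const.mul (continuous_id.sub continuous_const)).sub
    continuous_const, continuous_const.sub continuous_id]

theorem continuous_oneCoeff (n : Fin 3) : Continuous (oneCoeff q u c n) := by
  refine continuous_const.mul ?_
  fin_cases n
  exacts [continuous_const, continuous_const.sub (continuous_const.mul continuous_id),
    continuous_id]

theorem integrable_mul_of_continuousOn {h F : ℝ → ℝ} (hh : Integrable h unitVolume)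
    (hF : ContinuousOn F (Set.Icc 0 1)) : Integrable (fun x => h x * F x) unitVolume := by
  refine ((isBddMeas_comp_unitClamp hF).integrable_mul hh).congr ?_
  filter_upwards [ae_restrict_mem measurableSet_Ioo] with x hx
  rw [unitClamp_of_mem (Set.Ioo_subset_Icc_self hx)]

theorem integral_mul_add_affine {h F : ℝ → ℝ} (hh : Integrable h unitVolume)
    (hF : ContinuousOn F (Set.Icc 0 1)) (a b e : ℝ) :
    ∫ x, h x * (a * F x + (b * x + e)) ∂unitVolume
      = a * (∫ x, h x * F x ∂unitVolume) + (b * (∫ x, h x * x ∂unitVolume)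
        + e * ∫ x, h x ∂unitVolume) := by
  have hhF := integrable_mul_of_continuousOn hh hF
  have hhx := integrable_mul_of_continuousOn hh (continuousOn_id' _)
  have haffine : Integrable (fun x => b * (h x * x) + e * h x) unitVolume :=
    (hhx.const_mul b).add (hh.const_mul e)
  rw [← integral_const_mul, ← integral_const_mul, ← integral_const_mul,
    ← integral_add (hhx.const_mul b) (hh.const_mul e), ← integral_add (hhF.const_mul a) haffine]
  exact integral_congr_ae (ae_of_all _ fun x => by ring)

theorem integral_mul_sub_one {h : ℝ → ℝ} (hh : Integrable h unitVolume) :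
    ∫ x, h x * (x - 1) ∂unitVolume = (∫ x, h x * x ∂unitVolume) - ∫ x, h x ∂unitVolume := by
  have haffine := integral_mul_add_affine hh continuousOn_const (F := 0) 0 1 (-1)
  simp only [zero_mul, one_mul, zero_add, ← sub_eq_add_neg, neg_mul] at haffine
  exact haffine

namespace IsSLPair

theorem continuousOn_interiorCoeff (h : IsSLPair I p q u v c) (n : Fin 3) :
    ContinuousOn (interiorCoeff u v c n) (Set.Icc 0 1) := by
  have hv := h.left.v_continuousOn.mono h.Icc_subset
  have hu := h.left.u_contDiffOn.continuousOn.mono h.Icc_subset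
  have hu' := h.left.continuousOn_deriv_u.mono h.Icc_subset
  refine continuousOn_const.mul ?_
  fin_cases n
  exacts [hv, hu'.neg, hu.neg]

theorem continuousOn_markovTransform (h : IsSLPair I p q u v c) {ψ : ℝ → ℝ}
    (hψ : IsTestFunction unitIoo ψ) : ContinuousOn (markovTransform p q ψ) (Set.Icc 0 1) :=
  fun _ hx => (h.hasDerivAt_markovTransform hψ (h.Icc_subset hx)).continuousAt.continuousWithinAt

/-- The function `ηₙ` with `∫ h ψ = ∫ h η₀ + ∫ h' η₁ + ∫ h'' η₂`; it depends on `ψ` only through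
`Ψ = markovTransform p q ψ`. -/
noncomputable def inverseTerm (p q u v : ℝ → ℝ) (c : ℝ) (Ψ : ℝ → ℝ) (n : Fin 3) (x : ℝ) : ℝ :=
  interiorCoeff u v c n x * Ψ x + zeroCoeff p u c n x * Ψ 0 + oneCoeff q u c n x * Ψ 1

/-- Integrate `h L[Ψ] = c h ψ` by parts twice. Since `Ψ` is a multiple of `p` near `0` and of `q`
near `1`, the boundary terms are multiples of `Ψ 0` and `Ψ 1`. -/
theorem mul_integral_mul_eq (h : IsSLPair I p q u v c) {h₀ h₁ h₂ ψ Ψ : ℝ → ℝ}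
    (hw₀ : HasIntegrableWeakDeriv h₀ h₁) (hw₁ : HasIntegrableWeakDeriv h₁ h₂)
    (hψ : IsTestFunction unitIoo ψ) (hΨ : Ψ = markovTransform p q ψ) :
    c * ∫ x, h₀ x * ψ x ∂unitVolume
      = (∫ x, h₀ x * (v x * Ψ x) ∂unitVolume) - (∫ x, h₁ x * (deriv u x * Ψ x) ∂unitVolume)
        - (∫ x, h₂ x * (u x * Ψ x) ∂unitVolume)
        + u 0 * Ψ 0 * (deriv p 0 / p 0 * ((∫ x, h₀ x ∂unitVolume) + ∫ x, h₁ x * (x - 1) ∂unitVolume)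
          - ((∫ x, h₁ x ∂unitVolume) + ∫ x, h₂ x * (x - 1) ∂unitVolume))
        - u 1 * Ψ 1 * (deriv q 1 / q 1 * ((∫ x, h₀ x ∂unitVolume) + ∫ x, h₁ x * x ∂unitVolume)
          - ((∫ x, h₁ x ∂unitVolume) + ∫ x, h₂ x * x ∂unitVolume)) := by
  subst hΨ
  set Ψ := markovTransform p q ψ
  have hv := h.left.v_continuousOn.mono h.Icc_subset
  have hu' := h.left.continuousOn_deriv_u.mono h.Icc_subset
  have hΨc : ContinuousOn Ψ (Set.Icc 0 1) := h.continuousOn_markovTransform hψ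
  have hX : ∀ x ∈ Set.Icc (0 : ℝ) 1, HasDerivAt (fun x => u x * deriv Ψ x)
      (v x * Ψ x - c * ψ x) x := fun x hx =>
    h.hasDerivAt_mul_deriv_markovTransform hψ (h.Icc_subset hx)
  have hXc : ContinuousOn (fun x => u x * deriv Ψ x) (Set.Icc 0 1) := HasDerivAt.continuousOn hX
  have hY : ∀ x ∈ Set.Icc (0 : ℝ) 1, HasDerivAt (fun x => u x * Ψ x)
      (deriv u x * Ψ x + u x * deriv Ψ x) x := fun x hx =>
    (h.left.hasDerivAt_u (h.Icc_subset hx)).fun_mul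
      (h.hasDerivAt_markovTransform hψ (h.Icc_subset hx)).differentiableAt.hasDerivAt
  have hparts₀ := hw₀.integral_mul_deriv_add hX
    ((hv.mul hΨc).sub (continuousOn_const.mul hψ.continuous.continuousOn))
  have hparts₁ := hw₁.integral_mul_deriv_add hY ((hu'.mul hΨc).add hXc)
  have hsplit₀ : ∫ x, h₀ x * (v x * Ψ x - c * ψ x) ∂unitVolume
      = (∫ x, h₀ x * (v x * Ψ x) ∂unitVolume) - c * ∫ x, h₀ x * ψ x ∂unitVolume := by
    rw [← integral_const_mul, ← integral_sub
      (integrable_mul_of_continuousOn hw₀.integrable (hv.fun_mul hΨc))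
      ((integrable_mul_of_continuousOn hw₀.integrable hψ.continuous.continuousOn).const_mul c)]
    exact integral_congr_ae (ae_of_all _ fun x => by ring)
  have hsplit₁ : ∫ x, h₁ x * (deriv u x * Ψ x + u x * deriv Ψ x) ∂unitVolume
      = (∫ x, h₁ x * (deriv u x * Ψ x) ∂unitVolume)
        + ∫ x, h₁ x * (u x * deriv Ψ x) ∂unitVolume := by
    rw [← integral_add (integrable_mul_of_continuousOn hw₁.integrable (hu'.fun_mul hΨc))
      (integrable_mul_of_continuousOn hw₁.integrable hXc)]
    exact integral_congr_ae (ae_of_all _ fun x => by ring)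
  rw [hsplit₀, h.deriv_markovTransform_zero hψ, h.deriv_markovTransform_one hψ] at hparts₀
  rw [hsplit₁] at hparts₁
  linear_combination hparts₁ - hparts₀

theorem integral_mul_eq_sum_inverseTerm (h : IsSLPair I p q u v c) {h₀ h₁ h₂ ψ : ℝ → ℝ}
    (hw₀ : HasIntegrableWeakDeriv h₀ h₁) (hw₁ : HasIntegrableWeakDeriv h₁ h₂)
    (hψ : IsTestFunction unitIoo ψ) :
    ∫ x, h₀ x * ψ x ∂unitVolume = ∑ n : Fin 3, ∫ x, ![h₀, h₁, h₂] n x *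
      inverseTerm p q u v c (markovTransform p q ψ) n x ∂unitVolume := by
  set Ψ := markovTransform p q ψ
  have hΨ : ContinuousOn Ψ (Set.Icc 0 1) := h.continuousOn_markovTransform hψ
  have hv := h.left.v_continuousOn.mono h.Icc_subset
  have hu := h.left.u_contDiffOn.continuousOn.mono h.Icc_subset
  have hu' := h.left.continuousOn_deriv_u.mono h.Icc_subset
  have hterm₀ := integral_mul_add_affine hw₀.integrable (hv.mul hΨ) c⁻¹ 0
    (c⁻¹ * (u 0 * (deriv p 0 / p 0) * Ψ 0 - u 1 * (deriv q 1 / q 1) * Ψ 1))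
  have hterm₁ := integral_mul_add_affine hw₁.integrable (hu'.mul hΨ) (-c⁻¹)
    (c⁻¹ * (u 0 * (deriv p 0 / p 0) * Ψ 0 - u 1 * (deriv q 1 / q 1) * Ψ 1))
    (c⁻¹ * (u 1 * Ψ 1 - u 0 * (deriv p 0 / p 0 + 1) * Ψ 0))
  have hterm₂ := integral_mul_add_affine hw₁.integrable_deriv (hu.mul hΨ) (-c⁻¹)
    (c⁻¹ * (u 1 * Ψ 1 - u 0 * Ψ 0)) (c⁻¹ * (u 0 * Ψ 0))
  have hmain := h.mul_integral_mul_eq hw₀ hw₁ hψ rfl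
  rw [integral_mul_sub_one hw₁.integrable, integral_mul_sub_one hw₁.integrable_deriv] at hmain
  have hη₀ : ∀ x, inverseTerm p q u v c Ψ 0 x = c⁻¹ * (v x * Ψ x) + (0 * x
      + c⁻¹ * (u 0 * (deriv p 0 / p 0) * Ψ 0 - u 1 * (deriv q 1 / q 1) * Ψ 1)) := fun x => by
    simp only [inverseTerm, interiorCoeff, zeroCoeff, oneCoeff, Matrix.cons_val]
    ring
  have hη₁ : ∀ x, inverseTerm p q u v c Ψ 1 x = -c⁻¹ * (deriv u x * Ψ x)
      + (c⁻¹ * (u 0 * (deriv p 0 / p 0) * Ψ 0 - u 1 * (deriv q 1 / q 1) * Ψ 1) * x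
      + c⁻¹ * (u 1 * Ψ 1 - u 0 * (deriv p 0 / p 0 + 1) * Ψ 0)) := fun x => by
    simp only [inverseTerm, interiorCoeff, zeroCoeff, oneCoeff, Matrix.cons_val]
    ring
  have hη₂ : ∀ x, inverseTerm p q u v c Ψ 2 x = -c⁻¹ * (u x * Ψ x)
      + (c⁻¹ * (u 1 * Ψ 1 - u 0 * Ψ 0) * x + c⁻¹ * (u 0 * Ψ 0)) := fun x => by
    simp only [inverseTerm, interiorCoeff, zeroCoeff, oneCoeff, Matrix.cons_val]
    ring
  rw [Fin.sum_univ_three, ← inv_mul_cancel_left₀ h.ne_zero (∫ x, h₀ x * ψ x ∂unitVolume), hmain]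
  simp only [hη₀, hη₁, hη₂, Matrix.cons_val]
  simp only [Pi.mul_apply] at hterm₀ hterm₁ hterm₂
  rw [hterm₀, hterm₁, hterm₂]
  ring

end IsSLPair

/-- The kernel of the operator `Φ ↦ e₀ Φ(0) + e₁ Φ(1)` on the functions `Φ` that are constant on
`(-∞, 0]` and on `[1, ∞)`, where the point values are written as means with respect to `ν`. -/
noncomputable def boundaryKernel (ν : Measure ℝ) (e₀ e₁ : ℝ → ℝ) (z : ℝ × ℝ) : ℝ :=
  (if z.2 ≤ 0 then e₀ (unitClamp z.1) / ν.real (Set.Iic 0) else 0)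
    + if 1 ≤ z.2 then e₁ (unitClamp z.1) / ν.real (Set.Ici 1) else 0

theorem isBddMeas_boundaryKernel (ν : Measure ℝ) {e₀ e₁ : ℝ → ℝ} (he₀ : Continuous e₀)
    (he₁ : Continuous e₁) : IsBddMeas (boundaryKernel ν e₀ e₁) := by
  have hside : ∀ {e : ℝ → ℝ} (a : ℝ), Continuous e →
      IsBddMeas fun z : ℝ × ℝ => e (unitClamp z.1) / a := fun a he =>
    ((isBddMeas_comp_unitClamp he.continuousOn).comp measurable_fst).mul (.const a⁻¹)
  exact ((hside _ he₀).ite (.const 0) (measurableSet_le measurable_snd measurable_const)).add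
    ((hside _ he₁).ite (.const 0) (measurableSet_le measurable_const measurable_snd))

theorem jumpOp_boundaryKernel {ν : Measure ℝ} [IsFiniteMeasure ν] (hν₀ : ν.real (Set.Iic 0) ≠ 0)
    (hν₁ : ν.real (Set.Ici 1) ≠ 0) {D e₀ e₁ Ψ : ℝ → ℝ} {x : ℝ} (hx : x ∈ unitIoo) :
    jumpOp ν unitIoo (boundaryKernel ν e₀ e₁) (fun s => D (unitClamp s))
        (fun s => Ψ (unitClamp s)) x = D x * Ψ x + e₀ x * Ψ 0 + e₁ x * Ψ 1 := by
  have hsplit : ∀ t, boundaryKernel ν e₀ e₁ (x, t) * Ψ (unitClamp t)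
      = (Set.Iic 0).indicator (fun _ => e₀ x / ν.real (Set.Iic 0) * Ψ 0) t
        + (Set.Ici 1).indicator (fun _ => e₁ x / ν.real (Set.Ici 1) * Ψ 1) t := fun t => by
    simp only [boundaryKernel, unitClamp_of_mem (Set.Ioo_subset_Icc_self hx), add_mul, ite_mul,
      zero_mul, Set.indicator_apply, Set.mem_Iic, Set.mem_Ici]
    congr 1
    · exact ite_congr rfl (fun ht => by rw [unitClamp_of_nonpos ht]) fun _ => rfl
    · exact ite_congr rfl (fun ht => by rw [unitClamp_of_one_le ht]) fun _ => rfl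
  rw [jumpOp, Set.indicator_of_mem hx, unitClamp_of_mem (Set.Ioo_subset_Icc_self hx),
    integral_congr_ae (ae_of_all _ hsplit),
    integral_add ((integrable_const _).indicator measurableSet_Iic)
      ((integrable_const _).indicator measurableSet_Ici),
    integral_indicator_const _ measurableSet_Iic, integral_indicator_const _ measurableSet_Ici]
  simp only [smul_eq_mul]
  field_simp
  ring

end InverseFormula

/-! ### Weak derivatives along products -/

/-- `h 1` and `h 2` are the first and second weak derivatives of `h 0` on `(0, 1)`. -/
structure IsWeakChain (h : Fin 3 → ℝ → ℝ) : Prop where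
  zero_one : HasIntegrableWeakDeriv (h 0) (h 1)
  one_two : HasIntegrableWeakDeriv (h 1) (h 2)

/-- Integration against `ψ` is the sum of the integrations of the derivatives of order `n` against
`η n`. Tensor products of such representations express an integral over the cube through the mixed
derivatives of the integrand. -/
structure RepresentsOnChains (η : Fin 3 → ℝ → ℝ) (ψ : ℝ → ℝ) : Prop where
  isBddMeas : ∀ n, IsBddMeas (η n)
  integral_mul_eq_sum : ∀ h, IsWeakChain h →
    ∫ x, h 0 x * ψ x ∂unitVolume = ∑ n, ∫ x, h n x * η n x ∂unitVolume

theorem RepresentsOnChains.single {ψ : ℝ → ℝ} (hψ : IsBddMeas ψ) :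
    RepresentsOnChains (Pi.single 0 ψ) ψ where
  isBddMeas n := by
    rcases eq_or_ne n 0 with rfl | hn
    · simpa using hψ
    · rw [Pi.single_eq_of_ne hn]
      exact IsBddMeas.const 0
  integral_mul_eq_sum h _ := by simp [Fin.sum_univ_succ]

theorem prod_update_apply {X ι : Type*} [Fintype ι] [DecidableEq ι] (η : ι → X → ℝ) (i : ι)
    (φ : X → ℝ) (x : ι → X) :
    ∏ j, Function.update η i φ j (x j) = φ (x i) * ∏ j ∈ Finset.univ.erase i, η j (x j) := by
  rw [← Finset.mul_prod_erase _ _ (Finset.mem_univ i), Function.update_self]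
  exact congrArg _ (Finset.prod_congr rfl fun j hj => by simp [Finset.ne_of_mem_erase hj])

theorem isBddMeas_update {X ι : Type*} [MeasurableSpace X] [DecidableEq ι] {η : ι → X → ℝ}
    (hη : ∀ j, IsBddMeas (η j)) (i : ι) {φ : X → ℝ} (hφ : IsBddMeas φ) (j : ι) :
    IsBddMeas (Function.update η i φ j) :=
  (Function.forall_update_iff η fun _ => IsBddMeas).2 ⟨hφ, fun j _ => hη j⟩ j

theorem integral_add_mul_prod_update_one {X ι : Type*} [MeasurableSpace X] [Fintype ι]
    [DecidableEq ι] {m : ι → Measure X} {F G : (ι → X) → ℝ} (hF : Integrable F (Measure.pi m))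
    (hG : Integrable G (Measure.pi m)) {i : ι} {φ χ : X → ℝ} (hφ : IsBddMeas φ) (hχ : IsBddMeas χ)
    {η : ι → X → ℝ} (hη : ∀ j, IsBddMeas (η j)) :
    ∫ x, (F x * φ (x i) + G x * χ (x i)) * ∏ j, Function.update η i (fun _ => 1) j (x j)
        ∂Measure.pi m
      = ∫ x, F x * ∏ j, Function.update η i φ j (x j) ∂Measure.pi m
        + ∫ x, G x * ∏ j, Function.update η i χ j (x j) ∂Measure.pi m := by
  rw [← integral_add (integrable_mul_prod hF (isBddMeas_update hη i hφ))
    (integrable_mul_prod hG (isBddMeas_update hη i hχ))]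
  refine integral_congr_ae (ae_of_all _ fun x => ?_)
  simp only [prod_update_apply]
  ring

theorem sum_congr_of_sum_update_congr {ι κ M : Type*} [Fintype ι] [DecidableEq ι] [Fintype κ]
    [Nonempty κ] [AddCommMonoid M] (i : ι) {F G : (ι → κ) → M}
    (h : ∀ α, ∑ n, F (Function.update α i n) = ∑ n, G (Function.update α i n)) :
    ∑ α, F α = ∑ α, G α := by
  obtain ⟨c⟩ := ‹Nonempty κ›
  have hsplit : ∀ (n : κ) (β : {j // j ≠ i} → κ), (Equiv.funSplitAt i κ).symm (n, β)
      = Function.update ((Equiv.funSplitAt i κ).symm (c, β)) i n := fun n β => by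
    funext j
    rcases eq_or_ne j i with rfl | hj <;> simp [Equiv.funSplitAt, *]
  rw [← (Equiv.funSplitAt i κ).symm.sum_comp, ← (Equiv.funSplitAt i κ).symm.sum_comp,
    Fintype.sum_prod_type_right, Fintype.sum_prod_type_right]
  refine Finset.sum_congr rfl fun β _ => ?_
  rw [Finset.sum_congr rfl fun n _ => congrArg F (hsplit n β), h,
    Finset.sum_congr rfl fun n _ => congrArg G (hsplit n β)]

/-- `f α` is the weak partial derivative of order `α` of `f 0` on the unit cube, tested against
products of test functions only. -/
structure IsTensorWeakFamily {d : ℕ} (f : (Fin d → Fin 3) → (Fin d → ℝ) → ℝ) : Prop where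
  integrable : ∀ α, Integrable (f α) (cubeVolume d)
  integral_mul_prod : ∀ (α : Fin d → Fin 3) (ψ : Fin d → ℝ → ℝ),
    (∀ j, IsTestFunction unitIoo (ψ j)) →
      ∫ x, f 0 x * ∏ j, iteratedDeriv (α j) (ψ j) (x j) ∂cubeVolume d
        = (-1) ^ (∑ j, (α j : ℕ)) * ∫ x, f α x * ∏ j, ψ j (x j) ∂cubeVolume d

namespace IsTensorWeakFamily

variable {d : ℕ} {f : (Fin d → Fin 3) → (Fin d → ℝ) → ℝ}

theorem integral_mul_prod_update_deriv_of_isTestFunction (hf : IsTensorWeakFamily f)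
    (α : Fin d → Fin 3) (i : Fin d) (n : Fin 2) {ψ : Fin d → ℝ → ℝ}
    (hψ : ∀ j ≠ i, IsTestFunction unitIoo (ψ j)) {φ : ℝ → ℝ} (hφ : IsTestFunction unitIoo φ) :
    ∫ x, f (Function.update α i n.castSucc) x *
        ∏ j, Function.update ψ i (deriv φ) j (x j) ∂cubeVolume d
      = -∫ x, f (Function.update α i n.succ) x *
        ∏ j, Function.update ψ i φ j (x j) ∂cubeVolume d := by
  have htest : ∀ {χ : ℝ → ℝ}, IsTestFunction unitIoo χ →
      ∀ j, IsTestFunction unitIoo (Function.update ψ i χ j) := fun hχ =>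
    (Function.forall_update_iff ψ fun _ => IsTestFunction unitIoo).2 ⟨hχ, hψ⟩
  have hleft := hf.integral_mul_prod (Function.update α i n.castSucc) _ (htest hφ.deriv)
  have hright := hf.integral_mul_prod (Function.update α i n.succ) _ (htest hφ)
  have hprod : ∀ x : Fin d → ℝ,
      ∏ j, iteratedDeriv (Function.update α i n.castSucc j) (Function.update ψ i (deriv φ) j) (x j)
        = ∏ j, iteratedDeriv (Function.update α i n.succ j) (Function.update ψ i φ j) (x j) :=
    fun x => Finset.prod_congr rfl fun j _ => by
      rcases eq_or_ne j i with rfl | hj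
      · simp [iteratedDeriv_succ']
      · simp [hj]
  have hsum : ∑ j, (Function.update α i n.succ j : ℕ)
      = ∑ j, (Function.update α i n.castSucc j : ℕ) + 1 := by
    rw [← Finset.add_sum_erase _ _ (Finset.mem_univ i),
      ← Finset.add_sum_erase _ (fun j => (Function.update α i n.castSucc j : ℕ))
        (Finset.mem_univ i),
      Finset.sum_congr (g := fun j => (Function.update α i n.castSucc j : ℕ)) rfl fun j hj => by
        simp [Finset.ne_of_mem_erase hj]]
    simp only [Function.update_self, Fin.val_succ, Fin.val_castSucc]
    ring
  simp only [hprod] at hleft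
  rw [hright, hsum, pow_succ, mul_assoc, neg_one_mul] at hleft
  exact (mul_left_cancel₀ (pow_ne_zero _ (by norm_num)) hleft).symm

/-- The difference of the two sides is the integral of one function `Θ` against a product over the
variables other than `x i`, so that the test functions there can be enlarged to bounded ones. -/
theorem integral_mul_prod_update_deriv (hf : IsTensorWeakFamily f) (α : Fin d → Fin 3) (i : Fin d)
    (n : Fin 2) {η : Fin d → ℝ → ℝ} (hη : ∀ j, IsBddMeas (η j)) {φ : ℝ → ℝ}
    (hφ : IsTestFunction unitIoo φ) :
    ∫ x, f (Function.update α i n.castSucc) x *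
        ∏ j, Function.update η i (deriv φ) j (x j) ∂cubeVolume d
      = -∫ x, f (Function.update α i n.succ) x *
        ∏ j, Function.update η i φ j (x j) ∂cubeVolume d := by
  set Θ : (Fin d → ℝ) → ℝ := fun x => f (Function.update α i n.castSucc) x * deriv φ (x i)
    + f (Function.update α i n.succ) x * φ (x i) with hΘ_def
  have hΘ : Integrable Θ (cubeVolume d) :=
    ((hφ.deriv.isBddMeas.comp (measurable_pi_apply i)).integrable_mul (hf.integrable _)).add
      ((hφ.isBddMeas.comp (measurable_pi_apply i)).integrable_mul (hf.integrable _))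
  let P : Fin d → (ℝ → ℝ) → Prop :=
    Function.update (fun _ => IsTestFunction unitIoo) i (· = fun _ => 1)
  have hbdd : ∀ j χ, P j χ → IsBddMeas χ :=
    (Function.forall_update_iff _ fun _ (p : (ℝ → ℝ) → Prop) => ∀ χ, p χ → IsBddMeas χ).2
      ⟨fun χ hχ => hχ ▸ .const 1, fun _ _ _ hχ => hχ.isBddMeas⟩
  have hzero := integral_mul_prod_eq_zero_of_separating (P := P) hbdd
    (Finset.univ.erase i) (fun j hj θ hθ h => ae_eq_zero_of_integral_mul_test
      (show IntegrableOn _ unitIoo volume from hθ).locallyIntegrableOn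
        (by simpa [P, Finset.ne_of_mem_erase hj] using h)) hΘ (fun ζ hζ => by
      have hζ' := (Function.forall_update_iff _ fun j (p : (ℝ → ℝ) → Prop) => p (ζ j)).1 hζ
      rw [← Function.update_eq_self i ζ, hζ'.1, integral_add_mul_prod_update_one (hf.integrable _)
        (hf.integrable _) hφ.deriv.isBddMeas hφ.isBddMeas (fun j => hbdd j _ (hζ j)),
        hf.integral_mul_prod_update_deriv_of_isTestFunction α i n hζ'.2 hφ, neg_add_cancel])
    (isBddMeas_update hη i (.const 1)) fun j hj => by
      obtain rfl : j = i := by simpa using hj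
      simp [P]
  rw [integral_add_mul_prod_update_one (hf.integrable _) (hf.integrable _) hφ.deriv.isBddMeas
    hφ.isBddMeas hη] at hzero
  exact eq_neg_of_add_eq_zero_left hzero

theorem exists_isWeakChain (hf : IsTensorWeakFamily f) (α : Fin d → Fin 3) (i : Fin d)
    {η : Fin d → ℝ → ℝ} (hη : ∀ j, IsBddMeas (η j)) :
    ∃ h, IsWeakChain h ∧ ∀ n φ, IsBddMeas φ →
      ∫ x, f (Function.update α i n) x * ∏ j, Function.update η i φ j (x j) ∂cubeVolume d
        = ∫ t, h n t * φ t ∂unitVolume := by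
  choose h hint hh using fun n =>
    exists_integral_mul_prod_update_eq (hf.integrable (Function.update α i n)) hη i
  have hweak : ∀ n : Fin 2, HasIntegrableWeakDeriv (h n.castSucc) (h n.succ) := fun n =>
    ⟨hint _, hint _, fun φ hφ => by
      rw [← hh _ _ hφ.deriv.isBddMeas, ← hh _ _ hφ.isBddMeas,
        hf.integral_mul_prod_update_deriv α i n hη hφ]⟩
  exact ⟨h, ⟨hweak 0, hweak 1⟩, hh⟩

theorem sum_integral_mul_prod_update_eq (hf : IsTensorWeakFamily f) (α : Fin d → Fin 3) (i : Fin d)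
    {η : Fin d → ℝ → ℝ} (hη : ∀ j, IsBddMeas (η j)) {ζ : Fin 3 → ℝ → ℝ} {ψ : ℝ → ℝ}
    (hψ : IsBddMeas ψ) (hζ : RepresentsOnChains ζ ψ) :
    ∑ n, ∫ x, f (Function.update α i n) x * ∏ j, Function.update η i (ζ n) j (x j) ∂cubeVolume d
      = ∫ x, f (Function.update α i 0) x * ∏ j, Function.update η i ψ j (x j) ∂cubeVolume d := by
  obtain ⟨h, hchain, hh⟩ := hf.exists_isWeakChain α i hη
  simp only [hh _ _ (hζ.isBddMeas _), hh _ _ hψ, hζ.integral_mul_eq_sum h hchain]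

theorem sum_integral_mul_prod_congr (hf : IsTensorWeakFamily f) (i : Fin d)
    {η : Fin d → Fin 3 → ℝ → ℝ} (hη : ∀ j n, IsBddMeas (η j n)) {ζ ζ' : Fin 3 → ℝ → ℝ} {ψ : ℝ → ℝ}
    (hψ : IsBddMeas ψ) (hζ : RepresentsOnChains ζ ψ) (hζ' : RepresentsOnChains ζ' ψ) :
    ∑ α, ∫ x, f α x * ∏ j, Function.update η i ζ j (α j) (x j) ∂cubeVolume d
      = ∑ α, ∫ x, f α x * ∏ j, Function.update η i ζ' j (α j) (x j) ∂cubeVolume d := by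
  have hslice : ∀ {θ : Fin 3 → ℝ → ℝ}, RepresentsOnChains θ ψ → ∀ α : Fin d → Fin 3,
      ∑ n, ∫ x, f (Function.update α i n) x *
          ∏ j, Function.update η i θ j (Function.update α i n j) (x j) ∂cubeVolume d
        = ∫ x, f (Function.update α i 0) x *
          ∏ j, Function.update (fun j => η j (α j)) i ψ j (x j) ∂cubeVolume d := fun {θ} hθ α => by
    have hupdate : ∀ n j, Function.update η i θ j (Function.update α i n j)
        = Function.update (fun j => η j (α j)) i (θ n) j := fun n j => by
      rcases eq_or_ne j i with rfl | hj <;> simp [*]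
    simp only [hupdate, hf.sum_integral_mul_prod_update_eq α i (fun j => hη j (α j)) hψ hθ]
  exact sum_congr_of_sum_update_congr i fun α => (hslice hζ α).trans (hslice hζ' α).symm

theorem integral_mul_prod_eq_sum (hf : IsTensorWeakFamily f) {η : Fin d → Fin 3 → ℝ → ℝ}
    {ψ : Fin d → ℝ → ℝ} (hψ : ∀ j, IsBddMeas (ψ j)) (hη : ∀ j, RepresentsOnChains (η j) (ψ j)) :
    ∫ x, f 0 x * ∏ j, ψ j (x j) ∂cubeVolume d
      = ∑ α, ∫ x, f α x * ∏ j, η j (α j) (x j) ∂cubeVolume d := by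
  set ζ : Fin d → Fin 3 → ℝ → ℝ := fun j => Pi.single 0 (ψ j) with hζ_def
  have hζ : ∀ j, RepresentsOnChains (ζ j) (ψ j) := fun j => .single (hψ j)
  have hpiecewise : ∀ S : Finset (Fin d),
      ∑ α, ∫ x, f α x * ∏ j, S.piecewise η ζ j (α j) (x j) ∂cubeVolume d
        = ∑ α, ∫ x, f α x * ∏ j, ζ j (α j) (x j) ∂cubeVolume d := fun S => by
    induction S using Finset.induction_on with
    | empty => simp
    | insert i S hi ih =>
      have hbdd : ∀ j n, IsBddMeas (S.piecewise η ζ j n) := fun j =>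
        S.piecewise_cases η ζ (fun θ => ∀ n, IsBddMeas (θ n)) (hη j).isBddMeas (hζ j).isBddMeas
      rw [Finset.piecewise_insert, hf.sum_integral_mul_prod_congr i hbdd (hψ i) (hη i) (hζ i), ← ih,
        ← Finset.piecewise_eq_of_notMem S η ζ hi, Function.update_eq_self]
  have huniv := hpiecewise Finset.univ
  rw [Finset.piecewise_univ] at huniv
  rw [huniv, Finset.sum_eq_single 0]
  · simp [hζ_def]
  · intro α _ hα
    obtain ⟨j, hj⟩ := Function.ne_iff.1 hα
    refine integral_eq_zero_of_ae (ae_of_all _ fun x => mul_eq_zero_of_right _ ?_)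
    exact Finset.prod_eq_zero (Finset.mem_univ j) (by
      simp only [hζ_def, Pi.single_eq_of_ne (show α j ≠ 0 from hj), Pi.zero_apply])
  · simp

end IsTensorWeakFamily

/-! ### The space of dominating mixed smoothness -/

instance isFiniteMeasure_volume_openCube (d : ℕ) :
    IsFiniteMeasure (volume : Measure (openCube d)) := by
  refine ⟨?_⟩
  have hmap := (map_val_volume (measurableSet_openCube d)).trans (volume_restrict_openCube d)
  have huniv := congrArg (fun m : Measure (Fin d → ℝ) => m Set.univ) hmap
  simp only [Measure.map_apply measurable_subtype_coe MeasurableSet.univ, Set.preimage_univ]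
    at huniv
  rw [huniv]
  exact measure_lt_top _ _

theorem integral_openCube_eq {d : ℕ} {f : openCube d → ℝ} {F : (Fin d → ℝ) → ℝ}
    (hf : ∀ x : openCube d, f x = F x) (φ : (Fin d → ℝ) → ℝ) :
    ∫ x : openCube d, f x * φ x = ∫ x, F x * φ x ∂cubeVolume d := by
  rw [← volume_restrict_openCube]
  exact integral_subtype_eq (F := fun x => F x * φ x) (measurableSet_openCube d)
    fun x => by simp only [hf x]

theorem memLp_openCube_iff {d : ℕ} {f : openCube d → ℝ} {F : (Fin d → ℝ) → ℝ}
    (hf : ∀ x : openCube d, f x = F x) {p : ℝ≥0∞} : MemLp f p ↔ MemLp F p (cubeVolume d) := by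
  rw [← volume_restrict_openCube]
  exact memLp_subtype_iff (measurableSet_openCube d) hf

theorem mem_mixedSobolev_iff {d m : ℕ} {g : openCube d → ℝ} {G : (Fin d → ℝ) → ℝ}
    (hG : ∀ x : openCube d, g x = G x) :
    g ∈ mixedSobolev d m ↔ MemLp G 2 (cubeVolume d) ∧ ∀ α : Fin d → ℕ, (∀ j, α j ≤ m) →
      ∃ F, MemLp F 2 (cubeVolume d) ∧ ∀ φ, IsTestFunction (openCube d) φ →
        ∫ x, G x * mixedPartial α φ x ∂cubeVolume d
          = (-1) ^ (∑ j, α j) * ∫ x, F x * φ x ∂cubeVolume d := by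
  have hloc : ∀ {f : openCube d → ℝ}, MemLp f 2 → LocallyIntegrable f := fun hf =>
    (hf.integrable (by norm_num)).locallyIntegrable
  refine ⟨fun h => ⟨(memLp_openCube_iff hG).1 h.1, fun α hα => ?_⟩,
    fun h => ⟨(memLp_openCube_iff hG).2 h.1, fun α hα => ?_⟩⟩
  · obtain ⟨f, hf, -, -, hweak⟩ := h.2 α hα
    have hF : ∀ x : openCube d, f x = Function.extend Subtype.val f 0 (x : Fin d → ℝ) := fun x =>
      (extend_val_of_mem f x.2).symm
    refine ⟨_, (memLp_openCube_iff hF).1 hf, fun φ hφ => ?_⟩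
    rw [← integral_openCube_eq hG, ← integral_openCube_eq hF, hweak φ hφ]
  · obtain ⟨F, hF, hweak⟩ := h.2 α hα
    have hf : MemLp (fun x : openCube d => F x) 2 := (memLp_openCube_iff fun _ => rfl).2 hF
    refine ⟨fun x => F x, hf, hloc ((memLp_openCube_iff hG).2 h.1), hloc hf, fun φ hφ => ?_⟩
    rw [integral_openCube_eq hG, integral_openCube_eq (F := F) fun _ => rfl, hweak φ hφ]

theorem mem_mixedSobolev_of_ae_eq {d m : ℕ} {g g' : openCube d → ℝ} (h : g =ᵐ[volume] g')
    (hg : g ∈ mixedSobolev d m) : g' ∈ mixedSobolev d m := by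
  have hg' : MemLp g' 2 := hg.1.ae_eq h
  refine ⟨hg', fun α hα => ?_⟩
  obtain ⟨f, hf, -, hf_loc, hweak⟩ := hg.2 α hα
  refine ⟨f, hf, (hg'.integrable (by norm_num)).locallyIntegrable, hf_loc, fun φ hφ => ?_⟩
  rw [← hweak φ hφ]
  refine integral_congr_ae ?_
  filter_upwards [h] with x hx
  rw [hx]

theorem exists_isTensorWeakFamily_of_mem_mixedSobolev {d : ℕ} {g : openCube d → ℝ}
    (hg : g ∈ mixedSobolev d 2) {G : (Fin d → ℝ) → ℝ} (hG : ∀ x : openCube d, g x = G x) :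
    ∃ f, f 0 = G ∧ (∀ α, MemLp (f α) 2 (cubeVolume d)) ∧ IsTensorWeakFamily f := by
  obtain ⟨hG_memLp, hpartial⟩ := (mem_mixedSobolev_iff hG).1 hg
  choose f hf hweak using fun α : Fin d → Fin 3 => hpartial (fun j => α j) fun j => by omega
  have hf' : ∀ α, MemLp (Function.update f 0 G α) 2 (cubeVolume d) :=
    (Function.forall_update_iff f fun _ F => MemLp F 2 (cubeVolume d)).2
      ⟨hG_memLp, fun α _ => hf α⟩
  refine ⟨Function.update f 0 G, Function.update_self .., hf', fun α =>
    (hf' α).integrable (by norm_num), fun α ψ hψ => ?_⟩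
  rw [Function.update_self]
  rcases eq_or_ne α 0 with rfl | hα
  · simp
  · rw [Function.update_of_ne hα, ← hweak α _ (isTestFunction_prod hψ),
      mixedPartial_prod fun j => (hψ j).1]

theorem eq_of_continuous_of_ae_eq {E : Type*} [TopologicalSpace E] [MeasureSpace E] [BorelSpace E]
    [(volume : Measure E).IsOpenPosMeasure] {S : Set E} (hS : IsOpen S) {g g' : S → ℝ}
    (hg : Continuous g) (hg' : Continuous g') (h : g =ᵐ[volume] g') : g = g' :=
  have : (volume : Measure S).IsOpenPosMeasure := .comap volume hS.isOpenEmbedding_subtypeVal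
  (hg.ae_eq_iff_eq volume hg').1 h

/-! ### Reproducing kernel Hilbert spaces of continuous kernels -/

section ReproducingKernel

variable {X : Type*} {k : X → X → ℝ} [Fact (kernelMatrix k).PosSemidef]

/-- The kernel function `k(·, x)`, the representer of evaluation at `x` in the reproducing kernel
Hilbert space of `k`. -/
noncomputable def kernelSection (k : X → X → ℝ) [Fact (kernelMatrix k).PosSemidef] (x : X) :
    RKHS.OfKernel (kernelMatrix k) :=
  RKHS.kerFun (RKHS.OfKernel (kernelMatrix k)) x 1

theorem kernelSection_apply (x y : X) : kernelSection k y x = k x y := by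
  rw [kernelSection, RKHS.kerFun_apply, RKHS.OfKernel.kernel_ofKernel]
  simp [kernelMatrix]

theorem inner_kernelSection (f : RKHS.OfKernel (kernelMatrix k)) (x : X) :
    inner ℝ (kernelSection k x) f = f x := by
  rw [kernelSection, RKHS.kerFun_inner]; simp

/-- The limit is bounded by the uniform boundedness principle. -/
theorem exists_tendsto_inner {ι : Type*} {l : Filter ι} [l.IsCountablyGenerated] [l.NeBot]
    (x : ι → X) (h : ∀ f : RKHS.OfKernel (kernelMatrix k),
      ∃ c, Filter.Tendsto (fun i => f (x i)) l (nhds c)) :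
    ∃ e : RKHS.OfKernel (kernelMatrix k), ∀ f : RKHS.OfKernel (kernelMatrix k),
      Filter.Tendsto (fun i => f (x i)) l (nhds (inner ℝ e f)) := by
  choose limit hlimit using h
  have htendsto : Filter.Tendsto (fun i (f : RKHS.OfKernel (kernelMatrix k)) =>
      innerSL ℝ (kernelSection k (x i)) f) l (nhds limit) := by
    rw [tendsto_pi_nhds]
    exact fun f => by simpa only [innerSL_apply_apply, inner_kernelSection] using hlimit f
  refine ⟨(InnerProductSpace.toDual ℝ _).symm (continuousLinearMapOfTendsto _ htendsto),
    fun f => ?_⟩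
  rw [InnerProductSpace.toDual_symm_apply]
  exact hlimit f

variable [TopologicalSpace X]

theorem continuous_kernelSection (hk : Continuous fun z : X × X => k z.1 z.2) :
    Continuous (kernelSection k) := by
  rw [continuous_iff_continuousAt]
  intro x
  rw [ContinuousAt, tendsto_iff_norm_sub_tendsto_zero]
  have norm_sub_eq : ∀ y, ‖kernelSection k y - kernelSection k x‖
      = √(k y y - k y x - k x y + k x x) := by
    intro y
    rw [norm_eq_sqrt_real_inner, inner_sub_left, inner_sub_right, inner_sub_right]
    simp only [inner_kernelSection, kernelSection_apply]
    ring_nf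
  have hcont : Continuous fun y => √(k y y - k y x - k x y + k x x) :=
    ((((hk.comp (continuous_id.prodMk continuous_id)).sub
      (hk.comp (continuous_id.prodMk continuous_const))).sub
      (hk.comp (continuous_const.prodMk continuous_id))).add continuous_const).sqrt
  simpa [norm_sub_eq] using hcont.tendsto x

theorem continuous_coe_ofKernel (hk : Continuous fun z : X × X => k z.1 z.2)
    (f : RKHS.OfKernel (kernelMatrix k)) : Continuous f := by
  simpa only [inner_kernelSection] using
    (continuous_kernelSection hk).inner (𝕜 := ℝ) (continuous_const (y := f))

theorem exists_coe_eq_integral [SecondCountableTopology X] [MeasurableSpace X]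
    [OpensMeasurableSpace X] (hk : Continuous fun z : X × X => k z.1 z.2) {m : Measure X}
    {w : X → ℝ} (hw : Integrable w m) {J : Set X} (hJ : IsCompact J) (hwJ : ∀ x ∉ J, w x = 0) :
    ∃ h : RKHS.OfKernel (kernelMatrix k), ∀ x, h x = ∫ s, k x s * w s ∂m := by
  have hcont := continuous_kernelSection hk
  obtain ⟨C, hC⟩ := hJ.exists_bound_of_continuousOn hcont.continuousOn
  have hint : Integrable (fun s => w s • kernelSection k s) m := by
    refine (hw.norm.mul_const C).mono' (hw.1.smul hcont.aestronglyMeasurable)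
      (ae_of_all _ fun s => ?_)
    rw [norm_smul]
    by_cases hs : s ∈ J
    · exact mul_le_mul_of_nonneg_left (hC s hs) (norm_nonneg _)
    · simp [hwJ s hs]
  refine ⟨∫ s, w s • kernelSection k s ∂m, fun x => ?_⟩
  rw [← inner_kernelSection, ← integral_inner hint]
  simp only [real_inner_smul_right, inner_kernelSection, kernelSection_apply, mul_comm]

end ReproducingKernel

/-! ### A converse of the Cauchy–Schwarz inequality -/

section ConverseCauchySchwarz

variable {X : Type*} [MeasurableSpace X] {μ : Measure X}

theorem exists_memLp_two_indicator [SigmaFinite μ] {f : X → ℝ} (hf : Measurable f) :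
    ∃ A : ℕ → Set X, (∀ n, MemLp ((A n).indicator f) 2 μ) ∧
      ∀ x, ∀ᶠ n in Filter.atTop, x ∈ A n := by
  have hmeas : ∀ n : ℕ, MeasurableSet (spanningSets μ n ∩ {x | ‖f x‖ ≤ n}) := fun n =>
    (measurableSet_spanningSets μ n).inter (measurableSet_le hf.norm measurable_const)
  refine ⟨fun n => spanningSets μ n ∩ {x | ‖f x‖ ≤ n}, fun n => ?_, fun x => ?_⟩
  · have : IsFiniteMeasure (μ.restrict (spanningSets μ n ∩ {x | ‖f x‖ ≤ n})) :=
      isFiniteMeasure_restrict.2 ((measure_mono Set.inter_subset_left).trans_lt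
        (measure_spanningSets_lt_top μ n)).ne
    rw [memLp_indicator_iff_restrict (hmeas n)]
    refine MemLp.of_bound hf.aestronglyMeasurable n ?_
    filter_upwards [ae_restrict_mem (hmeas n)] with x hx using hx.2
  · obtain ⟨N, hN⟩ := exists_nat_ge ‖f x‖
    filter_upwards [Filter.eventually_ge_atTop (max N (spanningSetsIndex μ x))] with n hn
    exact ⟨monotone_spanningSets μ ((le_max_right _ _).trans hn) (mem_spanningSetsIndex μ x),
      hN.trans (by exact_mod_cast (le_max_left _ _).trans hn)⟩

/-- The uniform boundedness principle bounds the norms of the truncations of `f`, regarded as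
functionals on `L²`; Fatou's lemma then bounds the norm of `f`. -/
theorem memLp_two_of_forall_integrable_mul [SigmaFinite μ] {f : X → ℝ} (hf : Measurable f)
    (h : ∀ w, MemLp w 2 μ → Integrable (fun x => f x * w x) μ) : MemLp f 2 μ := by
  obtain ⟨A, hfA, hlim⟩ := exists_memLp_two_indicator (μ := μ) hf
  have pointwise_bound : ∀ w : Lp ℝ 2 μ,
      ∃ C, ∀ n, ‖innerSL ℝ ((hfA n).toLp _) w‖ ≤ C := by
    refine fun w => ⟨∫ x, ‖f x * w x‖ ∂μ, fun n => ?_⟩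
    rw [innerSL_apply_apply, L2.inner_def]
    refine norm_integral_le_of_norm_le (h w (Lp.memLp w)).norm ?_
    filter_upwards [(hfA n).coeFn_toLp] with x hx
    rw [hx, Real.inner_apply, norm_mul, norm_mul]
    gcongr
    exact norm_indicator_le_norm_self f x
  obtain ⟨C, hC⟩ := banach_steinhaus pointwise_bound
  have norm_bound : ∀ n, eLpNorm ((A n).indicator f) 2 μ ≤ ENNReal.ofReal C := fun n => by
    rw [← ENNReal.ofReal_toReal (hfA n).eLpNorm_ne_top, ← Lp.norm_toLp _ (hfA n)]
    simpa only [innerSL_apply_norm] using ENNReal.ofReal_le_ofReal (hC n)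
  refine ⟨hf.aestronglyMeasurable, lt_of_le_of_lt ?_ (ENNReal.ofReal_lt_top (r := C))⟩
  refine (Lp.eLpNorm_lim_le_liminf_eLpNorm (fun n => (hfA n).1) f (ae_of_all _ fun x => ?_)).trans
    (Filter.liminf_le_of_le (by isBoundedDefault) fun b hb => ?_)
  · refine tendsto_const_nhds.congr' ?_
    filter_upwards [hlim x] with n hn using (Set.indicator_of_mem hn f).symm
  · obtain ⟨n, hn⟩ := hb.exists
    exact hn.trans (norm_bound n)

end ConverseCauchySchwarz

/-! ### The Sturm–Liouville assumption in one variable -/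

section Wronskian

variable {I : Set ℝ} {u v p q r : ℝ → ℝ}

theorem eq_zero_of_wronskian_eq_zero (hp : IsSLSolution I u v p) (hq : IsSLSolution I u v q)
    (hq₀ : ∀ x ∈ I, q x ≠ 0) (hmono : StrictMonoOn (fun x => p x / q x) I)
    (hw : ∀ x ∈ I, u x * (deriv p x * q x - p x * deriv q x) = 0) {x : ℝ} (hx : x ∈ I) :
    u x = 0 := by
  by_contra hux
  obtain ⟨ε, hε, hball⟩ := Metric.eventually_nhds_iff_ball.1
    ((hp.isOpen.eventually_mem hx).and ((hp.hasDerivAt_u hx).continuousAt.eventually_ne hux))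
  have hderiv : ∀ y ∈ Metric.ball x ε, HasDerivAt (fun x => p x / q x) 0 y := fun y hy => by
    obtain ⟨hyI, hyu⟩ := hball y hy
    refine ((hp.hasDerivAt hyI).div (hq.hasDerivAt hyI) (hq₀ y hyI)).congr_deriv ?_
    rw [(mul_eq_zero.1 (hw y hyI)).resolve_left hyu, zero_div]
  have hx' : x + ε / 2 ∈ Metric.ball x ε := by
    rw [Metric.mem_ball, Real.dist_eq, add_sub_cancel_left, abs_of_pos (by positivity)]; linarith
  have hconst := Metric.isOpen_ball.is_const_of_deriv_eq_zero (convex_ball x ε).isPreconnected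
    (fun y hy => (hderiv y hy).differentiableAt.differentiableWithinAt)
    (fun y hy => (hderiv y hy).deriv) (Metric.mem_ball_self hε) hx'
  exact (hmono hx (hball _ hx').1 (by linarith)).ne hconst

theorem IsSLSolution.slOp_eq_zero (h : IsSLSolution I u v r) (hr : ∀ x ∈ I, r x ≠ 0)
    (hu : ∀ x ∈ I, u x = 0) (φ : ℝ → ℝ) {x : ℝ} (hx : x ∈ I) :
    TensorMarkovKernel.slOp u v φ x = 0 := by
  have hev : ∀ f : ℝ → ℝ, HasDerivAt (fun y => u y * f y) 0 x := fun f => by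
    refine (hasDerivAt_const x (0 : ℝ)).congr_of_eventuallyEq ?_
    filter_upwards [h.isOpen.mem_nhds hx] with y hy
    rw [hu y hy, zero_mul]
  have hv : v x = 0 := (mul_eq_zero.1 ((h.hasDerivAt_mul_deriv x hx).unique
    (hev (deriv r)))).resolve_right (hr x hx)
  rw [TensorMarkovKernel.slOp, (hev (deriv φ)).deriv, hv, neg_zero, zero_mul, add_zero]

end Wronskian

theorem isWeakDeriv_one_zero : IsWeakDeriv unitIoo 1 (fun _ => 1) (fun _ => 0) := by
  have := isLocallyFiniteMeasure_subtype (S := unitIoo) measurableSet_Ioo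
  refine ⟨locallyIntegrable_const _, locallyIntegrable_const _, fun φ hφ => ?_⟩
  rw [integral_subtype_eq measurableSet_Ioo (F := fun x => 1 * deriv φ x)
      (by simp only [iteratedDeriv_one, implies_true]),
    hφ.setIntegral_mul_deriv isOpen_Ioo (fun x _ => hasDerivAt_const x 1) continuousOn_const]
  simp only [zero_mul, integral_zero, neg_zero, mul_zero]

theorem exists_tendsto_of_derivNormSq_lt_top {g : unitIoo → ℝ} (hg : Continuous g)
    (hfin : TensorMarkovKernel.derivNormSq g < ⊤) {t : ℝ} (ht : t ∈ Set.Icc (0 : ℝ) 1) :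
    ∃ l, Filter.Tendsto g ((nhds t).comap Subtype.val) (nhds l) := by
  simp only [TensorMarkovKernel.derivNormSq, iInf_lt_top] at hfin
  obtain ⟨f, hf, hf_fin⟩ := hfin
  have hmeas := measurableSet_Ioo (a := (0 : ℝ)) (b := 1)
  set F := Function.extend Subtype.val f 0
  set G := Function.extend Subtype.val g 0
  have hF : ∀ x : unitIoo, f x = F x := fun x => (extend_val_of_mem f x.2).symm
  have hG : ∀ x : unitIoo, g x = G x := fun x => (extend_val_of_mem g x.2).symm
  have hfL : MemLp f 2 := by
    refine ⟨hf.2.1.aestronglyMeasurable, ?_⟩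
    rw [eLpNorm_lt_top_iff_lintegral_rpow_enorm_lt_top (by simp) (by simp)]
    simpa using hf_fin
  have hFi : Integrable F unitVolume :=
    ((memLp_subtype_iff hmeas hF).1 hfL).integrable one_le_two
  obtain ⟨C, hC⟩ := ae_eq_const_add_integral
    (locallyIntegrableOn_of_subtype isOpen_Ioo hG hf.1) hFi fun φ hφ => by
      have hweak := hf.2.2 φ hφ
      rwa [integral_subtype_eq hmeas (F := fun x => G x * deriv φ x)
          (by simp only [hG, iteratedDeriv_one, implies_true]),
        integral_subtype_eq hmeas (F := fun x => F x * φ x) (by simp only [hF, implies_true]),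
        pow_one, neg_one_mul] at hweak
  have hcont : ContinuousOn (fun x => C + ∫ s in (0 : ℝ)..x, F s) (Set.Icc 0 1) :=
    continuousOn_const.add (continuousOn_indefinite_integral hFi)
  have hGc : ContinuousOn G unitIoo := by
    rw [continuousOn_iff_continuous_domRestrict]
    exact (funext hG : g = unitIoo.domRestrict G) ▸ hg
  have heq := Measure.eqOn_open_of_ae_eq hC isOpen_Ioo hGc
    (hcont.mono Set.Ioo_subset_Icc_self)
  refine ⟨_, ((hcont t ht).tendsto.comp (tendsto_nhdsWithin_iff.2 ⟨Filter.tendsto_comap,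
    Filter.Eventually.of_forall fun x => Set.Ioo_subset_Icc_self x.2⟩)).congr fun x => ?_⟩
  exact ((hG x).trans (heq x.2)).symm

theorem isOpen_erealIoo (a b : EReal) : IsOpen (erealIoo a b) :=
  isOpen_Ioo.preimage continuous_coe_real_ereal

theorem ordConnected_erealIoo (a b : EReal) : (erealIoo a b).OrdConnected :=
  ⟨fun _ hx _ hy _ hz => ⟨hx.1.trans_le (EReal.coe_le_coe_iff.2 hz.1),
    (EReal.coe_le_coe_iff.2 hz.2).trans_lt hy.2⟩⟩

namespace TensorMarkovKernel

variable {d : ℕ} (T : TensorMarkovKernel d) {j : Fin d} {u v r : ℝ → ℝ}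

theorem isOpen_interval (j : Fin d) : IsOpen (T.interval j) := isOpen_erealIoo _ _

theorem measurableSet_interval (j : Fin d) : MeasurableSet (T.interval j) :=
  (T.isOpen_interval j).measurableSet

theorem ordConnected_interval (j : Fin d) : (T.interval j).OrdConnected := ordConnected_erealIoo _ _

theorem half_mem_interval (j : Fin d) : (1 / 2 : ℝ) ∈ T.interval j :=
  T.unitIoo_subset j ⟨by norm_num, by norm_num⟩

theorem kernel₁_pos {x y : ℝ} (hx : x ∈ T.interval j) (hy : y ∈ T.interval j) :
    0 < T.kernel₁ j x y := by
  refine mul_pos (T.p_pos j _ ?_) (T.q_pos j _ ?_)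
  · rcases min_choice x y with h | h <;> rwa [h]
  · rcases max_choice x y with h | h <;> rwa [h]

theorem continuous_kernel₁ (hp : ContinuousOn (T.p j) (T.interval j))
    (hq : ContinuousOn (T.q j) (T.interval j)) :
    Continuous fun z : T.interval j × T.interval j => T.kernel₁ j z.1 z.2 := by
  refine (hp.comp_continuous (by fun_prop) fun z => ?_).mul
    (hq.comp_continuous (by fun_prop) fun z => ?_)
  · rcases min_choice (z.1 : ℝ) z.2 with h | h <;> rw [h] <;> exact Subtype.coe_prop _
  · rcases max_choice (z.1 : ℝ) z.2 with h | h <;> rw [h] <;> exact Subtype.coe_prop _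

section SolvesODE

variable {T} (hS : T.SolvesODE j u v)

include hS

theorem SolvesODE.isSLSolution (hr : r ∈ ({T.p j, T.q j} : Set (ℝ → ℝ))) :
    IsSLSolution (T.interval j) u v r := by
  obtain ⟨hr₁, hr₂⟩ := hS.2.2 r hr
  refine ⟨T.isOpen_interval j, hS.1, hS.2.1, hr₁, fun x hx => ?_⟩
  refine (hr₂ x hx).1.hasDerivAt.congr_deriv ?_
  have hslOp := (hr₂ x hx).2
  rw [slOp] at hslOp
  linarith

theorem SolvesODE.isSLSolution_p : IsSLSolution (T.interval j) u v (T.p j) :=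
  hS.isSLSolution (Set.mem_insert _ _)

theorem SolvesODE.isSLSolution_q : IsSLSolution (T.interval j) u v (T.q j) :=
  hS.isSLSolution (Set.mem_insert_of_mem _ rfl)

theorem SolvesODE.continuous_kernel₁ :
    Continuous fun z : T.interval j × T.interval j => T.kernel₁ j z.1 z.2 :=
  T.continuous_kernel₁ hS.isSLSolution_p.contDiffOn.continuousOn
    hS.isSLSolution_q.contDiffOn.continuousOn

theorem SolvesODE.eq_zero_of_integral_mul_slOp_eq_zero (hE : T.InnerEqSL j u v) {e : T.Space₁ j}
    (he : ∀ φ, IsTestFunction (T.interval j) φ → ∫ x : T.interval j, e x * slOp u v φ x = 0) :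
    e = 0 := by
  have := isLocallyFiniteMeasure_subtype (T.measurableSet_interval j)
  have hweak : IsWeakSL (T.interval j) u v e fun _ => 0 :=
    ⟨(continuous_coe_ofKernel hS.continuous_kernel₁ e).locallyIntegrable,
      locallyIntegrable_const _, fun φ hφ => by simpa only [zero_mul, integral_zero] using he φ hφ⟩
  rw [← inner_self_eq_zero (𝕜 := ℝ), hE e e _ hweak (by simp)]
  simp only [mul_zero, integral_zero]

/-- If the Wronskian vanished, so would `u` and `v`, hence every element of the Hilbert space. -/
theorem SolvesODE.exists_wronskian_eq (hE : T.InnerEqSL j u v) :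
    ∃ c : ℝ, c ≠ 0 ∧ ∀ x ∈ T.interval j,
      u x * (deriv (T.p j) x * T.q j x - T.p j x * deriv (T.q j) x) = c := by
  have hp := hS.isSLSolution_p
  have hq₀ := fun x hx => (T.q_pos j x hx).ne'
  obtain ⟨c, hc⟩ := hp.exists_wronskian_eq hS.isSLSolution_q
    (T.ordConnected_interval j).isPreconnected
  refine ⟨c, fun hc₀ => ?_, hc⟩
  have hu : ∀ x ∈ T.interval j, u x = 0 := fun x hx =>
    eq_zero_of_wronskian_eq_zero hp hS.isSLSolution_q hq₀ (T.strictMono j)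
      (fun x hx => (hc x hx).trans hc₀) hx
  let x₀ : T.interval j := ⟨1 / 2, T.half_mem_interval j⟩
  have hsection := hS.eq_zero_of_integral_mul_slOp_eq_zero hE
    (e := kernelSection _ x₀) fun φ _ => by
      simp only [hp.slOp_eq_zero (fun x hx => (T.p_pos j x hx).ne') hu φ (Subtype.coe_prop _),
        mul_zero, integral_zero]
  refine (T.kernel₁_pos x₀.2 x₀.2).ne' ?_
  rw [← kernelSection_apply (k := fun x y : T.interval j => T.kernel₁ j x y), hsection,
    RKHS.coe_zero, Pi.zero_apply]

end SolvesODE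

namespace RestrNormEquiv

variable {T} (hR : T.RestrNormEquiv j)

include hR

theorem exists_tendsto {g : T.Space₁ j} (hg : Continuous g) {t : ℝ}
    (ht : t ∈ Set.Icc (0 : ℝ) 1) :
    ∃ l, Filter.Tendsto (fun x => g (Set.inclusion (T.unitIoo_subset j) x))
      ((nhds t).comap Subtype.val) (nhds l) := by
  obtain ⟨c, _, hc, _, hle, _⟩ := hR
  refine exists_tendsto_of_derivNormSq_lt_top
    (g := fun x => g (Set.inclusion (T.unitIoo_subset j) x))
    (hg.comp (continuous_inclusion _)) ?_ ht
  have hrestr : T.restrNormSq j (fun x => g (Set.inclusion (T.unitIoo_subset j) x)) < ⊤ :=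
    (iInf₂_le g fun _ => rfl).trans_lt (by simp)
  refine lt_top_iff_ne_top.2 fun htop => ((hle _).trans_lt hrestr).ne ?_
  rw [htop, ENNReal.mul_top (by simpa using hc)]

theorem exists_coe_eq_one :
    ∃ h : T.Space₁ j, ∀ x : unitIoo, h (Set.inclusion (T.unitIoo_subset j) x) = 1 := by
  obtain ⟨_, C, _, _, _, hle⟩ := hR
  have hderiv : derivNormSq (fun _ => 1) ≤ 0 :=
    (iInf₂_le _ isWeakDeriv_one_zero).trans (by simp)
  have hfin : T.restrNormSq j (fun _ => 1) < ⊤ := by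
    refine (hle _ continuous_const).trans_lt (ENNReal.mul_lt_top (by simp)
      (ENNReal.add_lt_top.2 ⟨?_, hderiv.trans_lt (by simp)⟩))
    simp [Measure.Subtype.volume_univ measurableSet_Ioo.nullMeasurableSet]
  simp only [restrNormSq, iInf_lt_top] at hfin
  obtain ⟨h, hh, _⟩ := hfin
  exact ⟨h, hh⟩

end RestrNormEquiv

/-- If `k_j(y, x)` were proportional to the solution `r` for `x` near `t`, so would be the
representer of the boundary value at `t`; but the Hilbert space contains no nonzero solution, while
it does contain an extension of `1`. -/
theorem SolvesODE.false_of_eventually_kernel₁_eq {T : TensorMarkovKernel d}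
    (hS : T.SolvesODE j u v) (hE : T.InnerEqSL j u v) (hR : T.RestrNormEquiv j)
    (hr : r ∈ ({T.p j, T.q j} : Set (ℝ → ℝ))) {t : ℝ} (ht : t ∈ Set.Icc (0 : ℝ) 1) (A : ℝ → ℝ)
    (hA : ∀ y ∈ T.interval j, ∀ᶠ x : unitIoo in (nhds t).comap Subtype.val,
      T.kernel₁ j x y = A x * r y) : False := by
  have : ((nhds t).comap (Subtype.val : unitIoo → ℝ)).NeBot :=
    mem_closure_iff_comap_neBot.1 (by rwa [closure_Ioo zero_ne_one])
  have hcont : ∀ g : T.Space₁ j, Continuous g := continuous_coe_ofKernel hS.continuous_kernel₁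
  obtain ⟨e, he⟩ := exists_tendsto_inner
    (k := fun x y : T.interval j => T.kernel₁ j x y) (Set.inclusion (T.unitIoo_subset j))
    fun g => hR.exists_tendsto (hcont g) ht
  have he_apply : ∀ y : T.interval j, Filter.Tendsto (fun x : unitIoo => A x * r y)
      ((nhds t).comap Subtype.val) (nhds (e y)) := fun y => by
    have hlim := he (kernelSection _ y)
    rw [real_inner_comm, inner_kernelSection] at hlim
    refine hlim.congr' ?_
    filter_upwards [hA y y.2] with x hx
    rw [← hx, kernelSection_apply, Set.coe_inclusion]
  have hr₀ : r (1 / 2) ≠ 0 := by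
    rcases hr with rfl | rfl
    exacts [(T.p_pos j _ (T.half_mem_interval j)).ne', (T.q_pos j _ (T.half_mem_interval j)).ne']
  obtain ⟨a, ha⟩ : ∃ a, ∀ y : T.interval j, e y = a * r y :=
    ⟨_, fun y => tendsto_nhds_unique (he_apply y) ((((he_apply ⟨_, T.half_mem_interval j⟩).div_const
      _).congr fun x => mul_div_cancel_right₀ _ hr₀).mul_const _)⟩
  have he₀ : e = 0 := hS.eq_zero_of_integral_mul_slOp_eq_zero hE fun φ hφ => by
    rw [integral_subtype_eq (T.measurableSet_interval j)
      (F := fun x => a * (r x * slOp u v φ x)) (fun x => by rw [ha x, mul_assoc]),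
      integral_const_mul, (hS.isSLSolution hr).integral_mul_slOp hφ, mul_zero]
  obtain ⟨h, hh⟩ := hR.exists_coe_eq_one
  have hlim := he h
  simp only [hh, he₀, inner_zero_left, tendsto_const_nhds_iff] at hlim
  exact one_ne_zero hlim

theorem SolvesODE.Icc_subset_interval {T : TensorMarkovKernel d} (hS : T.SolvesODE j u v)
    (hE : T.InnerEqSL j u v) (hR : T.RestrNormEquiv j) : Set.Icc 0 1 ⊆ T.interval j := by
  have hI := T.ordConnected_interval j
  have hhalf := T.half_mem_interval j
  refine hI.out ?_ ?_
  · by_contra h₀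
    refine hS.false_of_eventually_kernel₁_eq hE hR (r := T.q j) (t := 0)
      (Set.mem_insert_of_mem _ rfl) (by simp) (T.p j) fun y hy => ?_
    have hy₀ : 0 < y := lt_of_not_ge fun hle => h₀ (hI.out hy hhalf ⟨hle, by norm_num⟩)
    filter_upwards [Filter.tendsto_comap.eventually (gt_mem_nhds hy₀)] with x hx
    rw [kernel₁, min_eq_left hx.le, max_eq_right hx.le]
  · by_contra h₁
    refine hS.false_of_eventually_kernel₁_eq hE hR (r := T.p j) (t := 1)
      (Set.mem_insert _ _) (by simp) (T.q j) fun y hy => ?_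
    have hy₁ : y < 1 := lt_of_not_ge fun hle => h₁ (hI.out hhalf hy ⟨by norm_num, hle⟩)
    filter_upwards [Filter.tendsto_comap.eventually (lt_mem_nhds hy₁)] with x hx
    rw [kernel₁, min_eq_right hx.le, max_eq_left hx.le, mul_comm]

theorem SturmLiouville.exists_isSLPair {T : TensorMarkovKernel d} (hT : T.SturmLiouville)
    (j : Fin d) : ∃ u v c, IsSLPair (T.interval j) (T.p j) (T.q j) u v c := by
  obtain ⟨⟨u, v, hS, hE⟩, hR, _⟩ := hT j
  obtain ⟨c, hc, hw⟩ := hS.exists_wronskian_eq hE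
  exact ⟨u, v, c, hS.isSLSolution_p, hS.isSLSolution_q, hS.Icc_subset_interval hE hR, T.p_pos j,
    T.q_pos j, hc, hw⟩

end TensorMarkovKernel

/-! ### Square densities -/

section SquareDensity

theorem pi_withDensity_ofReal {ι X : Type*} [Fintype ι] [MeasurableSpace X] {m : ι → Measure X}
    [∀ i, SigmaFinite (m i)] {f : ι → X → ℝ} (hf : ∀ i, Integrable (f i) (m i))
    (hf₀ : ∀ i x, 0 ≤ f i x) :
    Measure.pi (fun i => (m i).withDensity fun x => ENNReal.ofReal (f i x))
      = (Measure.pi m).withDensity fun x => ENNReal.ofReal (∏ i, f i (x i)) := by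
  have : ∀ i, IsFiniteMeasure ((m i).withDensity fun x => ENNReal.ofReal (f i x)) := fun i =>
    isFiniteMeasure_withDensity_ofReal (hf i).2
  refine Measure.pi_eq fun s hs => ?_
  rw [withDensity_apply _ (MeasurableSet.univ_pi hs), Measure.restrict_pi_pi,
    ← ofReal_integral_eq_lintegral_ofReal
      (Integrable.fintype_prod fun i => (hf i).integrableOn)
      (ae_of_all _ fun x => Finset.prod_nonneg fun i _ => hf₀ i _),
    integral_fintype_prod_eq_prod, ENNReal.ofReal_prod_of_nonneg fun i _ => integral_nonneg (hf₀ i)]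
  refine Finset.prod_congr rfl fun i _ => ?_
  rw [withDensity_apply _ (hs i), ofReal_integral_eq_lintegral_ofReal (hf i).integrableOn
    (ae_of_all _ (hf₀ i))]

variable {X : Type*} [MeasurableSpace X] {μ : Measure X} {k : X → ℝ}

theorem integral_withDensity_sq (hk : AEMeasurable k μ) (f : X → ℝ) :
    ∫ x, f x ∂μ.withDensity (fun x => ENNReal.ofReal (k x ^ 2)) = ∫ x, f x * k x ^ 2 ∂μ := by
  rw [integral_withDensity_eq_integral_toReal_smul₀ (hk.pow_const 2).ennreal_ofReal
    (ae_of_all _ fun _ => ENNReal.ofReal_lt_top)]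
  simp only [ENNReal.toReal_ofReal (sq_nonneg (k _)), smul_eq_mul, mul_comm]

theorem memLp_two_withDensity_sq (hk : AEMeasurable k μ) (hk₀ : ∀ᵐ x ∂μ, k x ≠ 0) {f : X → ℝ} :
    MemLp f 2 (μ.withDensity fun x => ENNReal.ofReal (k x ^ 2)) ↔
      MemLp (fun x => f x * k x) 2 μ := by
  have hdensity : AEMeasurable (fun x => ENNReal.ofReal (k x ^ 2)) μ :=
    (hk.pow_const 2).ennreal_ofReal
  have aestronglyMeasurable_iff :
      AEStronglyMeasurable f (μ.withDensity fun x => ENNReal.ofReal (k x ^ 2)) ↔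
        AEStronglyMeasurable (fun x => f x * k x) μ := by
    constructor
    · refine fun h => (h.mono_ac (withDensity_absolutelyContinuous' hdensity ?_)).mul
        hk.aestronglyMeasurable
      filter_upwards [hk₀] with x hx using (ENNReal.ofReal_pos.2 (by positivity)).ne'
    · refine fun h => ((h.mul hk.inv.aestronglyMeasurable).congr ?_).mono_ac
        (withDensity_absolutelyContinuous _ _)
      filter_upwards [hk₀] with x hx using mul_inv_cancel_right₀ hx (f x)
  have memLp_iff : ∀ {m : Measure X} {g : X → ℝ}, MemLp g 2 m ↔
      AEStronglyMeasurable g m ∧ Integrable (fun x => g x ^ 2) m := fun {m g} =>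
    ⟨fun h => ⟨h.1, h.integrable_sq⟩, fun h => (memLp_two_iff_integrable_sq h.1).2 h.2⟩
  rw [memLp_iff, memLp_iff, aestronglyMeasurable_iff,
    integrable_withDensity_iff_integrable_smul₀' hdensity
      (ae_of_all _ fun _ => ENNReal.ofReal_lt_top)]
  simp only [ENNReal.toReal_ofReal (sq_nonneg (k _)), smul_eq_mul, mul_pow, mul_comm]

end SquareDensity

/-! ### Absorbing the kernel outside the unit interval into a measure -/

section SideMeasure

/-- For `k = markovKernel p q`, the factor `k(x, s) / k(x, κ(s))`, where `κ = unitClamp`. It does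
not depend on `x ∈ [0,1]`, and it is computed at `x = κ(s)`. -/
noncomputable def sideWeight (p q : ℝ → ℝ) (s : ℝ) : ℝ :=
  markovKernel p q (unitClamp s) s / markovKernel p q (unitClamp s) (unitClamp s)

/-- The measure on `J` whose density is the square of `sideWeight p q`. Passing from Lebesgue
measure to this measure reduces integrals of `markovKernel p q x s` over `s` to kernels that are
bounded, and it identifies the two `L²` spaces. -/
noncomputable def sideMeasure (p q : ℝ → ℝ) (J : Set ℝ) : Measure ℝ :=
  (volume.restrict J).withDensity fun s => ENNReal.ofReal (sideWeight p q s ^ 2)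

/-- A measurable set `J` with `(0,1) ⊆ J ⊆ I` on which `sideWeight p q` is square integrable. -/
structure IsSideDomain (I : Set ℝ) (p q : ℝ → ℝ) (J : Set ℝ) : Prop where
  measurableSet : MeasurableSet J
  unitIoo_subset : unitIoo ⊆ J
  subset : J ⊆ I
  memLp : MemLp (sideWeight p q) 2 (volume.restrict J)

variable {I J : Set ℝ} {p q u v : ℝ → ℝ} {c x s : ℝ}

namespace IsSLPair

theorem markovKernel_pos (h : IsSLPair I p q u v c) (hx : x ∈ I) (hs : s ∈ I) :
    0 < markovKernel p q x s :=
  mul_pos (h.left_pos _ (min_rec' (· ∈ I) hx hs)) (h.right_pos _ (max_rec' (· ∈ I) hx hs))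

theorem unitClamp_mem (h : IsSLPair I p q u v c) (s : ℝ) : unitClamp s ∈ I :=
  h.Icc_subset (_root_.unitClamp_mem s)

theorem sideWeight_pos (h : IsSLPair I p q u v c) (hs : s ∈ I) : 0 < sideWeight p q s :=
  div_pos (h.markovKernel_pos (h.unitClamp_mem s) hs)
    (h.markovKernel_pos (h.unitClamp_mem s) (h.unitClamp_mem s))

theorem sideWeight_eq_one (h : IsSLPair I p q u v c) (hs : s ∈ Set.Icc 0 1) :
    sideWeight p q s = 1 := by
  rw [sideWeight, unitClamp_of_mem hs]
  exact div_self (h.markovKernel_pos (h.Icc_subset hs) (h.Icc_subset hs)).ne'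

theorem markovKernel_eq_mul_sideWeight (h : IsSLPair I p q u v c) (hx : x ∈ Set.Icc 0 1) (s : ℝ) :
    markovKernel p q x s = markovKernel p q x (unitClamp s) * sideWeight p q s := by
  have hp₀ := (h.left_pos 0 (h.Icc_subset (by simp))).ne'
  have hq₀ := (h.right_pos 0 (h.Icc_subset (by simp))).ne'
  have hp₁ := (h.left_pos 1 (h.Icc_subset (by simp))).ne'
  have hq₁ := (h.right_pos 1 (h.Icc_subset (by simp))).ne'
  rcases le_total s 0 with hs₀ | hs₀
  · simp only [sideWeight, markovKernel, unitClamp_of_nonpos hs₀, min_eq_right (hs₀.trans hx.1),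
      max_eq_left (hs₀.trans hx.1), min_eq_right hx.1, max_eq_left hx.1, min_eq_right hs₀,
      max_eq_left hs₀, min_self, max_self]
    field_simp
  rcases le_total 1 s with hs₁ | hs₁
  · simp only [sideWeight, markovKernel, unitClamp_of_one_le hs₁, min_eq_left (hx.2.trans hs₁),
      max_eq_right (hx.2.trans hs₁), min_eq_left hx.2, max_eq_right hx.2, min_eq_left hs₁,
      max_eq_right hs₁, min_self, max_self]
    field_simp
  · rw [h.sideWeight_eq_one ⟨hs₀, hs₁⟩, unitClamp_of_mem ⟨hs₀, hs₁⟩, mul_one]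

theorem continuousOn_markovKernel (h : IsSLPair I p q u v c) {f g : ℝ → ℝ} (hf : Continuous f)
    (hg : Continuous g) (hfI : Set.MapsTo f I I) (hgI : Set.MapsTo g I I) :
    ContinuousOn (fun s => markovKernel p q (f s) (g s)) I :=
  (h.left.contDiffOn.continuousOn.comp (hf.min hg).continuousOn fun _ hs =>
      min_rec' (· ∈ I) (hfI hs) (hgI hs)).mul
    (h.right.contDiffOn.continuousOn.comp (hf.max hg).continuousOn fun _ hs =>
      max_rec' (· ∈ I) (hfI hs) (hgI hs))

theorem continuousOn_sideWeight (h : IsSLPair I p q u v c) : ContinuousOn (sideWeight p q) I :=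
  have hclamp : Set.MapsTo unitClamp I I := fun s _ => h.unitClamp_mem s
  (h.continuousOn_markovKernel continuous_unitClamp continuous_id hclamp (Set.mapsTo_id I)).div
    (h.continuousOn_markovKernel continuous_unitClamp continuous_unitClamp hclamp hclamp)
    fun s _ => (h.markovKernel_pos (h.unitClamp_mem s) (h.unitClamp_mem s)).ne'

theorem isSideDomain_of_isCompact (h : IsSLPair I p q u v c) (hJ : IsCompact J)
    (hU : unitIoo ⊆ J) (hJI : J ⊆ I) : IsSideDomain I p q J where
  measurableSet := hJ.measurableSet
  unitIoo_subset := hU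
  subset := hJI
  memLp := by
    have : IsFiniteMeasure (volume.restrict J) := isFiniteMeasure_restrict.2 hJ.measure_ne_top
    have hcont := h.continuousOn_sideWeight.mono hJI
    obtain ⟨C, hC⟩ := hJ.exists_bound_of_continuousOn hcont
    refine .of_bound (hcont.aestronglyMeasurable hJ.measurableSet) C ?_
    filter_upwards [ae_restrict_mem hJ.measurableSet] with s hs using hC s hs

theorem sideMeasure_restrict_unitIoo (h : IsSLPair I p q u v c) (hU : unitIoo ⊆ J) :
    (sideMeasure p q J).restrict unitIoo = unitVolume := by
  rw [sideMeasure, restrict_withDensity measurableSet_Ioo, Measure.restrict_restrict_of_subset hU]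
  refine (withDensity_congr_ae ?_).trans withDensity_one
  filter_upwards [ae_restrict_mem measurableSet_Ioo] with s hs
  rw [h.sideWeight_eq_one (Set.Ioo_subset_Icc_self hs), one_pow, ENNReal.ofReal_one, Pi.one_apply]

theorem sideMeasure_ne_zero (h : IsSLPair I p q u v c) (hJ : IsSideDomain I p q J) {A : Set ℝ}
    (hA : MeasurableSet A) (hAJ : volume (A ∩ J) ≠ 0) : sideMeasure p q J A ≠ 0 := by
  rw [← Measure.restrict_apply hA] at hAJ
  refine fun h₀ => hAJ (withDensity_absolutelyContinuous' ?_ ?_ h₀)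
  · exact (hJ.memLp.1.aemeasurable.pow_const 2).ennreal_ofReal
  · filter_upwards [ae_restrict_mem hJ.measurableSet] with s hs
    have := h.sideWeight_pos (hJ.subset hs)
    exact (ENNReal.ofReal_pos.2 (by positivity)).ne'

end IsSLPair

theorem IsSideDomain.isFiniteMeasure (hJ : IsSideDomain I p q J) :
    IsFiniteMeasure (sideMeasure p q J) :=
  isFiniteMeasure_withDensity_ofReal hJ.memLp.integrable_sq.2

end SideMeasure

section SideMeasurePi

variable {d : ℕ} {I J : Fin d → Set ℝ} {p q u v : Fin d → ℝ → ℝ} {c : Fin d → ℝ}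

theorem pi_sideMeasure (hJ : ∀ j, IsSideDomain (I j) (p j) (q j) (J j)) :
    Measure.pi (fun j => sideMeasure (p j) (q j) (J j))
      = (volume.restrict (Set.univ.pi J)).withDensity fun s =>
          ENNReal.ofReal ((∏ j, sideWeight (p j) (q j) (s j)) ^ 2) := by
  simp only [sideMeasure]
  rw [pi_withDensity_ofReal (fun j => (hJ j).memLp.integrable_sq) fun _ _ => sq_nonneg _,
    volume_pi, Measure.restrict_pi_pi]
  simp only [Finset.prod_pow]

theorem aemeasurable_prod_sideWeight (hJ : ∀ j, IsSideDomain (I j) (p j) (q j) (J j)) :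
    AEMeasurable (fun s : Fin d → ℝ => ∏ j, sideWeight (p j) (q j) (s j))
      (volume.restrict (Set.univ.pi J)) := by
  rw [volume_pi, Measure.restrict_pi_pi]
  exact Finset.aemeasurable_fun_prod _ fun j _ =>
    (hJ j).memLp.1.aemeasurable.comp_quasiMeasurePreserving
      (Measure.quasiMeasurePreserving_eval _ j)

theorem prod_sideWeight_ne_zero (h : ∀ j, IsSLPair (I j) (p j) (q j) (u j) (v j) (c j))
    {s : Fin d → ℝ} (hs : s ∈ Set.univ.pi I) : ∏ j, sideWeight (p j) (q j) (s j) ≠ 0 :=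
  Finset.prod_ne_zero_iff.2 fun j _ => ((h j).sideWeight_pos (hs j trivial)).ne'

theorem memLp_pi_sideMeasure_iff (h : ∀ j, IsSLPair (I j) (p j) (q j) (u j) (v j) (c j))
    (hJ : ∀ j, IsSideDomain (I j) (p j) (q j) (J j)) {f : (Fin d → ℝ) → ℝ} :
    MemLp f 2 (Measure.pi fun j => sideMeasure (p j) (q j) (J j)) ↔
      MemLp (fun s => f s * ∏ j, sideWeight (p j) (q j) (s j)) 2
        (volume.restrict (Set.univ.pi J)) := by
  rw [pi_sideMeasure hJ]
  refine memLp_two_withDensity_sq (aemeasurable_prod_sideWeight hJ) ?_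
  filter_upwards [ae_restrict_mem (MeasurableSet.univ_pi fun j => (hJ j).measurableSet)] with s hs
  exact prod_sideWeight_ne_zero h (Set.pi_mono (fun j _ => (hJ j).subset) hs)

/-- The transform `∫ ∏ k_j(x_j, κ(s_j)) w(s) dm(s)` for `k_j = markovKernel (p j) (q j)`,
`κ = unitClamp` and the product `m` of the measures `sideMeasure (p j) (q j) (J j)`. -/
noncomputable def sideTransform (p q : Fin d → ℝ → ℝ) (J : Fin d → Set ℝ) (w : (Fin d → ℝ) → ℝ)
    (x : Fin d → ℝ) : ℝ :=
  ∫ s, (∏ j, kernelDeriv (p j) (q j) 0 (s j, x j)) * w s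
    ∂Measure.pi fun j => sideMeasure (p j) (q j) (J j)

theorem sideTransform_eq (h : ∀ j, IsSLPair (I j) (p j) (q j) (u j) (v j) (c j))
    (hJ : ∀ j, IsSideDomain (I j) (p j) (q j) (J j)) (w : (Fin d → ℝ) → ℝ) {x : Fin d → ℝ}
    (hx : x ∈ openCube d) :
    sideTransform p q J w x = ∫ s in Set.univ.pi J, (∏ j, markovKernel (p j) (q j) (x j) (s j)) *
      (w s * ∏ j, sideWeight (p j) (q j) (s j)) := by
  rw [sideTransform, pi_sideMeasure hJ, integral_withDensity_sq (aemeasurable_prod_sideWeight hJ)]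
  congr 1 with s
  have hprod : ∏ j, markovKernel (p j) (q j) (x j) (s j)
      = (∏ j, kernelDeriv (p j) (q j) 0 (s j, x j)) * ∏ j, sideWeight (p j) (q j) (s j) := by
    rw [← Finset.prod_mul_distrib]
    refine Finset.prod_congr rfl fun j _ => ?_
    rw [kernelDeriv_zero (Set.Ioo_subset_Icc_self (hx j)),
      (h j).markovKernel_eq_mul_sideWeight (Set.Ioo_subset_Icc_self (hx j))]
  rw [hprod]
  ring

end SideMeasurePi

/-! ### Kernel transforms have dominating mixed smoothness -/

namespace IsSLPair

variable {I : Set ℝ} {p q u v : ℝ → ℝ} {c : ℝ}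

theorem isBddMeas_kernelDeriv (h : IsSLPair I p q u v c) {n : ℕ} (hn : n ≤ 2) :
    IsBddMeas (kernelDeriv p q n) :=
  _root_.isBddMeas_kernelDeriv h.left.isOpen h.Icc_subset
    ((h.left.contDiffOn_two h.u_ne_zero).of_le (by exact_mod_cast hn))
    ((h.right.contDiffOn_two h.u_ne_zero).of_le (by exact_mod_cast hn))

theorem isBddMeas_kernelJump (h : IsSLPair I p q u v c) (n : ℕ) :
    IsBddMeas (kernelJump p q n) :=
  _root_.isBddMeas_kernelJump h.left.isOpen h.Icc_subset h.left.contDiffOn h.right.contDiffOn n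

end IsSLPair

section SideTransform

variable {d : ℕ} {I J : Fin d → Set ℝ} {p q u v : Fin d → ℝ → ℝ} {c : Fin d → ℝ} {α : Fin d → ℕ}

theorem integral_prod_kernelDeriv_mul_mixedPartial
    (h : ∀ j, IsSLPair (I j) (p j) (q j) (u j) (v j) (c j)) (hα : ∀ j, α j ≤ 2)
    {φ : (Fin d → ℝ) → ℝ} (hφ : IsTestFunction (openCube d) φ) (s : Fin d → ℝ) :
    ∫ x, (∏ j, kernelDeriv (p j) (q j) 0 (s j, x j)) * mixedPartial α φ x ∂cubeVolume d
      = (-1) ^ (∑ j, α j) * ∫ z, (∏ j, jumpWeight unitVolume unitIoo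
            (kernelDeriv (p j) (q j) (α j)) (kernelJump (p j) (q j) (α j)) (s j, z j))
          * φ (fun j => jumpPoint unitIoo (s j, z j))
          ∂Measure.pi fun _ => unitVolume.prod .count := by
  have hweight : ∀ j, IsBddMeas (jumpWeight unitVolume unitIoo (kernelDeriv (p j) (q j) (α j))
      (kernelJump (p j) (q j) (α j))) := fun j =>
    isBddMeas_jumpWeight measurableSet_Ioo ((h j).isBddMeas_kernelDeriv (hα j))
      ((h j).isBddMeas_kernelJump _)
  rw [integral_prod_mul_mixedPartial (m := fun _ => unitVolume)
    (θ := fun _ => unitVolume.prod .count)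
    (c := fun j x => kernelDeriv (p j) (q j) 0 (s j, x))
    (e := fun j z => (-1) ^ α j * jumpWeight unitVolume unitIoo (kernelDeriv (p j) (q j) (α j))
      (kernelJump (p j) (q j) (α j)) (s j, z))
    (r := fun j z => jumpPoint unitIoo (s j, z)) (fun j => ?_) (fun j => ?_) (fun j => ?_)
    (fun j ψ hψ => ?_) hφ]
  · simp only [Finset.prod_mul_distrib, Finset.prod_pow_eq_pow_sum, mul_assoc, integral_const_mul]
  · exact (((h j).isBddMeas_kernelDeriv zero_le_two).comp measurable_prodMk_left).integrable
  · exact (((hweight j).comp measurable_prodMk_left).integrable).const_mul _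
  · exact (measurable_jumpPoint measurableSet_Ioo).comp measurable_prodMk_left
  · simp only [mul_assoc, integral_const_mul]
    rw [integral_kernelDeriv_mul_iteratedDeriv (h j).left.isOpen (h j).Icc_subset
      ((h j).left.contDiffOn_two (h j).u_ne_zero) ((h j).right.contDiffOn_two (h j).u_ne_zero)
      (hα j) hψ, integral_jumpWeight_mul measurableSet_Ioo (by simp)
      ((h j).isBddMeas_kernelDeriv (hα j)) ((h j).isBddMeas_kernelJump _) hψ.isBddMeas]

theorem integral_sideTransform_mul (h : ∀ j, IsSLPair (I j) (p j) (q j) (u j) (v j) (c j))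
    (hJ : ∀ j, IsSideDomain (I j) (p j) (q j) (J j)) {w φ : (Fin d → ℝ) → ℝ}
    (hw : MemLp w 2 (Measure.pi fun j => sideMeasure (p j) (q j) (J j))) (hφ : IsBddMeas φ) :
    ∫ x, sideTransform p q J w x * φ x ∂cubeVolume d
      = ∫ s, w s * ∫ x, (∏ j, kernelDeriv (p j) (q j) 0 (s j, x j)) * φ x ∂cubeVolume d
          ∂Measure.pi fun j => sideMeasure (p j) (q j) (J j) := by
  have := fun j => (hJ j).isFiniteMeasure
  have hkernel := IsBddMeas.prod_prodMk fun j => (h j).isBddMeas_kernelDeriv zero_le_two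
  simp only [sideTransform, ← integral_mul_const, ← integral_const_mul]
  rw [integral_integral_swap]
  · simp only [mul_left_comm, mul_comm]
  · convert ((hkernel.comp measurable_swap).mul (hφ.comp measurable_fst)).integrable_mul
      ((hw.integrable one_le_two).comp_snd (cubeVolume d)) using 2 with z
    simp only [Function.uncurry, Prod.fst_swap, Prod.snd_swap]
    ring

theorem exists_memLp_integral_sideTransform_mul_mixedPartial
    (h : ∀ j, IsSLPair (I j) (p j) (q j) (u j) (v j) (c j))
    (hJ : ∀ j, IsSideDomain (I j) (p j) (q j) (J j)) {w : (Fin d → ℝ) → ℝ}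
    (hw : MemLp w 2 (Measure.pi fun j => sideMeasure (p j) (q j) (J j))) (hα : ∀ j, α j ≤ 2) :
    ∃ F, MemLp F 2 (cubeVolume d) ∧ ∀ φ, IsTestFunction (openCube d) φ →
      ∫ x, sideTransform p q J w x * mixedPartial α φ x ∂cubeVolume d
        = (-1) ^ (∑ j, α j) * ∫ x, F x * φ x ∂cubeVolume d := by
  have := fun j => (hJ j).isFiniteMeasure
  obtain ⟨F, hF, hFφ⟩ := exists_memLp_integral_mul_jump (ν := fun _ : Fin d => unitVolume)
    (U := unitIoo) measurableSet_Ioo (fun j => by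
      rw [(h j).sideMeasure_restrict_unitIoo (hJ j).unitIoo_subset, Measure.restrict_restrict
        measurableSet_Ioo, Set.inter_self])
    (fun j => (h j).isBddMeas_kernelDeriv (hα j)) (fun j => (h j).isBddMeas_kernelJump (α j)) hw
  refine ⟨F, hF, fun φ hφ => ?_⟩
  rw [integral_sideTransform_mul h hJ hw (hφ.mixedPartial α).isBddMeas, hFφ φ hφ.isBddMeas,
    ← integral_const_mul]
  simp only [integral_prod_kernelDeriv_mul_mixedPartial h hα hφ, mul_left_comm]

theorem memLp_sideTransform (h : ∀ j, IsSLPair (I j) (p j) (q j) (u j) (v j) (c j))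
    (hJ : ∀ j, IsSideDomain (I j) (p j) (q j) (J j)) {w : (Fin d → ℝ) → ℝ}
    (hw : MemLp w 2 (Measure.pi fun j => sideMeasure (p j) (q j) (J j))) :
    MemLp (sideTransform p q J w) 2 (cubeVolume d) := by
  have := fun j => (hJ j).isFiniteMeasure
  have hint := hw.integrable one_le_two
  have hkernel := (IsBddMeas.prod_prodMk fun j =>
    (h j).isBddMeas_kernelDeriv zero_le_two).comp measurable_swap
  obtain ⟨C, hC⟩ := hkernel.2
  have hmeas := (hkernel.integrable_mul (hint.comp_snd (cubeVolume d))).1.integral_prod_right'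
  simp only [mul_comm (w _)] at hmeas
  refine .of_bound hmeas
    (∫ s, C * ‖w s‖ ∂Measure.pi fun j => sideMeasure (p j) (q j) (J j)) (ae_of_all _ fun x => ?_)
  refine norm_integral_le_of_norm_le (hint.norm.const_mul C) (ae_of_all _ fun s => ?_)
  rw [norm_mul]
  exact mul_le_mul_of_nonneg_right (hC (x, s)) (norm_nonneg _)

end SideTransform

/-! ### Transforms belong to the Sobolev space -/

theorem IsSLPair.isSideDomain_self {I : Set ℝ} {p q u v : ℝ → ℝ} {c x : ℝ}
    (h : IsSLPair I p q u v c) (hx : x ∈ Set.Icc 0 1)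
    (hk : MemLp (markovKernel p q x) 2 (volume.restrict I)) : IsSideDomain I p q I where
  measurableSet := h.left.isOpen.measurableSet
  unitIoo_subset := Set.Ioo_subset_Icc_self.trans h.Icc_subset
  subset := le_rfl
  memLp := by
    have hpos : ∀ s ∈ Set.Icc (0 : ℝ) 1, 0 < markovKernel p q x s := fun s hs =>
      h.markovKernel_pos (h.Icc_subset hx) (h.Icc_subset hs)
    have hcont : ContinuousOn (markovKernel p q x) I :=
      h.continuousOn_markovKernel continuous_const continuous_id
        (fun _ _ => h.Icc_subset hx) (Set.mapsTo_id I)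
    obtain ⟨-, C, hC⟩ := isBddMeas_comp_unitClamp
      ((hcont.mono h.Icc_subset).inv₀ fun s hs => (hpos s hs).ne')
    refine hk.of_le_mul (c := C)
      (h.continuousOn_sideWeight.aestronglyMeasurable h.left.isOpen.measurableSet)
      (ae_of_all _ fun s => ?_)
    calc ‖sideWeight p q s‖
        = ‖(markovKernel p q x (unitClamp s))⁻¹‖ * ‖markovKernel p q x s‖ := by
          rw [← norm_mul, h.markovKernel_eq_mul_sideWeight hx s,
            inv_mul_cancel_left₀ (hpos _ (_root_.unitClamp_mem s)).ne']
      _ ≤ C * ‖markovKernel p q x s‖ := mul_le_mul_of_nonneg_right (hC s) (norm_nonneg _)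

namespace TensorMarkovKernel

variable {d : ℕ} {T : TensorMarkovKernel d} {j : Fin d}

theorem TransformRegular.memLp_kernel₁ (hT : T.TransformRegular j)
    (hk : Continuous fun z : T.interval j × T.interval j => T.kernel₁ j z.1 z.2) {x : ℝ}
    (hx : x ∈ unitIoo) : MemLp (T.kernel₁ j x) 2 (volume.restrict (T.interval j)) := by
  have hI := T.measurableSet_interval j
  have hcont : ContinuousOn (T.kernel₁ j x) (T.interval j) := by
    rw [continuousOn_iff_continuous_domRestrict]
    exact hk.comp (Continuous.prodMk_right (⟨x, T.unitIoo_subset j hx⟩ : T.interval j))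
  have hmeas := hcont.aestronglyMeasurable (μ := volume) hI
  refine (memLp_congr_ae hmeas.ae_eq_mk).2 (memLp_two_of_forall_integrable_mul
    hmeas.stronglyMeasurable_mk.measurable fun w hw => ?_)
  have hint := (hT (fun s => w s) ((memLp_subtype_iff hI fun _ => rfl).2 hw)).1 x hx
  rw [integrable_subtype_iff hI (F := fun s => T.kernel₁ j x s * w s) fun _ => rfl] at hint
  refine hint.congr ?_
  filter_upwards [hmeas.ae_eq_mk] with s hs
  rw [← hs]

theorem box_eq_pi : T.box = Set.univ.pi T.interval := by
  ext x
  simp only [box, Set.mem_ofPred_eq, Set.mem_univ_pi]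

theorem measurableSet_box : MeasurableSet T.box := by
  rw [box_eq_pi]
  exact MeasurableSet.univ_pi T.measurableSet_interval

namespace SturmLiouville

variable (hT : T.SturmLiouville)

include hT

theorem isSideDomain_interval (j : Fin d) :
    IsSideDomain (T.interval j) (T.p j) (T.q j) (T.interval j) := by
  obtain ⟨⟨u, v, hS, -⟩, -, hregular⟩ := hT j
  obtain ⟨u', v', c, h⟩ := hT.exists_isSLPair j
  have hhalf : (1 / 2 : ℝ) ∈ unitIoo := ⟨by norm_num, by norm_num⟩
  exact h.isSideDomain_self (Set.Ioo_subset_Icc_self hhalf)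
    (hregular.memLp_kernel₁ hS.continuous_kernel₁ hhalf)

theorem continuous_kernel : Continuous fun z : T.box × T.box => T.kernel z.1 z.2 := by
  refine continuous_finsetProd _ fun j _ => ?_
  obtain ⟨⟨u, v, hS, -⟩, -⟩ := hT j
  have hcoord : Continuous fun x : T.box => (⟨x.1 j, x.2 j⟩ : T.interval j) :=
    ((continuous_apply j).comp continuous_subtype_val).subtype_mk _
  exact hS.continuous_kernel₁.comp (hcoord.prodMap hcoord)

theorem continuous_of_mem_restrSpaceTwo {g : openCube d → ℝ} (hg : g ∈ T.restrSpaceTwo) :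
    Continuous g := by
  obtain ⟨h, -, hh⟩ := hg
  rw [← funext hh]
  exact (continuous_coe_ofKernel hT.continuous_kernel h).comp (continuous_inclusion _)

theorem mem_mixedSobolev_of_mem_restrSpaceTwo {g : openCube d → ℝ} (hg : g ∈ T.restrSpaceTwo) :
    g ∈ mixedSobolev d 2 := by
  choose u v c h using hT.exists_isSLPair
  have hdomain := hT.isSideDomain_interval
  obtain ⟨f, ⟨w, hw, hfw⟩, hfg⟩ := hg
  set W := Function.extend Subtype.val w 0
  have hW : ∀ s : T.box, w s = W s := fun s => (extend_val_of_mem w s.2).symm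
  let V : (Fin d → ℝ) → ℝ := fun s => W s / ∏ j, sideWeight (T.p j) (T.q j) (s j)
  have hV : ∀ s : T.box, V s * ∏ j, sideWeight (T.p j) (T.q j) (s.1 j) = w s := fun s => by
    rw [hW, div_mul_cancel₀ _ (prod_sideWeight_ne_zero h (box_eq_pi.subset s.2))]
  have hVm : MemLp V 2 (Measure.pi fun j => sideMeasure (T.p j) (T.q j) (T.interval j)) := by
    rw [memLp_pi_sideMeasure_iff h hdomain, ← box_eq_pi]
    exact (memLp_subtype_iff measurableSet_box fun s => (hV s).symm).1 hw
  refine (mem_mixedSobolev_iff (G := sideTransform T.p T.q T.interval V) fun x => ?_).2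
    ⟨memLp_sideTransform h hdomain hVm,
      fun α hα => exists_memLp_integral_sideTransform_mul_mixedPartial h hdomain hVm hα⟩
  rw [← hfg, (hfw _).2, sideTransform_eq h hdomain V x.2, ← box_eq_pi]
  refine integral_subtype_eq measurableSet_box fun s => ?_
  rw [hV]
  rfl

end SturmLiouville

end TensorMarkovKernel

/-! ### Sobolev functions are transforms -/

theorem measure_inter_ne_zero_of_mem_closure_interior {X : Type*} [TopologicalSpace X]
    [MeasurableSpace X] {μ : Measure X} [μ.IsOpenPosMeasure] {A J : Set X} {x : X}
    (hA : x ∈ closure (interior A)) (hJ : x ∈ interior J) : μ (A ∩ J) ≠ 0 := by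
  refine (Measure.measure_pos_of_nonempty_interior μ ?_).ne'
  rw [interior_inter, Set.inter_comm]
  exact mem_closure_iff.1 hA _ isOpen_interior hJ

theorem IsSLPair.representsOnChains {I : Set ℝ} {p q u v ψ : ℝ → ℝ} {c : ℝ}
    (h : IsSLPair I p q u v c) (hψ : IsTestFunction unitIoo ψ) :
    RepresentsOnChains (fun n x => inverseTerm p q u v c (markovTransform p q ψ) n (unitClamp x))
      ψ where
  isBddMeas n := isBddMeas_comp_unitClamp
    ((((h.continuousOn_interiorCoeff n).mul (h.continuousOn_markovTransform hψ)).add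
      ((continuous_zeroCoeff n).continuousOn.mul continuousOn_const)).add
      ((continuous_oneCoeff n).continuousOn.mul continuousOn_const))
  integral_mul_eq_sum f hf := by
    rw [h.integral_mul_eq_sum_inverseTerm hf.zero_one hf.one_two hψ]
    refine Finset.sum_congr rfl fun n _ => setIntegral_congr_fun measurableSet_Ioo fun x hx => ?_
    rw [unitClamp_of_mem (Set.Ioo_subset_Icc_self hx)]
    fin_cases n <;> rfl

section Inverse

variable {d : ℕ} {I J : Fin d → Set ℝ} {p q u v : Fin d → ℝ → ℝ} {c : Fin d → ℝ}
  {f : (Fin d → Fin 3) → (Fin d → ℝ) → ℝ}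

/-- In each variable, integration against `ψ` is a combination of integrations of weak derivatives
against multiples of `Ψ`, `Ψ 0` and `Ψ 1` for `Ψ = markovTransform p q ψ`, and `Ψ 0`, `Ψ 1` are
means of `Ψ ∘ unitClamp` over `(-∞, 0]` and `[1, ∞)`. -/
theorem exists_memLp_integral_mul_prod_markovTransform
    (h : ∀ j, IsSLPair (I j) (p j) (q j) (u j) (v j) (c j)) {ν : Fin d → Measure ℝ}
    [∀ j, IsFiniteMeasure (ν j)] (hν : ∀ j, (ν j).restrict unitIoo = unitVolume)
    (hν₀ : ∀ j, ν j (Set.Iic 0) ≠ 0) (hν₁ : ∀ j, ν j (Set.Ici 1) ≠ 0)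
    (hf : IsTensorWeakFamily f) (hf₂ : ∀ α, MemLp (f α) 2 (cubeVolume d)) :
    ∃ w, MemLp w 2 (Measure.pi ν) ∧ ∀ ψ : Fin d → ℝ → ℝ, (∀ j, IsTestFunction unitIoo (ψ j)) →
      ∫ s, w s * ∏ j, markovTransform (p j) (q j) (ψ j) (unitClamp (s j)) ∂Measure.pi ν
        = ∫ x, f 0 x * ∏ j, ψ j (x j) ∂cubeVolume d := by
  have hνU : ∀ j, ν j unitIoo ≠ 0 := fun j => by
    rw [← Measure.restrict_apply_self, hν j, Measure.restrict_apply_self]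
    simp [unitIoo]
  choose W hW hWφ using fun α : Fin d → Fin 3 =>
    exists_memLp_integral_mul_prod_jumpOp (μ := fun _ => unitVolume) measurableSet_Ioo
      (fun j => by
        rw [hν j, Measure.restrict_restrict measurableSet_Ioo, Set.inter_self]) hνU
      (fun j => isBddMeas_boundaryKernel (ν j) (continuous_zeroCoeff (p := p j) (u := u j)
        (c := c j) (α j)) (continuous_oneCoeff (q := q j) (u := u j) (c := c j) (α j)))
      (fun j => isBddMeas_comp_unitClamp ((h j).continuousOn_interiorCoeff (α j))) (hf₂ α)
  refine ⟨∑ α, W α, memLp_finsetSum' _ fun α _ => hW α, fun ψ hψ => ?_⟩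
  have hΨ : ∀ j, IsBddMeas fun s => markovTransform (p j) (q j) (ψ j) (unitClamp s) := fun j =>
    isBddMeas_comp_unitClamp ((h j).continuousOn_markovTransform (hψ j))
  have hint : ∀ α ∈ Finset.univ, Integrable (fun s => W α s *
      ∏ j, markovTransform (p j) (q j) (ψ j) (unitClamp (s j))) (Measure.pi ν) := fun α _ =>
    integrable_mul_prod ((hW α).integrable one_le_two) hΨ
  rw [hf.integral_mul_prod_eq_sum (fun j => (hψ j).isBddMeas)
    fun j => (h j).representsOnChains (hψ j)]
  simp only [Finset.sum_apply, Finset.sum_mul]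
  rw [integral_finsetSum _ hint]
  refine Finset.sum_congr rfl fun α _ => ?_
  rw [hWφ α _ hΨ]
  change ∫ x, _ ∂cubeVolume d = _
  rw [← volume_restrict_openCube]
  refine setIntegral_congr_fun (measurableSet_openCube d) fun x hx => ?_
  congr 1
  refine Finset.prod_congr rfl fun j _ => ?_
  rw [jumpOp_boundaryKernel ((measureReal_ne_zero_iff (measure_ne_top _ _)).2 (hν₀ j))
    ((measureReal_ne_zero_iff (measure_ne_top _ _)).2 (hν₁ j)) (hx j),
    unitClamp_of_mem (Set.Ioo_subset_Icc_self (hx j)), IsSLPair.inverseTerm]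

theorem integral_sideTransform_mul_prod (h : ∀ j, IsSLPair (I j) (p j) (q j) (u j) (v j) (c j))
    (hJ : ∀ j, IsSideDomain (I j) (p j) (q j) (J j)) {w : (Fin d → ℝ) → ℝ}
    (hw : MemLp w 2 (Measure.pi fun j => sideMeasure (p j) (q j) (J j))) {ψ : Fin d → ℝ → ℝ}
    (hψ : ∀ j, IsTestFunction unitIoo (ψ j)) :
    ∫ x, sideTransform p q J w x * ∏ j, ψ j (x j) ∂cubeVolume d
      = ∫ s, w s * ∏ j, markovTransform (p j) (q j) (ψ j) (unitClamp (s j))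
          ∂Measure.pi fun j => sideMeasure (p j) (q j) (J j) := by
  rw [integral_sideTransform_mul h hJ hw (IsBddMeas.pi_prod fun j => (hψ j).isBddMeas)]
  refine integral_congr_ae (ae_of_all _ fun s => congrArg (w s * ·) ?_)
  simp only [← Finset.prod_mul_distrib]
  rw [integral_fintype_prod_eq_prod fun j x => kernelDeriv (p j) (q j) 0 (s j, x) * ψ j x]
  refine Finset.prod_congr rfl fun j _ => ?_
  rw [← integral_markovKernel_mul ((h j).left.contDiffOn.continuousOn.mono (h j).Icc_subset)
    ((h j).right.contDiffOn.continuousOn.mono (h j).Icc_subset) (hψ j).continuous]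
  refine setIntegral_congr_fun measurableSet_Ioo fun x hx => ?_
  rw [kernelDeriv_zero (Set.Ioo_subset_Icc_self hx)]

theorem exists_sideTransform_ae_eq (h : ∀ j, IsSLPair (I j) (p j) (q j) (u j) (v j) (c j))
    (hJ : ∀ j, IsSideDomain (I j) (p j) (q j) (J j)) (hJ₀ : ∀ j, volume (Set.Iic 0 ∩ J j) ≠ 0)
    (hJ₁ : ∀ j, volume (Set.Ici 1 ∩ J j) ≠ 0) (hf : IsTensorWeakFamily f)
    (hf₂ : ∀ α, MemLp (f α) 2 (cubeVolume d)) :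
    ∃ w, MemLp w 2 (Measure.pi fun j => sideMeasure (p j) (q j) (J j)) ∧
      sideTransform p q J w =ᵐ[cubeVolume d] f 0 := by
  have := fun j => (hJ j).isFiniteMeasure
  obtain ⟨w, hw, hwψ⟩ := exists_memLp_integral_mul_prod_markovTransform h
    (fun j => (h j).sideMeasure_restrict_unitIoo (hJ j).unitIoo_subset)
    (fun j => (h j).sideMeasure_ne_zero (hJ j) measurableSet_Iic (hJ₀ j))
    (fun j => (h j).sideMeasure_ne_zero (hJ j) measurableSet_Ici (hJ₁ j)) hf hf₂
  have hint := (memLp_sideTransform h hJ hw).integrable one_le_two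
  refine ⟨w, hw, (sub_ae_eq_zero _ _).1 ?_⟩
  refine ae_eq_zero_of_integral_mul_prod_test (hint.sub (hf.integrable 0)) fun ψ hψ => ?_
  have hbdd := fun j => (hψ j).isBddMeas
  simp only [Pi.sub_apply, sub_mul]
  rw [integral_sub (integrable_mul_prod hint hbdd) (integrable_mul_prod (hf.integrable 0) hbdd),
    integral_sideTransform_mul_prod h hJ hw hψ, hwψ ψ hψ, sub_self]

end Inverse

namespace TensorMarkovKernel

variable {d : ℕ} {T : TensorMarkovKernel d}

namespace SturmLiouville

variable (hT : T.SturmLiouville)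

include hT

theorem exists_mem_spaceTwo_of_isCompact {J : Set (Fin d → ℝ)} (hJ : IsCompact J)
    (hJT : J ⊆ T.box) {w : (Fin d → ℝ) → ℝ} (hw : MemLp w 2 (volume.restrict J)) :
    ∃ h ∈ T.spaceTwo, ∀ x : T.box, h x = ∫ s in J, T.kernel x s * w s := by
  have hk := hT.continuous_kernel
  have hbox := measurableSet_box (T := T)
  set V : (Fin d → ℝ) → ℝ := J.indicator w
  have hVJ : ∀ s ∉ J, V s = 0 := fun s hs => Set.indicator_of_notMem hs w
  have hV : MemLp V 2 (volume.restrict T.box) :=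
    ((memLp_indicator_iff_restrict hJ.measurableSet).2 hw).restrict _
  have hVint : Integrable fun s : T.box => V s := by
    have : IsFiniteMeasure (volume.restrict J) := isFiniteMeasure_restrict.2 hJ.measure_ne_top
    exact (integrable_subtype_iff hbox fun _ => rfl).2
      ((integrable_indicator_iff hJ.measurableSet).2 (hw.integrable one_le_two)).integrableOn
  have hJ' : IsCompact (Subtype.val ⁻¹' J : Set T.box) := by
    rw [Subtype.isCompact_iff, Subtype.image_preimage_coe, Set.inter_eq_self_of_subset_right hJT]
    exact hJ
  have hkV : ∀ x : T.box, Integrable fun s : T.box => T.kernel x s * V s := fun x => by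
    obtain ⟨C, hC⟩ := hJ'.exists_bound_of_continuousOn
      (hk.comp (Continuous.prodMk_right x)).continuousOn
    refine (hVint.norm.const_mul C).mono'
      ((hk.comp (Continuous.prodMk_right x)).aestronglyMeasurable.mul hVint.1)
      (ae_of_all _ fun s => ?_)
    rw [norm_mul]
    by_cases hs : (s : Fin d → ℝ) ∈ J
    · exact mul_le_mul_of_nonneg_right (hC s hs) (norm_nonneg _)
    · simp [hVJ s hs]
  obtain ⟨h, hh⟩ := exists_coe_eq_integral (k := fun x y : T.box => T.kernel x y) hk hVint hJ'
    fun s hs => hVJ s hs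
  refine ⟨h, ⟨fun s => V s, (memLp_subtype_iff hbox fun _ => rfl).2 hV,
    fun x => ⟨hkV x, hh x⟩⟩, fun x => ?_⟩
  rw [hh x, integral_subtype_eq hbox (F := J.indicator fun s => T.kernel x s * w s) fun s => ?_,
    setIntegral_indicator hJ.measurableSet, Set.inter_eq_self_of_subset_right hJT]
  exact (Set.indicator_mul_right J (fun s => T.kernel x s) w).symm

theorem exists_mem_restrSpaceTwo {g : openCube d → ℝ} (hg : g ∈ mixedSobolev d 2) :
    ∃ h ∈ T.restrSpaceTwo, h =ᵐ[volume] g := by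
  choose u v c h using hT.exists_isSLPair
  choose J hJ hIccJ hJI using fun j => exists_compact_between isCompact_Icc (T.isOpen_interval j)
    (h j).Icc_subset
  have hdomain : ∀ j, IsSideDomain (T.interval j) (T.p j) (T.q j) (J j) := fun j =>
    (h j).isSideDomain_of_isCompact (hJ j)
      (Set.Ioo_subset_Icc_self.trans ((hIccJ j).trans interior_subset)) (hJI j)
  obtain ⟨f, hf₀, hf₂, hf⟩ := exists_isTensorWeakFamily_of_mem_mixedSobolev hg
    fun x => (extend_val_of_mem g x.2).symm
  obtain ⟨w, hw, hwf⟩ := exists_sideTransform_ae_eq h hdomain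
    (fun j => measure_inter_ne_zero_of_mem_closure_interior (x := 0) (by simp)
      (hIccJ j (by simp)))
    (fun j => measure_inter_ne_zero_of_mem_closure_interior (x := 1) (by simp)
      (hIccJ j (by simp))) hf hf₂
  obtain ⟨k, hk, hkw⟩ := hT.exists_mem_spaceTwo_of_isCompact (isCompact_univ_pi hJ)
    (box_eq_pi (T := T) ▸ Set.pi_mono fun j _ => hJI j)
    ((memLp_pi_sideMeasure_iff h hdomain).1 hw)
  refine ⟨fun x => k (Set.inclusion T.openCube_subset x), ⟨k, hk, fun _ => rfl⟩, ?_⟩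
  rw [← volume_restrict_openCube] at hwf
  filter_upwards [(ae_subtype_iff (measurableSet_openCube d)).2 hwf] with x hx
  rw [hkw, ← extend_val_of_mem g x.2, ← hf₀, ← hx, sideTransform_eq h hdomain w x.2]
  rfl

end SturmLiouville

end TensorMarkovKernel

theorem mainTheorem6 {d : ℕ} (T : TensorMarkovKernel d) (hT : T.SturmLiouville) :
    (∀ g : openCube d → ℝ, g ∈ T.restrSpaceTwo ↔ Continuous g ∧ g ∈ mixedSobolev d 2) ∧
    (∀ g : openCube d → ℝ,
      g ∈ mixedSobolev d 2 ↔ ∃ h ∈ T.restrSpaceTwo, h =ᵐ[volume] g) := by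
  refine ⟨fun g => ⟨fun hg => ⟨hT.continuous_of_mem_restrSpaceTwo hg,
    hT.mem_mixedSobolev_of_mem_restrSpaceTwo hg⟩, fun ⟨hcont, hg⟩ => ?_⟩, fun g =>
    ⟨hT.exists_mem_restrSpaceTwo, fun ⟨h, hh, hhg⟩ =>
      mem_mixedSobolev_of_ae_eq hhg (hT.mem_mixedSobolev_of_mem_restrSpaceTwo hh)⟩⟩
  obtain ⟨h, hh, hhg⟩ := hT.exists_mem_restrSpaceTwo hg
  rwa [← eq_of_continuous_of_ae_eq (isOpen_openCube d) (hT.continuous_of_mem_restrSpaceTwo hh)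
    hcont hhg]
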